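/- Let $n\ge 0$ and $\lambda\in\mathbb R\setminus\{0\}$. Write points of $\mathbb R^{2n}$ as $\xi=(x,u)$, $\eta=(a,b)$ with $x,u,a,b\in\mathbb R^n$, let $[(x,u),(y,v)]=u\cdot y-x\cdot v$, and define on $\mathcal S(\mathbb R^{2n})$ the twisted translations and twisted modulations $$\tau_\lambda(\xi)g(t)=g(t-\xi)\,e^{-i\frac{\lambda}{2}[t,\xi]},\qquad e_\lambda(a,b)g(x,u)=g\big(x-(\tanh\tfrac{\lambda}{2})b,\;u+(\tanh\tfrac{\lambda}{2})a\big)\,e^{-i\frac{\lambda}{2}(\coth\frac{\lambda}{2})(x\cdot a+u\cdot b)},$$ and $\Pi_\lambda(\xi,\eta)=e^{i\frac{\lambda}{2}(\coth\lambda)\,\xi\cdot\eta}\,e_\lambda(\eta)\,\tau_\lambda(\xi)$. For $f\in\mathcal S'(\mathbb R^{2n})$ and $g\in\mathcal S(\mathbb R^{2n})$ put $V_gf(\xi,\eta)=\langle f,\Pi_\lambda(\xi,\eta)g\rangle$, where $\langle f,\varphi\rangle=f(\overline{\varphi})$. For $1\le p,q\le\infty$ let $L^{p,q}(\mathbb R^{2n}\times\mathbb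 R^{2n})$ be the space of measurable functions $F$ with finite norm $$\|F\|_{p,q}=\Big(\int_{\mathbb R^{2n}}\Big(\int_{\mathbb R^{2n}}|F(\xi,\eta)|^p\,d\xi\Big)^{q/p}d\eta\Big)^{1/q}$$ (essential suprema if $p=\infty$ or $q=\infty$). The twisted modulation space $M_\lambda^{p,q}(\mathbb R^{2n})$ is the set of all tempered distributions $f$ on $\mathbb R^{2n}$ with $V_gf\in L^{p,q}(\mathbb R^{2n}\times\mathbb R^{2n})$ for some nonzero $g\in\mathcal S(\mathbb R^{2n})$. (i) For $1\le p,q\le\infty$, $M_\lambda^{p,q}(\mathbb R^{2n})$ is a linear subspace of $\mathcal S'(\mathbb R^{2n})$, and for every nonzero $g\in\mathcal S(\mathbb R^{2n})$ the expression $\|f\|_{(p,q)}=\|V_gf\|_{p,q}$ is a (finite) norm on it which makes it a Banach space. (ii) Let $1\le p,q<\infty$, $\frac1p+\frac1{p'}=1$, $\frac1q+\frac1{q'}=1$, and let $0\ne g\in\mathcal S(\mathbb R^{2n})$. Then $\mathcal S(\mathbb R^{2n})$ is contained and dense in $M_\lambda^{p,q}(\mathbb R^{2n})$, and the dual of $M_\lambda^{p,q}(\mathbb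 R^{2n})$ is $M_\lambda^{p',q'}(\mathbb R^{2n})$ under the pairing $$\langle f,h\rangle_\lambda=\int_{\mathbb R^{2n}}\int_{\mathbb R^{2n}}V_gf(\xi,\eta)\,\overline{V_gh(\xi,\eta)}\,d\xi\,d\eta .$$ That is: for $h\in M_\lambda^{p',q'}(\mathbb R^{2n})$ the integral converges absolutely and $f\mapsto\langle f,h\rangle_\lambda$ is a linear functional on $M_\lambda^{p,q}(\mathbb R^{2n})$ with $|\langle f,h\rangle_\lambda|\le\|V_gf\|_{p,q}\|V_gh\|_{p',q'}$; every bounded linear functional on $M_\lambda^{p,q}(\mathbb R^{2n})$ has this form for exactly one $h\in M_\lambda^{p',q'}(\mathbb R^{2n})$; and the norm of the functional is equivalent to $\|V_gh\|_{p',q'}$. (iii) If $1\le p_1\le p_2\le\infty$ and $1\le q_1\le q_2\le\infty$, then $M_\lambda^{p_1,q_1}(\mathbb R^{2n})\subseteq M_\lambda^{p_2,q_2}(\mathbb R^{2n})$. -/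

import Mathlib

open MeasureTheory
open scoped SchwartzMap ENNReal ComplexConjugate

noncomputable section

namespace TwistedMod

/-- The space `ℝ²ⁿ`, with Euclidean norm and Lebesgue measure. A point is `ξ = (x, u)` with
`x j = ξ (Sum.inl j)` and `u j = ξ (Sum.inr j)`. -/
abbrev Space (n : ℕ) := EuclideanSpace ℝ (Fin n ⊕ Fin n)

/-- The (bilinear) symplectic form `[(x, u), (y, v)] = u · y - x · v` on `R²ⁿ`, used for `R = ℝ`
and `R = ℂ`. -/
def symp {R : Type*} [CommRing R] {n : ℕ} (ζ ζ' : Fin n ⊕ Fin n → R) : R :=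
  ∑ j : Fin n, (ζ (Sum.inr j) * ζ' (Sum.inl j) - ζ (Sum.inl j) * ζ' (Sum.inr j))

/-- The (bilinear) dot product on `R²ⁿ`. -/
def dot {R : Type*} [CommRing R] {n : ℕ} (ζ ζ' : Fin n ⊕ Fin n → R) : R :=
  ∑ j : Fin n, (ζ (Sum.inl j) * ζ' (Sum.inl j) + ζ (Sum.inr j) * ζ' (Sum.inr j))

/-- The rotation `(a, b) ↦ (-b, a)` of `ℝ²ⁿ`. -/
def rot {n : ℕ} (η : Space n) : Space n :=
  WithLp.toLp 2 (Sum.elim (fun j => -η (Sum.inr j)) (fun j => η (Sum.inl j)))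

/-- The hyperbolic cotangent (used only at nonzero arguments). -/
def coth (t : ℝ) : ℝ := Real.cosh t / Real.sinh t

/-! ### Twisted translations and twisted modulations of Schwartz functions -/

theorem hasTemperateGrowth_cexp_I :
    (fun t : ℝ => Complex.exp (Complex.I * t)).HasTemperateGrowth := by
  have hs : ∀ k : ℕ, iteratedDeriv k (fun t : ℝ => Complex.exp (Complex.I * t)) =
      fun t : ℝ => Complex.I ^ k * Complex.exp (Complex.I * t) := by
    intro k
    induction k with
    | zero => simp
    | succ k ih =>
      rw [iteratedDeriv_succ, ih]
      funext t
      have h1 : HasDerivAt (fun t : ℝ => Complex.I * (t : ℂ)) (Complex.I * 1) t :=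
        (Complex.ofRealCLM.hasDerivAt (x := t)).const_mul Complex.I
      have := (h1.cexp.const_mul (Complex.I ^ k)).deriv
      rw [this]
      ring
  refine ⟨(contDiff_const.mul Complex.ofRealCLM.contDiff).cexp, fun k => ⟨0, 1, fun t => ?_⟩⟩
  rw [norm_iteratedFDeriv_eq_norm_iteratedDeriv, hs k]
  have : ‖Complex.exp (Complex.I * t)‖ = 1 := by
    rw [mul_comm]; exact Complex.norm_exp_ofReal_mul_I t
  simp [this]

theorem hasTemperateGrowth_cexp_I_clm {n : ℕ} (L : Space n →L[ℝ] ℝ) :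
    (fun ξ : Space n => Complex.exp (Complex.I * (L ξ : ℝ))).HasTemperateGrowth :=
  hasTemperateGrowth_cexp_I.comp L.hasTemperateGrowth

/-- `ξ ↦ [ξ, η]` as a continuous linear map. -/
def sympCLM {n : ℕ} (η : Space n) : Space n →L[ℝ] ℝ :=
  LinearMap.toContinuousLinearMap
    { toFun := fun ξ => symp ξ η
      map_add' := fun a b => by
        simp only [symp, PiLp.add_apply, ← Finset.sum_add_distrib]
        exact Finset.sum_congr rfl fun j _ => by ring
      map_smul' := fun c a => by
        simp only [symp, PiLp.smul_apply, smul_eq_mul, RingHom.id_apply, Finset.mul_sum]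
        exact Finset.sum_congr rfl fun j _ => by ring }

/-- `ξ ↦ ξ · η` as a continuous linear map. -/
def dotCLM {n : ℕ} (η : Space n) : Space n →L[ℝ] ℝ :=
  LinearMap.toContinuousLinearMap
    { toFun := fun ξ => dot ξ η
      map_add' := fun a b => by
        simp only [dot, PiLp.add_apply, ← Finset.sum_add_distrib]
        exact Finset.sum_congr rfl fun j _ => by ring
      map_smul' := fun c a => by
        simp only [dot, PiLp.smul_apply, smul_eq_mul, RingHom.id_apply, Finset.mul_sum]
        exact Finset.sum_congr rfl fun j _ => by ring }

/-- The `λ`-twisted translation `τ_λ(ξ)` on Schwartz functions,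
`τ_λ(ξ) g (t) = g (t - ξ) exp (-i (λ/2) [t, ξ])`; see `twistedTranslation_apply`. -/
def twistedTranslation {n : ℕ} (lam : ℝ) (ξ : Space n) : 𝓢(Space n, ℂ) →L[ℂ] 𝓢(Space n, ℂ) :=
  SchwartzMap.smulLeftCLM ℂ
      (fun t : Space n => Complex.exp (Complex.I * ((-(lam / 2) * symp t ξ : ℝ) : ℂ))) ∘L
    SchwartzMap.compSubConstCLM ℂ ξ

/-- The `λ`-twisted modulation `e_λ(η)` on Schwartz functions, for `η = (a, b)`,
`e_λ(a, b) g (x, u) = g (x - tanh (λ/2) b, u + tanh (λ/2) a)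
  exp (-i (λ/2) coth (λ/2) (x · a + u · b))`; see `twistedModulation_apply`. -/
def twistedModulation {n : ℕ} (lam : ℝ) (η : Space n) : 𝓢(Space n, ℂ) →L[ℂ] 𝓢(Space n, ℂ) :=
  SchwartzMap.smulLeftCLM ℂ
      (fun t : Space n =>
        Complex.exp (Complex.I * ((-(lam / 2 * coth (lam / 2)) * dot t η : ℝ) : ℂ))) ∘L
    SchwartzMap.compSubConstCLM ℂ (-(Real.tanh (lam / 2) • rot η))

/-- The operators `Π_λ(ξ, η) = exp (i (λ/2) coth λ (ξ · η)) e_λ(η) τ_λ(ξ)`. These are the operators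
of the (projective) unitary representation of `ℂ²ⁿ` on `L²(ℝ²ⁿ)` that the twisted Bargmann transform
carries to the standard representation on the twisted Fock space, see `bargmann_twistedRep`. -/
def twistedRep {n : ℕ} (lam : ℝ) (ξ η : Space n) : 𝓢(Space n, ℂ) →L[ℂ] 𝓢(Space n, ℂ) :=
  Complex.exp (Complex.I * ((lam / 2 * coth lam * dot ξ η : ℝ) : ℂ)) •
    (twistedModulation lam η ∘L twistedTranslation lam ξ)

theorem twistedTranslation_apply {n : ℕ} (lam : ℝ) (ξ : Space n) (g : 𝓢(Space n, ℂ))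
    (t : Space n) :
    twistedTranslation lam ξ g t =
      Complex.exp (Complex.I * ((-(lam / 2) * symp t ξ : ℝ) : ℂ)) * g (t - ξ) := by
  have h := hasTemperateGrowth_cexp_I_clm ((-(lam / 2)) • sympCLM ξ)
  simp only [twistedTranslation, ContinuousLinearMap.comp_apply]
  erw [SchwartzMap.smulLeftCLM_apply_apply h]
  rfl

theorem twistedModulation_apply {n : ℕ} (lam : ℝ) (η : Space n) (g : 𝓢(Space n, ℂ))
    (t : Space n) :
    twistedModulation lam η g t =
      Complex.exp (Complex.I * ((-(lam / 2 * coth (lam / 2)) * dot t η : ℝ) : ℂ)) *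
        g (t + Real.tanh (lam / 2) • rot η) := by
  have h := hasTemperateGrowth_cexp_I_clm ((-(lam / 2 * coth (lam / 2))) • dotCLM η)
  simp only [twistedModulation, ContinuousLinearMap.comp_apply]
  erw [SchwartzMap.smulLeftCLM_apply_apply h]
  rw [SchwartzMap.compSubConstCLM_apply, sub_neg_eq_add]
  rfl

/-! ### The twisted Bargmann transform -/

/-- The (holomorphic extension to `ℂ²ⁿ` of the) heat kernel `p_t^λ` of the special Hermite
operator, `p_t^λ(ζ) = (4π)⁻ⁿ (λ / sinh (tλ))ⁿ exp (-(λ/4) coth (tλ) ζ · ζ)`. -/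
def heatKernel {n : ℕ} (lam t : ℝ) (ζ : Fin n ⊕ Fin n → ℂ) : ℂ :=
  (((4 * Real.pi) ^ n)⁻¹ * (lam / Real.sinh (t * lam)) ^ n : ℝ) *
    Complex.exp (-((lam / 4 * coth (t * lam) : ℝ) : ℂ) * dot ζ ζ)

/-- The twisted Bargmann transform `B_λ f(ζ) = c_λ p_1^λ(ζ)⁻¹ (f ∗_λ p_{1/2}^λ)(ζ)`, where
`c_λ = p_1^λ(0)` and `∗_λ` is the twisted convolution. -/
def bargmann {n : ℕ} (lam : ℝ) (f : Space n → ℂ) (ζ : Fin n ⊕ Fin n → ℂ) : ℂ :=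
  heatKernel lam 1 (0 : Fin n ⊕ Fin n → ℂ) * (heatKernel lam 1 ζ)⁻¹ *
    ∫ t : Space n, f t * (heatKernel lam (1 / 2) (fun j => ζ j - (t j : ℂ)) *
      Complex.exp (-Complex.I * (lam / 2 : ℝ) * symp ζ (fun j => (t j : ℂ))))

/-- The operators `ρ_λ(ζ')` on the twisted Fock space. -/
def fockRep {n : ℕ} (lam : ℝ) (ζ' : Fin n ⊕ Fin n → ℂ) (F : (Fin n ⊕ Fin n → ℂ) → ℂ)
    (ζ : Fin n ⊕ Fin n → ℂ) : ℂ :=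
  F (ζ - ζ') * Complex.exp ((lam / 2 * coth lam : ℝ) * dot ζ (star ζ')) *
    Complex.exp (-Complex.I * (lam / 2 : ℝ) * symp ζ (star ζ')) *
    Complex.exp (-(lam / 4 * coth lam : ℝ) * dot ζ' (star ζ')) *
    Complex.exp ((lam / 2 * symp (fun j => (ζ' j).re) (fun j => (ζ' j).im) : ℝ) : ℂ)

theorem twistedRep_apply {n : ℕ} (lam : ℝ) (ξ η : Space n) (g : 𝓢(Space n, ℂ)) (t : Space n) :
    twistedRep lam ξ η g t =
      Complex.exp (Complex.I * ((lam / 2 * coth lam * dot ξ η : ℝ) : ℂ)) *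
      (Complex.exp (Complex.I * ((-(lam / 2 * coth (lam / 2)) * dot t η : ℝ) : ℂ)) *
      (Complex.exp (Complex.I *
        ((-(lam / 2) * symp (t + Real.tanh (lam / 2) • rot η) ξ : ℝ) : ℂ)) *
        g (t + Real.tanh (lam / 2) • rot η - ξ))) := by
  rw [← twistedTranslation_apply, ← twistedModulation_apply]
  rfl

/-- On Schwartz functions `B_λ ∘ Π_λ(ξ, η) = ρ_λ(ξ + iη) ∘ B_λ`. -/
theorem bargmann_twistedRep {n : ℕ} {lam : ℝ} (hlam : lam ≠ 0) (ξ η : Space n)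
    (g : 𝓢(Space n, ℂ)) (ζ : Fin n ⊕ Fin n → ℂ) :
    bargmann lam (twistedRep lam ξ η g) ζ =
      fockRep lam (fun j => (ξ j : ℂ) + Complex.I * (η j : ℂ)) (bargmann lam g) ζ := by
  have hS : Real.sinh (lam / 2) ≠ 0 := by
    rw [Ne, Real.sinh_eq_zero]
    exact div_ne_zero hlam two_ne_zero
  have hCh : Real.cosh (lam / 2) ≠ 0 := (Real.cosh_pos _).ne'
  obtain ⟨C, hC⟩ : ∃ C : ℝ, C = coth (lam / 2) := ⟨_, rfl⟩
  have hC0 : C ≠ 0 := by rw [hC]; exact div_ne_zero hCh hS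
  have hT : Real.tanh (lam / 2) = C⁻¹ := by rw [hC, coth, Real.tanh_eq_sinh_div_cosh, inv_div]
  have hcoth : coth lam = (C + C⁻¹) / 2 := by
    have h2 : lam = 2 * (lam / 2) := by ring
    rw [hC, coth, coth]
    conv_lhs => rw [h2, Real.cosh_two_mul, Real.sinh_two_mul]
    field_simp
  have hhalf : (1 / 2 : ℝ) * lam = lam / 2 := by ring
  have hC0' : (C : ℂ) ≠ 0 := by exact_mod_cast hC0
  unfold fockRep bargmann
  rw [← integral_sub_right_eq_self _ (C⁻¹ • rot η - ξ)]
  simp only [twistedRep_apply, ← integral_const_mul, ← integral_mul_const, hT]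
  refine integral_congr_ae (Filter.Eventually.of_forall fun t => ?_)
  have e2 : t - (C⁻¹ • rot η - ξ) + C⁻¹ • rot η = t + ξ := by abel
  simp only [e2, add_sub_cancel_right, heatKernel, hhalf, one_mul, ← hC, hcoth, mul_inv, ← Complex.exp_neg]
  set K1 : ℂ := ((((4 * Real.pi) ^ n)⁻¹ * (lam / Real.sinh lam) ^ n : ℝ) : ℂ)
  set K2 : ℂ := ((((4 * Real.pi) ^ n)⁻¹ * (lam / Real.sinh (lam / 2)) ^ n : ℝ) : ℂ)
  set E0 := Complex.exp (-((lam / 4 * ((C + C⁻¹) / 2) : ℝ) : ℂ) *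
    dot (0 : Fin n ⊕ Fin n → ℂ) (0 : Fin n ⊕ Fin n → ℂ))
  have key : ∀ a1 a2 a3 a4 a5 a6 b1 b2 b3 b4 b5 b6 b7 G : ℂ,
      a1 + a2 + a3 + a4 + a5 + a6 = b1 + b2 + b3 + b4 + b5 + b6 + b7 →
      K1 * E0 * (K1⁻¹ * Complex.exp a1) *
        (Complex.exp a2 * (Complex.exp a3 * (Complex.exp a4 * G)) *
          (K2 * Complex.exp a5 * Complex.exp a6)) =
      K1 * E0 * (K1⁻¹ * Complex.exp b1) * (G * (K2 * Complex.exp b2 * Complex.exp b3)) *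
        Complex.exp b4 * Complex.exp b5 * Complex.exp b6 * Complex.exp b7 := by
    intro a1 a2 a3 a4 a5 a6 b1 b2 b3 b4 b5 b6 b7 G h
    have h' := congrArg Complex.exp h
    simp only [Complex.exp_add] at h'
    linear_combination (K1 * K1⁻¹ * E0 * K2 * G) * h'
  apply key
  simp only [dot, symp, rot, Complex.ofReal_mul, Complex.ofReal_sum, Complex.ofReal_add,
    Complex.ofReal_sub, Complex.ofReal_neg, PiLp.add_apply, PiLp.sub_apply, PiLp.smul_apply,
    smul_eq_mul, Sum.elim_inl, Sum.elim_inr, Pi.sub_apply, Pi.star_apply, Finset.mul_sum,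
    ← Finset.sum_add_distrib, ← Finset.sum_neg_distrib]
  refine Finset.sum_congr rfl fun j _ => ?_
  simp only [Complex.add_re, Complex.add_im, Complex.ofReal_re, Complex.ofReal_im, Complex.mul_re,
    Complex.mul_im, Complex.I_re, Complex.I_im, star_add, star_mul', RCLike.star_def,
    Complex.conj_ofReal, Complex.conj_I, Complex.ofReal_div, Complex.ofReal_inv,
    Complex.ofReal_add, Complex.ofReal_mul, Complex.ofReal_sub,
    Complex.ofReal_zero, Complex.ofReal_one, Complex.ofReal_ofNat]
  field_simp
  ring_nf
  simp only [Complex.I_sq]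
  ring_nf

/-! ### Twisted modulation spaces -/

/-- The complex conjugate of a Schwartz function. -/
def conjSchwartz {n : ℕ} (φ : 𝓢(Space n, ℂ)) : 𝓢(Space n, ℂ) :=
  SchwartzMap.postcompCLM (𝕜 := ℝ) (Complex.conjCLE : ℂ →L[ℝ] ℂ) φ

/-- The matrix coefficient `(ξ, η) ↦ ⟨f, Π_λ(ξ, η) g⟩` of a tempered distribution `f` with window
`g`; the bracket is linear in `f` and conjugate linear in the Schwartz function, that is
`⟨f, φ⟩ = f (conj φ)`. -/
def matrixCoeff {n : ℕ} (lam : ℝ) (g : 𝓢(Space n, ℂ)) (f : 𝓢'(Space n, ℂ))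
    (z : Space n × Space n) : ℂ :=
  f (conjSchwartz (twistedRep lam z.1 z.2 g))

/-- The mixed norm of `L^{p,q}(ℝ²ⁿ × ℝ²ⁿ)`: the `L^p` norm in `ξ`, then the `L^q` norm in `η`. -/
def mixedNorm {n : ℕ} (p q : ℝ≥0∞) (F : Space n × Space n → ℂ) : ℝ≥0∞ :=
  eLpNorm (fun η : Space n => eLpNorm (fun ξ : Space n => F (ξ, η)) p volume) q volume

/-- Membership in the mixed norm space `L^{p,q}(ℝ²ⁿ × ℝ²ⁿ)`. -/
def MemMixed {n : ℕ} (p q : ℝ≥0∞) (F : Space n × Space n → ℂ) : Prop :=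
  AEStronglyMeasurable F volume ∧ mixedNorm p q F < ∞

/-- The norm `‖f‖_{(p,q)}` with window `g`. -/
def modulationNorm {n : ℕ} (lam : ℝ) (p q : ℝ≥0∞) (g : 𝓢(Space n, ℂ))
    (f : 𝓢'(Space n, ℂ)) : ℝ≥0∞ :=
  mixedNorm p q (matrixCoeff lam g f)

/-- The twisted modulation space `M_λ^{p,q}(ℝ²ⁿ)`: the tempered distributions whose matrix
coefficient is in `L^{p,q}` for some nonzero Schwartz window. -/
def twistedModulationSpace (n : ℕ) (lam : ℝ) (p q : ℝ≥0∞) : Set 𝓢'(Space n, ℂ) :=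
  {f | ∃ g : 𝓢(Space n, ℂ), g ≠ 0 ∧ MemMixed p q (matrixCoeff lam g f)}

/-- The tempered distribution `ψ ↦ ∫ φ ψ` defined by a Schwartz function `φ`. -/
def ofSchwartz {n : ℕ} (φ : 𝓢(Space n, ℂ)) : 𝓢'(Space n, ℂ) :=
  SchwartzMap.toTemperedDistributionCLM (Space n) ℂ volume φ

/-- The integrand of the duality pairing of twisted modulation spaces. -/
def pairingIntegrand {n : ℕ} (lam : ℝ) (g : 𝓢(Space n, ℂ)) (f h : 𝓢'(Space n, ℂ))
    (z : Space n × Space n) : ℂ :=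
  matrixCoeff lam g f z * conj (matrixCoeff lam g h z)

/-- The duality pairing `∫∫ ⟨f, Π_λ(ξ, η) g⟩ conj ⟨h, Π_λ(ξ, η) g⟩ dξ dη`. -/
def modulationPairing {n : ℕ} (lam : ℝ) (g : 𝓢(Space n, ℂ)) (f h : 𝓢'(Space n, ℂ)) : ℂ :=
  ∫ z : Space n × Space n, pairingIntegrand lam g f h z

/-- The seminorm `N` is a norm that makes the complex vector space `V` a Banach space. -/
def IsBanachNorm {V : Type*} [AddCommGroup V] [Module ℂ V] (N : Seminorm ℂ V) : Prop :=
  (∀ f : V, N f = 0 → f = 0) ∧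
  ∀ u : ℕ → V, (∀ ε : ℝ, 0 < ε → ∃ K : ℕ, ∀ m k : ℕ, K ≤ m → K ≤ k → N (u m - u k) < ε) →
    ∃ f : V, Filter.Tendsto (fun k : ℕ => N (u k - f)) Filter.atTop (nhds 0)

/-- Under the pairing with window `g`, the dual of the subspace `M` of tempered distributions, normed
by `N`, is the set `M'` of tempered distributions normed by `N'`: pairing with `h ∈ M'` is a bounded
linear functional on `M`, every bounded linear functional on `M` arises from exactly one `h ∈ M'`,
and the functional norm is equivalent to `N'`. -/
def IsDualUnderPairing {n : ℕ} (lam : ℝ) (g : 𝓢(Space n, ℂ)) (M : Submodule ℂ 𝓢'(Space n, ℂ))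
    (N : Seminorm ℂ M) (M' : Set 𝓢'(Space n, ℂ)) (N' : 𝓢'(Space n, ℂ) → ℝ≥0∞) : Prop :=
  (∀ h ∈ M', ∃ ℓ : M →ₗ[ℂ] ℂ, ∀ f : M, Integrable (pairingIntegrand lam g f h) volume ∧
    ℓ f = modulationPairing lam g f h ∧ ‖ℓ f‖ ≤ (N' h).toReal * N f) ∧
  (∀ ℓ : M →ₗ[ℂ] ℂ, (∃ C : ℝ, ∀ f : M, ‖ℓ f‖ ≤ C * N f) →
    ∃! h : 𝓢'(Space n, ℂ), h ∈ M' ∧ ∀ f : M, ℓ f = modulationPairing lam g f h) ∧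
  (∃ A : ℝ, 0 < A ∧ ∀ h ∈ M', ∀ C : ℝ, 0 ≤ C →
    (∀ f : M, ‖modulationPairing lam g f h‖ ≤ C * N f) → N' h ≤ ENNReal.ofReal (A * C))

end TwistedMod

end

open TwistedMod

/-! Up to a unimodular factor, $\Pi_\lambda(\xi,\eta)$ is the ordinary time-frequency shift at
$L(\xi,\eta)$, where $L$ is an invertible linear map of phase space
(`exists_twistedRep_eq_tfShift`); invertibility rests on $\coth\frac\lambda2\ne\tanh\frac\lambda2$.
Since $L$ mixes the variables, the mixed norm is not carried to the usual one. What does transfer is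
whatever survives a linear change of coordinates: rapid decay of
$\langle\varphi,\Pi_\lambda(z)g\rangle$, the covariance
$|\langle\Pi_\lambda(z)g,\Pi_\lambda(z')\gamma\rangle|=|\langle g,\Pi_\lambda(z'-z)\gamma\rangle|$,
and the inversion formula. Inversion extends to distributions as the orthogonality relation
`exists_integral_matrixCoeff_mul_conj`, because integrals with values in Schwartz space commute with
continuous functionals (`SchwartzIntegrable.exists_integral`).

Orthogonality applied to $\varphi=\Pi_\lambda(z)g$ writes $V_gf(z)$ as an integral of $V_\gamma f$
against a kernel dominated by a product weight in $z'-z$. Young's inequality for mixed norms, which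
may raise both exponents, then gives independence of the window and the inclusions (iii) together
(`exists_modulationNorm_le`).

For (i), orthogonality and Hölder bound $|f(\psi)|$ by a continuous seminorm of $\psi$ times
$\|f\|_{(p,q)}$ (`exists_enorm_apply_le`). Hence Cauchy sequences converge pointwise to a
distribution, and Fatou's lemma gives convergence in norm.

For (ii), cutting the reproducing integral off at a ball synthesizes a Schwartz function; the error
is the synthesis of the tail of $V_gf$, which is small for finite exponents by dominated
convergence. A bounded functional is determined on Schwartz functions by a distribution $h$, read
off from orthogonality. Its dual norm is controlled by converse Hölder: a bounded test function $H$
with bounded support, times the phase of $V_gh$, synthesizes a Schwartz function of norm at most a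
constant times that of $H$ (`exists_modulationNorm_le_of_forall_schwartz`). Density identifies the
functional on the whole space. -/

namespace TwistedMod

/-! ### Norms of extended nonnegative functions, Hölder's inequality and its near-extremizers -/

section MixedNorm

variable {X Y : Type*} [MeasurableSpace X] [MeasurableSpace Y] {μ : Measure X} {ν : Measure Y}

theorem eLpNorm_ennreal_eq {p : ℝ≥0∞} (hp0 : p ≠ 0) (hp : p ≠ ∞) (f : X → ℝ≥0∞) :
    eLpNorm f p μ = (∫⁻ x, f x ^ p.toReal ∂μ) ^ (1 / p.toReal) := by
  simp [eLpNorm_eq_lintegral_rpow_enorm_toReal hp0 hp]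

theorem eLpNorm_ennreal_rpow {p : ℝ≥0∞} (hp0 : p ≠ 0) (hp : p ≠ ∞) (f : X → ℝ≥0∞) :
    eLpNorm f p μ ^ p.toReal = ∫⁻ x, f x ^ p.toReal ∂μ := by
  rw [eLpNorm_ennreal_eq hp0 hp, ← ENNReal.rpow_mul,
    one_div_mul_cancel (ENNReal.toReal_pos hp0 hp).ne', ENNReal.rpow_one]

theorem eLpNorm_top_le_iff {f : X → ℝ≥0∞} {c : ℝ≥0∞} :
    eLpNorm f ∞ μ ≤ c ↔ ∀ᵐ x ∂μ, f x ≤ c := by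
  rw [eLpNorm_exponent_top]
  constructor
  · intro h
    filter_upwards [ae_le_eLpNormEssSup (f := f) (μ := μ)] with x hx
    exact (by simpa using hx : f x ≤ _).trans h
  · intro h
    exact eLpNormEssSup_le_of_ae_enorm_bound (by simpa using h)

theorem eLpNorm_ennreal_mono {f g : X → ℝ≥0∞} (p : ℝ≥0∞) (h : ∀ x, f x ≤ g x) :
    eLpNorm f p μ ≤ eLpNorm g p μ :=
  eLpNorm_mono_enorm (by simpa using h)

theorem eLpNorm_ennreal_one (f : X → ℝ≥0∞) : eLpNorm f 1 μ = ∫⁻ x, f x ∂μ := by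
  simp [eLpNorm_one_eq_lintegral_enorm]

/-- For finite `p` this is Tonelli. For `p = ∞` a sublevel set consists of the `y` whose slice of a
superlevel set of `F` is null, and slice measures are measurable. -/
theorem measurable_eLpNorm_prod [SFinite μ] {F : X × Y → ℝ≥0∞} (hF : Measurable F) (p : ℝ≥0∞) :
    Measurable fun y => eLpNorm (fun x => F (x, y)) p μ := by
  rcases eq_or_ne p 0 with rfl | hp0
  · simp
  rcases eq_or_ne p ∞ with rfl | hp
  · refine measurable_of_Iic fun c => ?_
    have : (fun y => eLpNorm (fun x => F (x, y)) ∞ μ) ⁻¹' Set.Iic c =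
        (fun y => μ ((fun x => (x, y)) ⁻¹' {z | c < F z})) ⁻¹' {0} := by
      ext y
      simp only [Set.mem_preimage, Set.mem_Iic, eLpNorm_top_le_iff, Set.mem_singleton_iff, ae_iff,
        not_le]
      rfl
    rw [this]
    exact measurable_measure_prodMk_right (measurableSet_lt measurable_const hF)
      (measurableSet_singleton _)
  · simp only [eLpNorm_ennreal_eq hp0 hp]
    exact (hF.pow_const _).lintegral_prod_left'.pow_const _

/-- Monotone convergence, powers being order isomorphisms; for `p = ∞` countably many null sets are
discarded. -/
theorem eLpNorm_iSup {f : ℕ → X → ℝ≥0∞} (hf : ∀ n, Measurable (f n)) (hm : Monotone f)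
    (p : ℝ≥0∞) : eLpNorm (fun x => ⨆ n, f n x) p μ = ⨆ n, eLpNorm (f n) p μ := by
  rcases eq_or_ne p 0 with rfl | hp0
  · simp
  rcases eq_or_ne p ∞ with rfl | hp
  · refine le_antisymm ?_ (iSup_le fun n => eLpNorm_ennreal_mono _ fun x => le_iSup (f · x) n)
    rw [eLpNorm_top_le_iff]
    have : ∀ᵐ x ∂μ, ∀ n, f n x ≤ eLpNorm (f n) ∞ μ :=
      ae_all_iff.2 fun n => eLpNorm_top_le_iff.1 le_rfl
    filter_upwards [this] with x hx
    exact iSup_mono hx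
  · have hpos := ENNReal.toReal_pos hp0 hp
    simp only [eLpNorm_ennreal_eq hp0 hp]
    have h1 : ∀ x, (⨆ n, f n x) ^ p.toReal = ⨆ n, f n x ^ p.toReal := fun x =>
      (ENNReal.orderIsoRpow _ hpos).map_iSup _
    simp only [h1]
    rw [lintegral_iSup (fun n => (hf n).pow_const _)
      fun a b hab x => ENNReal.rpow_le_rpow (hm hab x) hpos.le]
    exact (ENNReal.orderIsoRpow _ (one_div_pos.2 hpos)).map_iSup _

theorem one_le_of_holderConjugate (p p' : ℝ≥0∞) [h : p.HolderConjugate p'] : 1 ≤ p := by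
  have := h.inv_add_inv_eq_inv
  rw [inv_one] at this
  exact ENNReal.inv_le_one.1 (this ▸ le_self_add)

theorem eq_one_of_holderConjugate_top (p' : ℝ≥0∞) [h : (∞ : ℝ≥0∞).HolderConjugate p'] :
    p' = 1 := by
  have := h.inv_add_inv_eq_inv
  simpa using this

/-- `key` settles the endpoint pair `(∞, 1)` and is used in both orders; the remaining exponents are
finite. -/
theorem lintegral_mul_le_eLpNorm (p p' : ℝ≥0∞) [h : p.HolderConjugate p'] {f g : X → ℝ≥0∞}
    (hf : AEMeasurable f μ) (hg : AEMeasurable g μ) :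
    ∫⁻ x, f x * g x ∂μ ≤ eLpNorm f p μ * eLpNorm g p' μ := by
  have key : ∀ f g : X → ℝ≥0∞, AEMeasurable g μ →
      ∫⁻ x, f x * g x ∂μ ≤ eLpNorm f ∞ μ * eLpNorm g 1 μ := by
    intro f g hg
    rw [eLpNorm_ennreal_one, ← lintegral_const_mul'' _ hg]
    refine lintegral_mono_ae ?_
    filter_upwards [eLpNorm_top_le_iff.1 (le_refl (eLpNorm f ∞ μ))] with x hx
    gcongr
  rcases eq_or_ne p ∞ with rfl | hp
  · obtain rfl := eq_one_of_holderConjugate_top p'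
    exact key f g hg
  rcases eq_or_ne p' ∞ with rfl | hp'
  · have := h.symm
    obtain rfl := eq_one_of_holderConjugate_top p
    simp only [mul_comm (f _), mul_comm (eLpNorm f _ _)]
    exact key g f hf
  have h0 : p ≠ 0 := (zero_lt_one.trans_le (one_le_of_holderConjugate p p')).ne'
  have h0' : p' ≠ 0 :=
    (zero_lt_one.trans_le (@one_le_of_holderConjugate p' p h.symm)).ne'
  rw [eLpNorm_ennreal_eq h0 hp, eLpNorm_ennreal_eq h0' hp']
  exact ENNReal.lintegral_mul_le_Lp_mul_Lq μ (ENNReal.HolderConjugate.toReal_of_ne_top hp hp') hf hg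

/-- The mixed norm of an extended nonnegative function. -/
noncomputable def mixedENorm (μ : Measure X) (ν : Measure Y) (p q : ℝ≥0∞) (F : X × Y → ℝ≥0∞) :
    ℝ≥0∞ :=
  eLpNorm (fun y => eLpNorm (fun x => F (x, y)) p μ) q ν

theorem mixedENorm_mono {F G : X × Y → ℝ≥0∞} (p q : ℝ≥0∞) (h : ∀ z, F z ≤ G z) :
    mixedENorm μ ν p q F ≤ mixedENorm μ ν p q G :=
  eLpNorm_ennreal_mono _ fun _ => eLpNorm_ennreal_mono _ fun _ => h _

/-- Tonelli with `y` outermost, then Hölder in `x` on each slice and Hölder in `y` on the slice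
norms. -/
theorem lintegral_mul_le_mixedENorm [SFinite μ] [SFinite ν] (p p' q q' : ℝ≥0∞)
    [p.HolderConjugate p'] [q.HolderConjugate q'] {F G : X × Y → ℝ≥0∞} (hF : Measurable F)
    (hG : Measurable G) :
    ∫⁻ z, F z * G z ∂(μ.prod ν) ≤ mixedENorm μ ν p q F * mixedENorm μ ν p' q' G := by
  rw [lintegral_prod_symm (fun z => F z * G z) (hF.mul hG).aemeasurable]
  refine le_trans (lintegral_mono fun y => ?_) (lintegral_mul_le_eLpNorm q q'
    (measurable_eLpNorm_prod hF p).aemeasurable (measurable_eLpNorm_prod hG p').aemeasurable)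
  exact lintegral_mul_le_eLpNorm p p' (hF.comp measurable_prodMk_right).aemeasurable
    (hG.comp measurable_prodMk_right).aemeasurable

theorem eLpNorm_lt_top_of_bounded {p : ℝ≥0∞} {f : X → ℝ≥0∞} {S : Set X} (hS : μ S ≠ ∞)
    {b : ℝ≥0∞} (hb : b ≠ ∞) (hfb : ∀ x, f x ≤ S.indicator (fun _ => b) x) :
    eLpNorm f p μ ≠ ∞ := by
  have h1 : eLpNorm f p μ ≤ eLpNorm (S.indicator fun _ => b) p μ := eLpNorm_ennreal_mono p hfb
  refine (h1.trans_lt ((eLpNorm_indicator_const_le (ε := ℝ≥0∞) b p).trans_lt ?_)).ne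
  rw [enorm_eq_self]
  exact ENNReal.mul_lt_top hb.lt_top (ENNReal.rpow_lt_top_of_nonneg (by positivity) hS)

/-- Near-extremizers of Hölder's inequality, depending measurably on a parameter. -/
theorem exists_norming_family [SFinite μ] (p p' : ℝ≥0∞) [h : p.HolderConjugate p']
    {F : X × Y → ℝ≥0∞} (hF : Measurable F) {S : Set X} (hS : μ S ≠ ∞) {b : ℝ≥0∞}
    (hb : b ≠ ∞) (hFb : ∀ z, F z ≤ S.indicator (fun _ => b) z.1) {c : ℝ≥0∞} (hc : c < 1) :
    ∃ H : X × Y → ℝ≥0∞, Measurable H ∧ (∀ y, eLpNorm (fun x => H (x, y)) p' μ ≤ 1) ∧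
      ∀ y, c * eLpNorm (fun x => F (x, y)) p μ ≤ ∫⁻ x, F (x, y) * H (x, y) ∂μ := by
  have hFy : ∀ y, Measurable fun x => F (x, y) := fun y => hF.comp measurable_prodMk_right
  rcases eq_or_ne p' ∞ with rfl | hp'
  · have := h.symm
    obtain rfl := eq_one_of_holderConjugate_top p
    refine ⟨fun _ => 1, measurable_const, fun y => eLpNorm_top_le_iff.2 (by simp), fun y => ?_⟩
    simp only [mul_one, eLpNorm_ennreal_one]
    exact mul_le_of_le_one_left' hc.le
  -- The bound and the support of finite measure serve to make every slice norm finite, so that it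
  -- can be divided by.
  have hN := fun y => eLpNorm_lt_top_of_bounded (p := p) hS hb (fun x => hFb (x, y))
  rcases eq_or_ne p ∞ with rfl | hp
  · obtain rfl := eq_one_of_holderConjugate_top p'
    set N : Y → ℝ≥0∞ := fun y => eLpNorm (fun x => F (x, y)) ∞ μ
    have hNm : Measurable N := measurable_eLpNorm_prod hF ∞
    -- An essential supremum need not be attained, whence the factor `c < 1`: the norming function
    -- is the normalised indicator of the set where `F` exceeds `c` times its slice supremum.
    set E : Set (X × Y) := {z | c * N z.2 < F z}
    have hE : MeasurableSet E :=
      measurableSet_lt ((hNm.comp measurable_snd).const_mul c) hF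
    set m : Y → ℝ≥0∞ := fun y => μ ((fun x => (x, y)) ⁻¹' E)
    have hm : Measurable m := measurable_measure_prodMk_right hE
    have hEy : ∀ y, MeasurableSet ((fun x => (x, y)) ⁻¹' E) := fun y => measurable_prodMk_right hE
    have hHy : ∀ y x, E.indicator (fun z => (m z.2)⁻¹) (x, y) =
        ((fun x => (x, y)) ⁻¹' E).indicator (fun _ => (m y)⁻¹) x := fun y x => by
      simp only [Set.indicator, Set.mem_preimage]
    refine ⟨E.indicator fun z => (m z.2)⁻¹, (hm.comp measurable_snd).inv.indicator hE,
      fun y => ?_, fun y => ?_⟩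
    · simp only [eLpNorm_ennreal_one, hHy]
      rw [lintegral_indicator_const (hEy y), mul_comm]
      exact ENNReal.mul_inv_le_one _
    · change c * N y ≤ _
      rcases eq_or_ne (N y) 0 with h0 | h0
      · simp [h0]
      have hm0 : m y ≠ 0 := by
        intro hm0
        have : N y ≤ c * N y := eLpNorm_top_le_iff.2 (by
          simp only [ae_iff, not_le]
          exact hm0)
        refine absurd this (not_le.2 ?_)
        calc c * N y < 1 * N y := (ENNReal.mul_lt_mul_iff_left h0 (hN y)).2 hc
          _ = N y := one_mul _
      -- `F` vanishes off `S`, so the slice of `E` lies in `S`.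
      have hmt : m y ≠ ∞ := by
        refine ((measure_mono fun x (hx : c * N y < F (x, y)) => ?_).trans_lt hS.lt_top).ne
        by_contra hxS
        have := hFb (x, y)
        rw [Set.indicator_of_notMem hxS] at this
        exact absurd (lt_of_lt_of_le hx this) (by simp)
      calc c * N y = c * N y * (m y)⁻¹ * m y := by
            rw [mul_assoc, ENNReal.inv_mul_cancel hm0 hmt, mul_one]
        _ = ∫⁻ x, ((fun x => (x, y)) ⁻¹' E).indicator (fun _ => c * N y * (m y)⁻¹) x ∂μ := by
            rw [lintegral_indicator_const (hEy y)]
        _ ≤ _ := lintegral_mono fun x => by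
            rw [hHy]
            by_cases hx : x ∈ (fun x => (x, y)) ⁻¹' E
            · simp only [Set.indicator_of_mem hx]
              gcongr
              exact le_of_lt hx
            · simp [Set.indicator_of_notMem hx]
  have hp1 : 1 ≤ p := one_le_of_holderConjugate p p'
  have h0 : p ≠ 0 := (zero_lt_one.trans_le hp1).ne'
  have h0' : p' ≠ 0 := (zero_lt_one.trans_le (@one_le_of_holderConjugate p' p h.symm)).ne'
  have hr := ENNReal.HolderConjugate.toReal_of_ne_top (p := p) (q := p') hp hp'
  set r := p.toReal
  set r' := p'.toReal
  have hr1 : 0 < r - 1 := sub_pos.2 hr.lt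
  have hrr : (r - 1) * r' = r := hr.sub_one_mul_conj
  set N : Y → ℝ≥0∞ := fun y => eLpNorm (fun x => F (x, y)) p μ
  have hNm : Measurable N := measurable_eLpNorm_prod hF p
  have hNr : ∀ y, N y ^ r = ∫⁻ x, F (x, y) ^ r ∂μ := fun y => eLpNorm_ennreal_rpow h0 hp _
  -- The classical extremizer $(F/N)^{r-1}$. Its $r'$-th power integrates to $N^r(N^r)^{-1}\le1$, an
  -- inequality that also holds when `N y = 0`.
  refine ⟨fun z => F z ^ (r - 1) * (N z.2 ^ (r - 1))⁻¹,
    (hF.pow_const _).mul ((hNm.comp measurable_snd).pow_const _).inv, fun y => ?_, fun y => ?_⟩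
  · rw [eLpNorm_ennreal_eq h0' hp']
    refine ENNReal.rpow_le_one ?_ (by positivity)
    have : ∀ x, (F (x, y) ^ (r - 1) * (N y ^ (r - 1))⁻¹) ^ r' = F (x, y) ^ r * (N y ^ r)⁻¹ := by
      intro x
      rw [ENNReal.mul_rpow_of_nonneg _ _ hr.symm.nonneg, ENNReal.inv_rpow, ← ENNReal.rpow_mul,
        ← ENNReal.rpow_mul, hrr]
    change ∫⁻ x, (F (x, y) ^ (r - 1) * (N y ^ (r - 1))⁻¹) ^ r' ∂μ ≤ 1
    simp only [this]
    rw [lintegral_mul_const _ ((hFy y).pow_const _), ← hNr]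
    exact ENNReal.mul_inv_le_one _
  · refine (mul_le_of_le_one_left' hc.le).trans ?_
    change N y ≤ ∫⁻ x, F (x, y) * (F (x, y) ^ (r - 1) * (N y ^ (r - 1))⁻¹) ∂μ
    rcases eq_or_ne (N y) 0 with hy0 | hy0
    · simp [hy0]
    have : ∀ x, F (x, y) * (F (x, y) ^ (r - 1) * (N y ^ (r - 1))⁻¹) =
        F (x, y) ^ r * (N y ^ (r - 1))⁻¹ := by
      intro x
      rw [← mul_assoc]
      congr 1
      nth_rw 1 [← ENNReal.rpow_one (F (x, y))]
      rw [← ENNReal.rpow_add_of_nonneg _ _ zero_le_one hr1.le]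
      congr 1
      ring
    simp only [this]
    rw [lintegral_mul_const _ ((hFy y).pow_const _), ← hNr, ← ENNReal.rpow_neg,
      ← ENNReal.rpow_add _ _ hy0 (hN y)]
    simp

end MixedNorm

/-! ### Mixed norms: limit theorems, converse Hölder and Minkowski -/

section MixedNorm

open Filter Topology

variable {X Y : Type*} [MeasurableSpace X] [MeasurableSpace Y] {μ : Measure X} {ν : Measure Y}

theorem eLpNorm_ennreal_const_mul {f : X → ℝ≥0∞} (hf : Measurable f) (c p : ℝ≥0∞) :
    eLpNorm (fun x => c * f x) p μ ≤ c * eLpNorm f p μ := by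
  rcases eq_or_ne p 0 with rfl | hp0
  · simp
  rcases eq_or_ne p ∞ with rfl | hp
  · rw [eLpNorm_top_le_iff]
    filter_upwards [eLpNorm_top_le_iff.1 (le_refl (eLpNorm f ∞ μ))] with x hx
    gcongr
  · have hpos := ENNReal.toReal_pos hp0 hp
    simp only [eLpNorm_ennreal_eq hp0 hp, ENNReal.mul_rpow_of_nonneg _ _ hpos.le]
    rw [lintegral_const_mul _ (hf.pow_const _), ENNReal.mul_rpow_of_nonneg _ _ (by positivity),
      ← ENNReal.rpow_mul, mul_one_div_cancel hpos.ne', ENNReal.rpow_one]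

theorem mixedENorm_const_mul [SFinite μ] {F : X × Y → ℝ≥0∞} (hF : Measurable F) (c p q : ℝ≥0∞) :
    mixedENorm μ ν p q (fun z => c * F z) ≤ c * mixedENorm μ ν p q F :=
  le_trans (eLpNorm_ennreal_mono _ fun _ =>
    eLpNorm_ennreal_const_mul (hF.comp measurable_prodMk_right) c p)
    (eLpNorm_ennreal_const_mul (measurable_eLpNorm_prod hF p) c q)

theorem mixedENorm_add_le [SFinite μ] {F G : X × Y → ℝ≥0∞} (hF : Measurable F)
    (hG : Measurable G) {p q : ℝ≥0∞} (hp : 1 ≤ p) (hq : 1 ≤ q) :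
    mixedENorm μ ν p q (fun z => F z + G z) ≤ mixedENorm μ ν p q F + mixedENorm μ ν p q G :=
  le_trans (eLpNorm_ennreal_mono _ fun _ =>
    eLpNorm_add_le (hF.comp measurable_prodMk_right).aestronglyMeasurable
      (hG.comp measurable_prodMk_right).aestronglyMeasurable hp)
    (eLpNorm_add_le (measurable_eLpNorm_prod hF p).aestronglyMeasurable
      (measurable_eLpNorm_prod hG p).aestronglyMeasurable hq)

theorem mixedENorm_iSup [SFinite μ] {F : ℕ → X × Y → ℝ≥0∞} (hF : ∀ n, Measurable (F n))
    (hm : Monotone F) (p q : ℝ≥0∞) :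
    mixedENorm μ ν p q (fun z => ⨆ n, F n z) = ⨆ n, mixedENorm μ ν p q (F n) := by
  unfold mixedENorm
  rw [← eLpNorm_iSup (fun n => measurable_eLpNorm_prod (hF n) p)
    fun a b hab y => eLpNorm_ennreal_mono p fun x => hm hab (x, y)]
  congr 1
  funext y
  exact eLpNorm_iSup (fun n => (hF n).comp measurable_prodMk_right)
    (fun a b hab x => hm hab (x, y)) p

/-- Fatou's lemma: the limit is the increasing supremum of the infima of the tails, to which
monotone convergence applies. -/
theorem mixedENorm_le_of_tendsto [SFinite μ] {F : ℕ → X × Y → ℝ≥0∞} (hF : ∀ n, Measurable (F n))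
    {G : X × Y → ℝ≥0∞} (hG : ∀ z, Tendsto (fun n => F n z) atTop (𝓝 (G z))) {p q b : ℝ≥0∞}
    (hb : ∀ᶠ n in atTop, mixedENorm μ ν p q (F n) ≤ b) : mixedENorm μ ν p q G ≤ b := by
  have h1 : G = fun z => ⨆ n, ⨅ i, F (n + i) z := by
    funext z
    rw [← (hG z).liminf_eq, liminf_eq_iSup_iInf_of_nat']
    simp only [add_comm]
  rw [h1, mixedENorm_iSup (fun n => Measurable.iInf fun i => hF _)]
  · refine iSup_le fun n => ?_
    obtain ⟨m, hm⟩ := eventually_atTop.1 hb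
    refine le_trans (mixedENorm_mono p q fun z => iInf_le _ m) (hm _ (by omega))
  · intro a b hab z
    refine le_iInf fun i => ?_
    refine (iInf_le _ (b - a + i)).trans_eq ?_
    congr 1
    omega

/-- Restriction of a function to a set, cut off at height `n`. -/
noncomputable def truncation (B : ℕ → Set X) (F : X → ℝ≥0∞) (n : ℕ) (x : X) : ℝ≥0∞ :=
  (B n).indicator (fun x => min (F x) n) x

theorem measurable_truncation {B : ℕ → Set X} (hB : ∀ n, MeasurableSet (B n)) {F : X → ℝ≥0∞}
    (hF : Measurable F) (n : ℕ) : Measurable (truncation B F n) :=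
  (hF.min measurable_const).indicator (hB n)

theorem truncation_le {Z : Type*} (B : ℕ → Set Z) (F : Z → ℝ≥0∞) (n : ℕ) (x : Z) :
    truncation B F n x ≤ F x :=
  Set.indicator_apply_le' (fun _ => min_le_left _ _) fun _ => zero_le

theorem truncation_le_indicator {Z : Type*} (B : ℕ → Set Z) (F : Z → ℝ≥0∞) (n : ℕ) (x : Z) :
    truncation B F n x ≤ (B n).indicator (fun _ => (n : ℝ≥0∞)) x :=
  Set.indicator_le_indicator (min_le_right _ _)

theorem monotone_truncation {Z : Type*} {B : ℕ → Set Z} (hB : Monotone B) (F : Z → ℝ≥0∞) :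
    Monotone (truncation B F) := by
  intro a b hab x
  by_cases hx : x ∈ B a
  · simp only [truncation, Set.indicator_of_mem hx, Set.indicator_of_mem (hB hab hx)]
    gcongr
  · simp [truncation, Set.indicator_of_notMem hx]

theorem iSup_truncation {Z : Type*} {B : ℕ → Set Z} (hB : Monotone B) (hU : ∀ x, ∃ n, x ∈ B n)
    (F : Z → ℝ≥0∞) (x : Z) : ⨆ n, truncation B F n x = F x := by
  refine le_antisymm (iSup_le fun n => truncation_le _ _ _ _) ?_
  obtain ⟨k, hk⟩ := hU x
  refine le_of_forall_lt fun c hc => ?_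
  obtain ⟨m, hm⟩ := ENNReal.exists_nat_gt (ne_top_of_lt hc)
  refine lt_of_lt_of_le ?_ (le_iSup _ (max k m))
  rw [truncation, Set.indicator_of_mem (hB (le_max_left k m) hk)]
  refine lt_min hc (hm.trans_le ?_)
  exact_mod_cast le_max_right k m

/-- Removes the loss `c < 1` left by the near-extremizers. -/
theorem le_of_forall_lt_one_mul_le_ennreal {a A : ℝ≥0∞} (h : ∀ c < 1, c * a ≤ A) : a ≤ A := by
  have h1 : Tendsto (fun c : ℝ≥0∞ => c * a) (𝓝[<] 1) (𝓝 (1 * a)) :=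
    (ENNReal.Tendsto.mul_const tendsto_id (Or.inl one_ne_zero)).mono_left nhdsWithin_le_nhds
  rw [one_mul] at h1
  have : (𝓝[<] (1 : ℝ≥0∞)).NeBot := nhdsLT_neBot_of_exists_lt ⟨0, zero_lt_one⟩
  exact le_of_tendsto h1 (eventually_nhdsWithin_of_forall h)

theorem mem_spanningSets_exists (μ : Measure X) [SigmaFinite μ] (x : X) :
    ∃ n, x ∈ spanningSets μ n :=
  ⟨_, mem_spanningSetsIndex μ x⟩

/-- Monotone convergence reduces to functions truncated in height and to sets of finite measure;
these have near-extremizers, here with a one-point parameter space. -/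
theorem eLpNorm_le_of_forall_lintegral_mul_le [SigmaFinite μ] (p p' : ℝ≥0∞)
    [p.HolderConjugate p'] {F : X → ℝ≥0∞} (hF : Measurable F) {A : ℝ≥0∞}
    (h : ∀ H : X → ℝ≥0∞, Measurable H → ∫⁻ x, F x * H x ∂μ ≤ A * eLpNorm H p' μ) :
    eLpNorm F p μ ≤ A := by
  have hB := measurableSet_spanningSets μ
  have hm : Monotone (spanningSets μ) := monotone_spanningSets μ
  have : F = fun x => ⨆ n, truncation (spanningSets μ) F n x := by
    funext x
    exact (iSup_truncation hm (mem_spanningSets_exists μ) F x).symm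
  rw [this, eLpNorm_iSup (measurable_truncation hB hF) (monotone_truncation hm F)]
  refine iSup_le fun n => le_of_forall_lt_one_mul_le_ennreal fun c hc => ?_
  obtain ⟨H, hH, hH1, hH2⟩ := exists_norming_family (Y := Unit) (μ := μ) p p'
    ((measurable_truncation hB hF n).comp measurable_fst)
    (measure_spanningSets_lt_top μ n).ne (ENNReal.natCast_ne_top n)
    (fun z => truncation_le_indicator _ F n z.1) hc
  refine (hH2 ()).trans (le_trans (lintegral_mono fun x => ?_)
    ((h (fun x => H (x, ())) (hH.comp measurable_prodMk_right)).trans ?_))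
  · gcongr
    exact truncation_le _ _ _ _
  · exact mul_le_of_le_one_right' (hH1 ())

/-- A near-extremizer `H (·, y)` for each slice, measurable in `y`, is multiplied by a test function
`k y`. The product has mixed norm at most that of `k`, so the one-variable converse Hölder
inequality applies to the slice norms. -/
theorem mixedENorm_le_of_forall_lintegral_mul_le [SigmaFinite μ] [SigmaFinite ν]
    (p p' q q' : ℝ≥0∞) [p.HolderConjugate p'] [q.HolderConjugate q'] {F : X × Y → ℝ≥0∞}
    (hF : Measurable F) {A : ℝ≥0∞}
    (h : ∀ H : X × Y → ℝ≥0∞, Measurable H →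
      ∫⁻ z, F z * H z ∂(μ.prod ν) ≤ A * mixedENorm μ ν p' q' H) :
    mixedENorm μ ν p q F ≤ A := by
  set B : ℕ → Set (X × Y) := fun n => Prod.fst ⁻¹' spanningSets μ n
  have hB : ∀ n, MeasurableSet (B n) := fun n => measurable_fst (measurableSet_spanningSets μ n)
  have hm : Monotone B := fun a b hab => Set.preimage_mono (monotone_spanningSets μ hab)
  have : F = fun z => ⨆ n, truncation B F n z := by
    funext z
    exact (iSup_truncation hm (fun z => mem_spanningSets_exists μ z.1) F z).symm
  rw [this, mixedENorm_iSup (measurable_truncation hB hF) (monotone_truncation hm F)]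
  refine iSup_le fun n => le_of_forall_lt_one_mul_le_ennreal fun c hc => ?_
  have hFn := measurable_truncation hB hF n
  obtain ⟨H, hH, hH1, hH2⟩ := exists_norming_family (μ := μ) p p' hFn
    (measure_spanningSets_lt_top μ n).ne (ENNReal.natCast_ne_top n)
    (fun z => truncation_le_indicator B F n z) hc
  have hN := measurable_eLpNorm_prod (μ := μ) hFn p
  suffices H1 : eLpNorm (fun y => c * eLpNorm (fun x => truncation B F n (x, y)) p μ) q ν ≤ A by
    rcases eq_or_ne c 0 with rfl | hc0
    · simp
    have h2 : mixedENorm μ ν p q (truncation B F n) ≤ c⁻¹ * A := by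
      refine le_trans ?_ (mul_le_mul_right H1 c⁻¹)
      refine le_trans (eLpNorm_ennreal_mono q fun y => ?_)
        (eLpNorm_ennreal_const_mul (hN.const_mul c) c⁻¹ q)
      rw [← mul_assoc, ENNReal.inv_mul_cancel hc0 (ne_top_of_lt hc), one_mul]
    calc c * mixedENorm μ ν p q (truncation B F n) ≤ c * (c⁻¹ * A) := by gcongr
      _ = A := by rw [← mul_assoc, ENNReal.mul_inv_cancel hc0 (ne_top_of_lt hc), one_mul]
  refine eLpNorm_le_of_forall_lintegral_mul_le q q' (hN.const_mul c) fun k hk => ?_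
  have hHk : Measurable fun z : X × Y => k z.2 * H z := (hk.comp measurable_snd).mul hH
  calc ∫⁻ y, c * eLpNorm (fun x => truncation B F n (x, y)) p μ * k y ∂ν
      ≤ ∫⁻ y, ∫⁻ x, F (x, y) * (k y * H (x, y)) ∂μ ∂ν := by
        refine lintegral_mono fun y => ?_
        refine (mul_le_mul_left (hH2 y) _).trans ?_
        have hFH : Measurable fun x => truncation B F n (x, y) * H (x, y) :=
          (hFn.mul hH).comp measurable_prodMk_right
        rw [← lintegral_mul_const _ hFH]
        refine lintegral_mono fun x => ?_
        rw [mul_assoc, mul_comm (H _)]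
        gcongr
        exact truncation_le _ _ _ _
    _ = ∫⁻ z, F z * (k z.2 * H z) ∂(μ.prod ν) :=
        (lintegral_prod_symm (fun z => F z * (k z.2 * H z)) (hF.mul hHk).aemeasurable).symm
    _ ≤ A * mixedENorm μ ν p' q' (fun z => k z.2 * H z) := h _ hHk
    _ ≤ A * eLpNorm k q' ν := by
        gcongr
        refine eLpNorm_ennreal_mono _ fun y => ?_
        have hHy : Measurable fun x => H (x, y) := hH.comp measurable_prodMk_right
        exact (eLpNorm_ennreal_const_mul hHy (k y) p').trans (mul_le_of_le_one_right' (hH1 y))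

/-- Any test function is the increasing limit of its truncations. Test functions of this restricted
kind can later be synthesized into Schwartz functions. -/
theorem mixedENorm_le_of_forall_bounded [SigmaFinite μ] [SigmaFinite ν]
    (p p' q q' : ℝ≥0∞) [p.HolderConjugate p'] [q.HolderConjugate q'] {F : X × Y → ℝ≥0∞}
    (hF : Measurable F) {A : ℝ≥0∞} {B : ℕ → Set (X × Y)} (hB : ∀ n, MeasurableSet (B n))
    (hm : Monotone B) (hU : ∀ z, ∃ n, z ∈ B n)
    (h : ∀ H : X × Y → ℝ≥0∞, Measurable H → ∀ n : ℕ,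
      (∀ z, H z ≤ (B n).indicator (fun _ => (n : ℝ≥0∞)) z) →
      ∫⁻ z, F z * H z ∂(μ.prod ν) ≤ A * mixedENorm μ ν p' q' H) :
    mixedENorm μ ν p q F ≤ A := by
  refine mixedENorm_le_of_forall_lintegral_mul_le p p' q q' hF fun H hH => ?_
  have : ∀ z, F z * H z = ⨆ n, F z * truncation B H n z := fun z => by
    rw [← ENNReal.mul_iSup, iSup_truncation hm hU]
  simp only [this]
  rw [lintegral_iSup (f := fun n z => F z * truncation B H n z)
    (fun n => hF.mul (measurable_truncation hB hH n)) fun a b hab z =>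
      mul_le_mul_right (monotone_truncation hm H hab z) _]
  refine iSup_le fun n => (h _ (measurable_truncation hB hH n) n
    (truncation_le_indicator B H n)).trans ?_
  gcongr
  exact mixedENorm_mono _ _ (truncation_le B H n)

/-- Minkowski's integral inequality. -/
theorem eLpNorm_lintegral_le [SigmaFinite μ] [SFinite ν] {p : ℝ≥0∞} (hp : 1 ≤ p)
    {F : X × Y → ℝ≥0∞} (hF : Measurable F) :
    eLpNorm (fun x => ∫⁻ y, F (x, y) ∂ν) p μ ≤ ∫⁻ y, eLpNorm (fun x => F (x, y)) p μ ∂ν := by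
  have := ENNReal.HolderConjugate.conjExponent hp
  -- By converse Hölder it suffices to test against `H`; Tonelli then brings the `x`-integral
  -- inside, where Hölder applies slice by slice.
  refine eLpNorm_le_of_forall_lintegral_mul_le p p.conjExponent hF.lintegral_prod_right'
    fun H hH => ?_
  have hFH : Measurable fun z : X × Y => F z * H z.1 := hF.mul (hH.comp measurable_fst)
  calc ∫⁻ x, (∫⁻ y, F (x, y) ∂ν) * H x ∂μ = ∫⁻ x, ∫⁻ y, F (x, y) * H x ∂ν ∂μ := by
        refine lintegral_congr fun x => ?_
        have hFx : Measurable fun y => F (x, y) := hF.comp measurable_prodMk_left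
        rw [lintegral_mul_const _ hFx]
    _ = ∫⁻ y, ∫⁻ x, F (x, y) * H x ∂μ ∂ν := lintegral_lintegral_swap hFH.aemeasurable
    _ ≤ ∫⁻ y, eLpNorm (fun x => F (x, y)) p μ * eLpNorm H p.conjExponent μ ∂ν :=
        lintegral_mono fun y => lintegral_mul_le_eLpNorm p _
          (hF.comp measurable_prodMk_right).aemeasurable hH.aemeasurable
    _ = _ := lintegral_mul_const _ (measurable_eLpNorm_prod hF p)

/-- With `M` the sum of the two norms, $f^r=f^pf^{r-p}\le f^pM^{r-p}$ almost everywhere, and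
$\|f\|_p\le M$. This crude interpolation is all that raising an exponent needs. -/
theorem eLpNorm_le_top_add {f : X → ℝ≥0∞} {p r : ℝ≥0∞} (hp : p ≠ 0) (hpr : p ≤ r) :
    eLpNorm f r μ ≤ eLpNorm f ∞ μ + eLpNorm f p μ := by
  rcases eq_or_ne r ∞ with rfl | hr
  · exact le_self_add
  have hp' : p ≠ ∞ := ne_top_of_le_ne_top hr hpr
  have hr0 : r ≠ 0 := (lt_of_lt_of_le (pos_iff_ne_zero.2 hp) hpr).ne'
  have hpp := ENNReal.toReal_pos hp hp'
  have hrr := ENNReal.toReal_pos hr0 hr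
  have hle : 0 ≤ r.toReal - p.toReal := sub_nonneg.2 (ENNReal.toReal_mono hr hpr)
  set M := eLpNorm f ∞ μ + eLpNorm f p μ
  have hM : ∀ᵐ x ∂μ, f x ≤ M := by
    filter_upwards [eLpNorm_top_le_iff.1 (le_refl (eLpNorm f ∞ μ))] with x hx
    exact hx.trans le_self_add
  have hadd : ∀ t : ℝ≥0∞, t ^ r.toReal = t ^ p.toReal * t ^ (r.toReal - p.toReal) := fun t => by
    rw [← ENNReal.rpow_add_of_nonneg _ _ hpp.le hle, add_sub_cancel]
  rcases eq_or_ne M ∞ with hMt | hMt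
  · rw [hMt]; exact le_top
  rw [← ENNReal.rpow_le_rpow_iff hrr, eLpNorm_ennreal_rpow hr0 hr]
  calc ∫⁻ x, f x ^ r.toReal ∂μ ≤ ∫⁻ x, f x ^ p.toReal * M ^ (r.toReal - p.toReal) ∂μ := by
        refine lintegral_mono_ae ?_
        filter_upwards [hM] with x hx
        rw [hadd]
        gcongr
    _ = eLpNorm f p μ ^ p.toReal * M ^ (r.toReal - p.toReal) := by
        rw [lintegral_mul_const' _ _ (ENNReal.rpow_ne_top_of_nonneg hle hMt),
          eLpNorm_ennreal_rpow hp hp']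
    _ ≤ M ^ r.toReal := by
        rw [hadd M]
        gcongr
        exact le_add_self

theorem tendsto_eLpNorm_zero {f : ℕ → X → ℝ≥0∞} (hf : ∀ n, Measurable (f n)) {g : X → ℝ≥0∞}
    (hfg : ∀ n x, f n x ≤ g x) {p : ℝ≥0∞} (hp0 : p ≠ 0) (hp : p ≠ ∞) (hg : eLpNorm g p μ ≠ ∞)
    (hlim : ∀ᵐ x ∂μ, Tendsto (fun n => f n x) atTop (𝓝 0)) :
    Tendsto (fun n => eLpNorm (f n) p μ) atTop (𝓝 0) := by
  have hpos := ENNReal.toReal_pos hp0 hp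
  simp only [eLpNorm_ennreal_eq hp0 hp]
  have h0 : (0 : ℝ≥0∞) = (∫⁻ _, 0 ∂μ) ^ (1 / p.toReal) := by
    simp [ENNReal.zero_rpow_of_pos (inv_pos.2 hpos)]
  rw [h0]
  refine ((ENNReal.continuous_rpow_const).tendsto _).comp
    (tendsto_lintegral_of_dominated_convergence (fun x => g x ^ p.toReal)
      (fun n => (hf n).pow_const _)
      (fun n => Eventually.of_forall fun x => ENNReal.rpow_le_rpow (hfg n x) hpos.le) ?_ ?_)
  · rw [← eLpNorm_ennreal_rpow hp0 hp]
    exact ENNReal.rpow_ne_top_of_nonneg hpos.le hg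
  · filter_upwards [hlim] with x hx
    have := ((ENNReal.continuous_rpow_const (y := p.toReal)).tendsto 0).comp hx
    rwa [ENNReal.zero_rpow_of_pos hpos] at this

/-- Dominated convergence in `x` and then in `y`, each needing a finite exponent; finiteness of the
mixed norm makes almost every slice norm finite. -/
theorem tendsto_mixedENorm_indicator_compl [SFinite μ] {V : X × Y → ℝ≥0∞} (hV : Measurable V)
    {B : ℕ → Set (X × Y)} (hB : ∀ n, MeasurableSet (B n)) (hm : Monotone B)
    (hU : ∀ z, ∃ n, z ∈ B n) {p q : ℝ≥0∞} (hp0 : p ≠ 0) (hp : p ≠ ∞) (hq0 : q ≠ 0) (hq : q ≠ ∞)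
    (hfin : mixedENorm μ ν p q V ≠ ∞) :
    Tendsto (fun n => mixedENorm μ ν p q ((B n)ᶜ.indicator V)) atTop (𝓝 0) := by
  have hVn : ∀ n, Measurable ((B n)ᶜ.indicator V) := fun n => hV.indicator (hB n).compl
  have hle : ∀ n z, (B n)ᶜ.indicator V z ≤ V z := fun n z => Set.indicator_le_self _ _ _
  refine tendsto_eLpNorm_zero (fun n => measurable_eLpNorm_prod (hVn n) p)
    (fun n y => eLpNorm_ennreal_mono p fun x => hle n (x, y)) hq0 hq hfin ?_
  have hfin' : ∀ᵐ y ∂ν, eLpNorm (fun x => V (x, y)) p μ < ∞ := by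
    have hpos := ENNReal.toReal_pos hq0 hq
    have h1 : ∫⁻ y, eLpNorm (fun x => V (x, y)) p μ ^ q.toReal ∂ν ≠ ∞ := by
      rw [← eLpNorm_ennreal_rpow hq0 hq]
      exact ENNReal.rpow_ne_top_of_nonneg hpos.le hfin
    filter_upwards [ae_lt_top ((measurable_eLpNorm_prod hV p).pow_const _) h1] with y hy
    exact (ENNReal.rpow_lt_top_iff_of_pos hpos).1 hy
  filter_upwards [hfin'] with y hy
  refine tendsto_eLpNorm_zero (fun n => (hVn n).comp measurable_prodMk_right)
    (fun n x => hle n (x, y)) hp0 hp hy.ne (Eventually.of_forall fun x => ?_)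
  obtain ⟨k, hk⟩ := hU (x, y)
  refine tendsto_const_nhds.congr' ?_
  filter_upwards [eventually_ge_atTop k] with n hn
  exact (Set.indicator_of_notMem (by simpa using hm hn hk) V).symm

end MixedNorm

/-! ### Young's inequality for correlations -/

section Young

variable {X : Type*} [MeasurableSpace X] [AddCommGroup X] [MeasurableAdd₂ X]
  {μ : Measure X}

/-- The correlation `x ↦ ∫ N(x') w(x' - x) dx'`. -/
noncomputable def correlation (μ : Measure X) (N w : X → ℝ≥0∞) (x : X) : ℝ≥0∞ :=
  ∫⁻ x', N x' * w (x' - x) ∂μ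

theorem eLpNorm_ennreal_comp_add_right [μ.IsAddLeftInvariant] {f : X → ℝ≥0∞}
    (hf : Measurable f) (p : ℝ≥0∞) (a : X) :
    eLpNorm (fun x => f (x + a)) p μ = eLpNorm f p μ :=
  eLpNorm_comp_measurePreserving hf.aestronglyMeasurable (measurePreserving_add_right μ a)

theorem correlation_eq [μ.IsAddLeftInvariant] {N w : X → ℝ≥0∞} (x : X) :
    correlation μ N w x = ∫⁻ u, N (x + u) * w u ∂μ := by
  rw [correlation, ← lintegral_add_left_eq_self _ x]
  simp

theorem measurable_correlation_uncurry [MeasurableNeg X] [SigmaFinite μ] {Y : Type*}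
    [MeasurableSpace Y] {V : X × Y → ℝ≥0∞}
    {w : X → ℝ≥0∞} (hV : Measurable V) (hw : Measurable w) :
    Measurable fun z : X × Y => correlation μ (fun x => V (x, z.2)) w z.1 := by
  refine Measurable.lintegral_prod_right' (f := fun t : (X × Y) × X =>
    V (t.2, t.1.2) * w (t.2 - t.1.1)) ?_
  have h2 : Measurable fun t : (X × Y) × X => t.2 - t.1.1 := by
    simp only [sub_eq_add_neg]
    fun_prop
  exact (hV.comp (by fun_prop)).mul (hw.comp h2)

variable [SigmaFinite μ] [μ.IsAddLeftInvariant]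

/-- Hölder with `w` in $L^{p'}$ bounds the supremum, Minkowski with `w` in $L^1$ bounds the
`p`-norm, and every `r ≥ p` lies between. -/
theorem eLpNorm_correlation_le {N w : X → ℝ≥0∞} (hN : Measurable N) (hw : Measurable w)
    {p p' : ℝ≥0∞} [p.HolderConjugate p'] {r : ℝ≥0∞} (hpr : p ≤ r) :
    eLpNorm (correlation μ N w) r μ ≤
      (eLpNorm w p' μ + eLpNorm w 1 μ) * eLpNorm N p μ := by
  have hp : 1 ≤ p := one_le_of_holderConjugate p p'
  refine (eLpNorm_le_top_add (zero_lt_one.trans_le hp).ne' hpr).trans ?_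
  rw [add_mul]
  gcongr
  · refine eLpNorm_top_le_iff.2 (Filter.Eventually.of_forall fun x => ?_)
    have hw' : Measurable fun x' => w (x' + -x) := hw.comp (measurable_add_const _)
    refine (lintegral_mul_le_eLpNorm p p' hN.aemeasurable (g := fun x' => w (x' - x))
      (by simpa only [sub_eq_add_neg] using hw'.aemeasurable)).trans_eq ?_
    rw [mul_comm]
    simp only [sub_eq_add_neg, eLpNorm_ennreal_comp_add_right hw]
  · have hF : Measurable fun z : X × X => N (z.1 + z.2) * w z.2 :=
      (hN.comp measurable_add).mul (hw.comp measurable_snd)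
    have h1 : correlation μ N w = fun x => ∫⁻ u, N (x + u) * w u ∂μ := funext correlation_eq
    rw [h1]
    refine (eLpNorm_lintegral_le hp hF).trans ?_
    rw [eLpNorm_ennreal_one, ← lintegral_mul_const _ hw]
    refine lintegral_mono fun u => ?_
    simp only [mul_comm (N _)]
    have hNu : Measurable fun x => N (x + u) := hN.comp (measurable_add_const u)
    refine (eLpNorm_ennreal_const_mul hNu _ _).trans_eq ?_
    rw [eLpNorm_ennreal_comp_add_right hN]

/-- Young's inequality for mixed norms and a tensor product kernel. -/
theorem mixedENorm_correlation_le [MeasurableNeg X] {V : X × X → ℝ≥0∞} (hV : Measurable V)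
    {w : X → ℝ≥0∞} (hw : Measurable w) {p p' q q' r s : ℝ≥0∞} [p.HolderConjugate p'] [q.HolderConjugate q']
    (hpr : p ≤ r) (hqs : q ≤ s) :
    mixedENorm μ μ r s (fun z =>
        ∫⁻ z', V z' * (w (z'.1 - z.1) * w (z'.2 - z.2)) ∂(μ.prod μ)) ≤
      ((eLpNorm w q' μ + eLpNorm w 1 μ) * (eLpNorm w p' μ + eLpNorm w 1 μ)) *
        mixedENorm μ μ p q V := by
  have hr : 1 ≤ r := (one_le_of_holderConjugate p p').trans hpr
  have hs : 1 ≤ s := (one_le_of_holderConjugate q q').trans hqs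
  set G : X × X → ℝ≥0∞ := fun z => correlation μ (fun x => V (x, z.2)) w z.1
  have hG : Measurable G := measurable_correlation_uncurry hV hw
  have hsub : Measurable fun z : X × X => z.1 - z.2 := by
    simp only [sub_eq_add_neg]
    exact measurable_fst.add measurable_snd.neg
  have hsub1 : ∀ a : X, Measurable fun x : X => x - a := fun a => by
    simp only [sub_eq_add_neg]
    exact measurable_id.add measurable_const
  -- The tensor kernel lets the first variable be integrated out: the double correlation is a
  -- correlation in `y` of the correlation `G` in `x`.
  have h1 : ∀ z : X × X, ∫⁻ z', V z' * (w (z'.1 - z.1) * w (z'.2 - z.2)) ∂(μ.prod μ) =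
      ∫⁻ y', G (z.1, y') * w (y' - z.2) ∂μ := by
    intro z
    have ha : Measurable fun z' : X × X => w (z'.1 - z.1) :=
      hw.comp ((hsub1 _).comp measurable_fst)
    have hb : Measurable fun z' : X × X => w (z'.2 - z.2) :=
      hw.comp ((hsub1 _).comp measurable_snd)
    rw [lintegral_prod_symm (fun z' : X × X => V z' * (w (z'.1 - z.1) * w (z'.2 - z.2)))
      (hV.mul (ha.mul hb)).aemeasurable]
    refine lintegral_congr fun y' => ?_
    simp only [← mul_assoc]
    have hVa : Measurable fun x => V (x, y') * w (x - z.1) :=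
      (hV.mul ha).comp measurable_prodMk_right
    rw [lintegral_mul_const _ hVa]
    rfl
  simp only [h1]
  set N : X → ℝ≥0∞ := fun y => eLpNorm (fun x => V (x, y)) p μ
  have hN : Measurable N := measurable_eLpNorm_prod hV p
  set C := eLpNorm w p' μ + eLpNorm w 1 μ
  -- Minkowski puts the inner norm under the `y'`-integral and Young in `x` bounds each slice by `C
  -- * N y'`. What remains is a correlation of `N`, to which Young in `y` applies.
  have h2 : ∀ y, eLpNorm (fun x => ∫⁻ y', G (x, y') * w (y' - y) ∂μ) r μ ≤
      C * correlation μ N w y := by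
    intro y
    have hwy : Measurable fun z : X × X => w (z.2 - y) := hw.comp ((hsub1 _).comp measurable_snd)
    refine (eLpNorm_lintegral_le hr (F := fun z => G z * w (z.2 - y)) (hG.mul hwy)).trans ?_
    have hNw : Measurable fun x' => N x' * w (x' - y) := hN.mul (hw.comp (hsub1 y))
    rw [correlation, ← lintegral_const_mul _ hNw]
    refine lintegral_mono fun y' => ?_
    simp only [mul_comm (G _)]
    refine (eLpNorm_ennreal_const_mul (hG.comp measurable_prodMk_right) _ _).trans ?_
    rw [mul_comm, ← mul_assoc]
    gcongr
    exact eLpNorm_correlation_le (hV.comp measurable_prodMk_right) hw hpr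
  refine (eLpNorm_ennreal_mono s h2).trans ?_
  have hcm : Measurable (correlation μ N w) :=
    (measurable_correlation_uncurry (Y := Unit) (hN.comp measurable_fst) hw).comp
      (measurable_prodMk_right (y := ()))
  refine (eLpNorm_ennreal_const_mul hcm _ _).trans ?_
  rw [mul_comm _ C, mul_assoc]
  gcongr
  exact eLpNorm_correlation_le hN hw hqs

end Young

/-! ### Integration of functions with values in Schwartz space -/

section SchwartzIntegral

open Filter Topology

variable {E : Type*} [NormedAddCommGroup E] [NormedSpace ℝ E]

/-- The space of `l`-th derivatives of complex functions on `E`, as a normed space. -/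
def DerivSpace (E : Type*) [NormedAddCommGroup E] [NormedSpace ℝ E] (l : ℕ) : Type _ :=
  ContinuousMultilinearMap ℝ (fun _ : Fin l => E) ℂ

noncomputable instance (l : ℕ) : NormedAddCommGroup (DerivSpace E l) :=
  inferInstanceAs (NormedAddCommGroup (ContinuousMultilinearMap ℝ (fun _ : Fin l => E) ℂ))

noncomputable instance (l : ℕ) : NormedSpace ℝ (DerivSpace E l) :=
  inferInstanceAs (NormedSpace ℝ (ContinuousMultilinearMap ℝ (fun _ : Fin l => E) ℂ))

noncomputable instance (l : ℕ) : NormedSpace ℂ (DerivSpace E l) :=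
  inferInstanceAs (NormedSpace ℂ (ContinuousMultilinearMap ℝ (fun _ : Fin l => E) ℂ))

instance (l : ℕ) : SMulCommClass ℝ ℂ (DerivSpace E l) :=
  inferInstanceAs (SMulCommClass ℝ ℂ (ContinuousMultilinearMap ℝ (fun _ : Fin l => E) ℂ))

instance (l : ℕ) : CompleteSpace (DerivSpace E l) :=
  inferInstanceAs (CompleteSpace (ContinuousMultilinearMap ℝ (fun _ : Fin l => E) ℂ))

/-- The `l`-th derivative of a Schwartz function. -/
noncomputable def schwartzDeriv (l : ℕ) (φ : 𝓢(E, ℂ)) (t : E) : DerivSpace E l :=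
  iteratedFDeriv ℝ l φ t

theorem norm_schwartzDeriv (l : ℕ) (φ : 𝓢(E, ℂ)) (t : E) :
    ‖schwartzDeriv l φ t‖ = ‖iteratedFDeriv ℝ l φ t‖ := rfl

theorem continuous_schwartzDeriv (l : ℕ) (φ : 𝓢(E, ℂ)) : Continuous (schwartzDeriv l φ) :=
  (φ.smooth l).continuous_iteratedFDeriv le_rfl

theorem schwartzDeriv_add (l : ℕ) (φ ψ : 𝓢(E, ℂ)) (t : E) :
    schwartzDeriv l (φ + ψ) t = schwartzDeriv l φ t + schwartzDeriv l ψ t :=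
  iteratedFDeriv_add_apply ((φ.smooth l).contDiffAt) ((ψ.smooth l).contDiffAt)

theorem schwartzDeriv_smul (l : ℕ) (a : ℂ) (φ : 𝓢(E, ℂ)) (t : E) :
    schwartzDeriv l (a • φ) t = a • schwartzDeriv l φ t :=
  iteratedFDeriv_const_smul_apply (φ.smooth l).contDiffAt

/-- The weighted derivative `t ↦ ‖t‖ ^ k • D^l φ(t)` as a bounded continuous function. -/
noncomputable def weightedDeriv (E : Type*) [NormedAddCommGroup E] [NormedSpace ℝ E] (k l : ℕ) :
    𝓢(E, ℂ) →L[ℂ] BoundedContinuousFunction E (DerivSpace E l) :=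
  SchwartzMap.mkCLMtoNormedSpace (σ := RingHom.id ℂ)
    (fun φ => BoundedContinuousFunction.ofNormedAddCommGroup
      (fun t => ‖t‖ ^ k • schwartzDeriv l φ t)
      ((continuous_norm.pow k).smul (continuous_schwartzDeriv l φ))
      (SchwartzMap.seminorm ℂ k l φ)
      fun t => by
        rw [norm_smul, norm_pow, norm_norm]
        exact SchwartzMap.le_seminorm ℂ k l φ t)
    (fun φ ψ => by
      ext1 t
      simp only [BoundedContinuousFunction.coe_ofNormedAddCommGroup,
        BoundedContinuousFunction.coe_add, Pi.add_apply]
      rw [schwartzDeriv_add, smul_add])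
    (fun a φ => by
      ext1 t
      simp only [BoundedContinuousFunction.coe_ofNormedAddCommGroup,
        BoundedContinuousFunction.coe_smul, RingHom.id_apply]
      rw [schwartzDeriv_smul, smul_comm])
    ⟨{(k, l)}, 1, zero_le_one, fun φ => by
      rw [one_mul, Finset.sup_singleton]
      exact BoundedContinuousFunction.norm_ofNormedAddCommGroup_le _ (apply_nonneg _ _) _⟩

theorem weightedDeriv_apply (k l : ℕ) (φ : 𝓢(E, ℂ)) (t : E) :
    weightedDeriv E k l φ t = ‖t‖ ^ k • schwartzDeriv l φ t := rfl

/-- Realises each Schwartz seminorm as a Banach space norm, so that Hahn–Banach and the Bochner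
integral become available. -/
theorem norm_weightedDeriv (k l : ℕ) (φ : 𝓢(E, ℂ)) :
    ‖weightedDeriv E k l φ‖ = SchwartzMap.seminorm ℂ k l φ := by
  refine le_antisymm ((BoundedContinuousFunction.norm_le (apply_nonneg _ _)).2 fun t => ?_) ?_
  · rw [weightedDeriv_apply, norm_smul, norm_pow, norm_norm]
    exact SchwartzMap.le_seminorm ℂ k l φ t
  refine SchwartzMap.seminorm_le_bound ℂ k l φ (norm_nonneg _) fun t => ?_
  have := (weightedDeriv E k l φ).norm_coe_le_norm t
  rwa [weightedDeriv_apply, norm_smul, norm_pow, norm_norm] at this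

/-- Every continuous linear functional on Schwartz space factors through finitely many weighted
derivatives. -/
theorem exists_eq_sum_weightedDeriv (f : 𝓢(E, ℂ) →L[ℂ] ℂ) :
    ∃ (s : Finset (ℕ × ℕ)) (g : ∀ i : s, BoundedContinuousFunction E (DerivSpace E i.1.2) →L[ℂ] ℂ),
      ∀ φ, f φ = ∑ i : s, g i (weightedDeriv E i.1.1 i.1.2 φ) := by
  classical
  have hq : Continuous ((normSeminorm ℂ ℂ).comp f.toLinearMap) :=
    continuous_norm.comp f.continuous
  obtain ⟨s, C, -, hC⟩ :=
    Seminorm.bound_of_continuous (schwartz_withSeminorms ℂ E ℂ) _ hq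
  let J : 𝓢(E, ℂ) →ₗ[ℂ] (∀ i : s, BoundedContinuousFunction E (DerivSpace E i.1.2)) :=
    LinearMap.pi fun i => (weightedDeriv E i.1.1 i.1.2).toLinearMap
  have hJ : ∀ φ, ‖f φ‖ ≤ C * ‖J φ‖ := by
    intro φ
    have h1 : ‖f φ‖ ≤ C * (s.sup (schwartzSeminormFamily ℂ E ℂ)) φ := hC φ
    refine h1.trans ?_
    gcongr
    refine Seminorm.finset_sup_apply_le (norm_nonneg _) fun i hi => ?_
    have h2 : schwartzSeminormFamily ℂ E ℂ i φ = ‖J φ ⟨i, hi⟩‖ :=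
      (norm_weightedDeriv i.1 i.2 φ).symm
    rw [h2]
    exact norm_le_pi_norm (J φ) _
  -- The bound by `‖J φ‖` makes `f` descend to a bounded functional on the range of `J`, which
  -- Hahn–Banach extends to the finite product; the `g i` are its components.
  have hker : LinearMap.ker J ≤ LinearMap.ker f.toLinearMap := by
    intro φ hφ
    rw [LinearMap.mem_ker] at hφ ⊢
    have := hJ φ
    rw [hφ] at this
    simp only [norm_zero, mul_zero] at this
    exact norm_le_zero_iff.1 this
  let g0 : LinearMap.range J →ₗ[ℂ] ℂ :=
    ((LinearMap.ker J).liftQ f.toLinearMap hker) ∘ₗ J.quotKerEquivRange.symm.toLinearMap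
  have hg0 : ∀ φ, g0 ⟨J φ, LinearMap.mem_range_self J φ⟩ = f φ := by
    intro φ
    simp only [g0, LinearMap.comp_apply, LinearEquiv.coe_coe]
    rw [LinearMap.quotKerEquivRange_symm_apply_image]
    simp
  obtain ⟨g, hg, -⟩ := exists_extension_norm_eq (LinearMap.range J)
    (g0.mkContinuous C (by
      rintro ⟨_, φ, rfl⟩
      have := hg0 φ
      rw [this]
      exact hJ φ))
  refine ⟨s, fun i => g ∘L ContinuousLinearMap.single ℂ
    (fun i : s => BoundedContinuousFunction E (DerivSpace E i.1.2)) i, fun φ => ?_⟩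
  have h1 := hg ⟨J φ, LinearMap.mem_range_self J φ⟩
  rw [LinearMap.mkContinuous_apply, hg0] at h1
  rw [← h1]
  simp only [ContinuousLinearMap.comp_apply]
  rw [← map_sum]
  congr 1
  exact (Finset.univ_sum_single (J φ)).symm

variable {Z : Type*} [MeasurableSpace Z] {ν : Measure Z}

/-- Integrability of a function with values in Schwartz space. -/
def SchwartzIntegrable (K : Z → 𝓢(E, ℂ)) (ν : Measure Z) : Prop :=
  ∀ k l : ℕ, Integrable (fun z => weightedDeriv E k l (K z)) ν

/-- Currying of the first variable of a derivative. -/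
noncomputable def curryDeriv (E : Type*) [NormedAddCommGroup E] [NormedSpace ℝ E] (l : ℕ) :
    DerivSpace E (l + 1) ≃ₗᵢ[ℝ] (E →L[ℝ] DerivSpace E l) :=
  continuousMultilinearCurryLeftEquiv ℝ (fun _ : Fin (l + 1) => E) ℂ

theorem hasFDerivAt_schwartzDeriv (l : ℕ) (φ : 𝓢(E, ℂ)) (t : E) :
    HasFDerivAt (schwartzDeriv l φ) (curryDeriv E l (schwartzDeriv (l + 1) φ t)) t := by
  have h1 := ((φ.smooth ⊤).differentiable_iteratedFDeriv
    (by exact_mod_cast WithTop.coe_lt_top l) t).hasFDerivAt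
  have h2 : curryDeriv E l (schwartzDeriv (l + 1) φ t) = fderiv ℝ (iteratedFDeriv ℝ l φ) t := by
    unfold schwartzDeriv
    rw [iteratedFDeriv_succ_eq_comp_left, Function.comp_apply]
    exact LinearIsometryEquiv.apply_symm_apply _ _
  rw [h2]
  exact h1

theorem SchwartzIntegrable.schwartzDeriv_integrable {K : Z → 𝓢(E, ℂ)}
    (hK : SchwartzIntegrable K ν) (l : ℕ) (t : E) :
    Integrable (fun z => schwartzDeriv l (K z) t) ν := by
  have : Integrable (fun z => weightedDeriv E 0 l (K z) t) ν :=
    (BoundedContinuousFunction.evalCLM ℝ t).integrable_comp (hK 0 l)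
  simpa only [weightedDeriv_apply, pow_zero, one_smul] using this

/-- Differentiation under the integral sign; the supremum norm of the next derivative dominates for
all `t` at once and is integrable by hypothesis. -/
theorem SchwartzIntegrable.hasFDerivAt_integral {K : Z → 𝓢(E, ℂ)}
    (hK : SchwartzIntegrable K ν) (l : ℕ) (t : E) :
    HasFDerivAt (fun t => ∫ z, schwartzDeriv l (K z) t ∂ν)
      (curryDeriv E l (∫ z, schwartzDeriv (l + 1) (K z) t ∂ν)) t := by
  have h0 : ∫ z, curryDeriv E l (schwartzDeriv (l + 1) (K z) t) ∂ν =
      curryDeriv E l (∫ z, schwartzDeriv (l + 1) (K z) t ∂ν) :=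
    (curryDeriv E l).toContinuousLinearEquiv.toContinuousLinearMap.integral_comp_comm
      (hK.schwartzDeriv_integrable (l + 1) t)
  rw [← h0]
  refine hasFDerivAt_integral_of_dominated_of_fderiv_le (s := Set.univ) (𝕜 := ℝ)
    (F := fun t z => schwartzDeriv l (K z) t)
    (F' := fun t z => curryDeriv E l (schwartzDeriv (l + 1) (K z) t))
    (bound := fun z => ‖weightedDeriv E 0 (l + 1) (K z)‖) univ_mem ?_ ?_ ?_ ?_ ?_ ?_
  · exact Eventually.of_forall fun t => (hK.schwartzDeriv_integrable l t).aestronglyMeasurable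
  · exact hK.schwartzDeriv_integrable l t
  · exact (curryDeriv E l).continuous.comp_aestronglyMeasurable
      (hK.schwartzDeriv_integrable (l + 1) t).aestronglyMeasurable
  · refine Eventually.of_forall fun z t _ => ?_
    rw [LinearIsometryEquiv.norm_map, norm_weightedDeriv, norm_schwartzDeriv]
    exact SchwartzMap.norm_iteratedFDeriv_le_seminorm ℂ (K z) (l + 1) t
  · exact (hK 0 (l + 1)).norm
  · exact Eventually.of_forall fun z t _ => hasFDerivAt_schwartzDeriv l (K z) t

theorem SchwartzIntegrable.iteratedFDeriv_integral {K : Z → 𝓢(E, ℂ)}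
    (hK : SchwartzIntegrable K ν) (l : ℕ) (t : E) :
    iteratedFDeriv ℝ l (fun t => ∫ z, K z t ∂ν) t = ∫ z, schwartzDeriv l (K z) t ∂ν := by
  induction l generalizing t with
  | zero =>
    have h := ((continuousMultilinearCurryFin0 ℝ E ℂ).symm.toContinuousLinearEquiv
      |>.integral_comp_comm (μ := ν) fun z => K z t)
    rw [iteratedFDeriv_zero_eq_comp]
    exact h.symm
  | succ l ih =>
    rw [iteratedFDeriv_succ_eq_comp_left, Function.comp_apply]
    have h1 : iteratedFDeriv ℝ l (fun t => ∫ z, K z t ∂ν) =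
      fun t => ∫ z, schwartzDeriv l (K z) t ∂ν := funext ih
    have h2 : fderiv ℝ (iteratedFDeriv ℝ l (fun t => ∫ z, K z t ∂ν)) t =
        curryDeriv E l (∫ z, schwartzDeriv (l + 1) (K z) t ∂ν) := by
      rw [h1]
      exact (hK.hasFDerivAt_integral l t).fderiv
    rw [h2]
    exact (curryDeriv E l).symm_apply_apply _

theorem SchwartzIntegrable.differentiable_iteratedFDeriv_integral {K : Z → 𝓢(E, ℂ)}
    (hK : SchwartzIntegrable K ν) (l : ℕ) :
    Differentiable ℝ (iteratedFDeriv ℝ l (fun t => ∫ z, K z t ∂ν)) := by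
  rw [funext (hK.iteratedFDeriv_integral l)]
  exact fun t => (hK.hasFDerivAt_integral l t).differentiableAt

/-- The integral of a function with values in Schwartz space exists as a Schwartz function, and
commutes with all continuous linear functionals. -/
theorem SchwartzIntegrable.exists_integral {K : Z → 𝓢(E, ℂ)} (hK : SchwartzIntegrable K ν) :
    ∃ ψ : 𝓢(E, ℂ), ∀ f : 𝓢(E, ℂ) →L[ℂ] ℂ, Integrable (fun z => f (K z)) ν ∧
      f ψ = ∫ z, f (K z) ∂ν := by
  -- The pointwise integral; its Schwartz bounds are the integrals of the seminorms of `K z`.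
  let ψ : 𝓢(E, ℂ) :=
    { toFun := fun t => ∫ z, K z t ∂ν
      smooth' := contDiff_of_differentiable_iteratedFDeriv
        fun m _ => hK.differentiable_iteratedFDeriv_integral m
      decay' := fun k l => ⟨∫ z, ‖weightedDeriv E k l (K z)‖ ∂ν, fun t => by
        calc ‖t‖ ^ k * ‖iteratedFDeriv ℝ l (fun t => ∫ z, K z t ∂ν) t‖
            = ‖t‖ ^ k * ‖∫ z, schwartzDeriv l (K z) t ∂ν‖ := by
              rw [hK.iteratedFDeriv_integral l t]
              rfl
          _ = ‖∫ z, weightedDeriv E k l (K z) t ∂ν‖ := by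
              simp only [weightedDeriv_apply]
              rw [integral_smul, norm_smul, norm_pow, norm_norm]
          _ ≤ _ := norm_integral_le_of_norm_le (hK k l).norm
              (Eventually.of_forall fun z => BoundedContinuousFunction.norm_coe_le_norm _ t)⟩ }
  -- Evaluation at points identifies each weighted derivative of `ψ` with a Bochner integral. A
  -- functional on Schwartz space is a finite sum of bounded functionals of these, and such
  -- functionals commute with the integral.
  have hψ : ∀ k l, weightedDeriv E k l ψ = ∫ z, weightedDeriv E k l (K z) ∂ν := by
    intro k l
    ext1 t
    have h1 : ∫ z, weightedDeriv E k l (K z) t ∂ν = (∫ z, weightedDeriv E k l (K z) ∂ν) t :=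
      (BoundedContinuousFunction.evalCLM ℝ t).integral_comp_comm (hK k l)
    rw [← h1]
    simp only [weightedDeriv_apply]
    rw [integral_smul]
    congr 1
    exact hK.iteratedFDeriv_integral l t
  refine ⟨ψ, fun f => ?_⟩
  obtain ⟨s, g, hg⟩ := exists_eq_sum_weightedDeriv f
  simp only [hg, hψ]
  have hi : ∀ i : s, Integrable (fun z => g i (weightedDeriv E i.1.1 i.1.2 (K z))) ν :=
    fun i => (g i).integrable_comp (hK _ _)
  refine ⟨integrable_finsetSum _ fun i _ => hi i, ?_⟩
  rw [integral_finsetSum _ fun i _ => hi i]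
  exact Finset.sum_congr rfl fun i _ => ((g i).integral_comp_comm (hK _ _)).symm

/-- The spaces of bounded continuous functions need not be separable; strong measurability comes
from continuity of `K` on a second countable space. -/
theorem SchwartzIntegrable.of_continuous [TopologicalSpace Z] [SecondCountableTopology Z]
    [OpensMeasurableSpace Z] {K : Z → 𝓢(E, ℂ)} (hK : Continuous K) {F : Z → ℂ}
    (hF : AEStronglyMeasurable F ν)
    (h : ∀ k l, ∃ b : Z → ℝ, Integrable b ν ∧
      ∀ z, ‖F z‖ * SchwartzMap.seminorm ℂ k l (K z) ≤ b z) :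
    SchwartzIntegrable (fun z => F z • K z) ν := by
  intro k l
  obtain ⟨b, hb, hbd⟩ := h k l
  refine hb.mono' ?_ (Eventually.of_forall fun z => ?_)
  · simp only [map_smul]
    have h1 : Continuous fun z => weightedDeriv E k l (K z) :=
      (weightedDeriv E k l).continuous.comp hK
    exact hF.smul h1.aestronglyMeasurable
  · rw [norm_weightedDeriv, map_smul_eq_mul]
    exact hbd z

end SchwartzIntegral

/-! ### Translations: polynomial growth and strong continuity -/

section Translation

open Filter Topology

variable {V : Type*} [NormedAddCommGroup V] [NormedSpace ℝ V]

/-- The weight inequality $\|t\|\le(1+\|a\|)(1+\|t-a\|)$ moves the polynomial weight to the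
translated point. -/
theorem seminorm_translate_le (k l : ℕ) (φ : 𝓢(V, ℂ)) (a : V) :
    SchwartzMap.seminorm ℂ k l (SchwartzMap.compSubConstCLM ℂ a φ) ≤
      (1 + ‖a‖) ^ k * (2 ^ k * (Finset.Iic (k, l)).sup (schwartzSeminormFamily ℂ V ℂ) φ) := by
  refine SchwartzMap.seminorm_le_bound ℂ k l _ (by positivity) fun t => ?_
  have h1 : iteratedFDeriv ℝ l (SchwartzMap.compSubConstCLM ℂ a φ) t =
      iteratedFDeriv ℝ l φ (t - a) := iteratedFDeriv_comp_sub l a t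
  have h2 : ‖t‖ ≤ (1 + ‖a‖) * (1 + ‖t - a‖) := by
    have := norm_add_le (t - a) a
    rw [sub_add_cancel] at this
    nlinarith [norm_nonneg a, norm_nonneg (t - a)]
  have h3 := SchwartzMap.one_add_le_sup_seminorm_apply (𝕜 := ℂ) (m := (k, l)) le_rfl le_rfl φ
    (t - a)
  rw [h1]
  calc ‖t‖ ^ k * ‖iteratedFDeriv ℝ l φ (t - a)‖
      ≤ ((1 + ‖a‖) * (1 + ‖t - a‖)) ^ k * ‖iteratedFDeriv ℝ l φ (t - a)‖ := by gcongr
    _ = (1 + ‖a‖) ^ k * ((1 + ‖t - a‖) ^ k * ‖iteratedFDeriv ℝ l φ (t - a)‖) := by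
        rw [mul_pow, mul_assoc]
    _ ≤ _ := mul_le_mul_of_nonneg_left h3 (by positivity)

/-- Stated for arbitrary continuous seminorms so that it can be iterated and conjugated by the
Fourier transform. A continuous seminorm is bounded by a finite supremum of basic ones, and
induction runs over that finite set. -/
theorem exists_seminorm_translate_le (P : Seminorm ℂ 𝓢(V, ℂ)) (hP : Continuous P) :
    ∃ (N : ℕ) (Q : Seminorm ℂ 𝓢(V, ℂ)), Continuous Q ∧
      ∀ a φ, P (SchwartzMap.compSubConstCLM ℂ a φ) ≤ (1 + ‖a‖) ^ N * Q φ := by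
  classical
  have hw := schwartz_withSeminorms ℂ V ℂ
  obtain ⟨s, C, -, hC⟩ := Seminorm.bound_of_continuous hw P hP
  suffices H : ∀ s : Finset (ℕ × ℕ), ∃ (N : ℕ) (Q : Seminorm ℂ 𝓢(V, ℂ)), Continuous Q ∧
      ∀ a φ, (s.sup (schwartzSeminormFamily ℂ V ℂ) : Seminorm ℂ 𝓢(V, ℂ))
        (SchwartzMap.compSubConstCLM ℂ a φ) ≤ (1 + ‖a‖) ^ N * Q φ by
    obtain ⟨N, Q, hQ, h⟩ := H s
    refine ⟨N, C • Q, hQ.const_smul C, fun a φ => (hC _).trans ?_⟩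
    calc (C : ℝ) * (s.sup (schwartzSeminormFamily ℂ V ℂ) : Seminorm ℂ 𝓢(V, ℂ))
          (SchwartzMap.compSubConstCLM ℂ a φ) ≤ C * ((1 + ‖a‖) ^ N * Q φ) := by gcongr; exact h a φ
      _ = (1 + ‖a‖) ^ N * (C * Q φ) := by ring
  intro s
  induction s using Finset.induction_on with
  | empty => exact ⟨0, 0, continuous_const, fun a φ => by simp⟩
  | insert i s _ ih =>
    obtain ⟨N, Q, hQ, h⟩ := ih
    have hQ' : Continuous ((Finset.Iic i).sup (schwartzSeminormFamily ℂ V ℂ) :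
        Seminorm ℂ 𝓢(V, ℂ)) :=
      Seminorm.continuous_finsetSup fun j _ => hw.continuous_seminorm j
    refine ⟨i.1 + N, ((2 : NNReal) ^ i.1) • (Finset.Iic i).sup (schwartzSeminormFamily ℂ V ℂ) + Q,
      (hQ'.const_smul ((2 : NNReal) ^ i.1)).add hQ, fun a φ => ?_⟩
    have hQ0 := apply_nonneg Q φ
    have ha : 1 ≤ 1 + ‖a‖ := by linarith [norm_nonneg a]
    have h1 := seminorm_translate_le i.1 i.2 φ a
    set A := 2 ^ i.1 * (Finset.Iic (i.1, i.2)).sup (schwartzSeminormFamily ℂ V ℂ) φ with hA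
    have hA0 : 0 ≤ A := by positivity
    rw [Finset.sup_insert]
    change max _ _ ≤ (1 + ‖a‖) ^ (i.1 + N) * (A + Q φ)
    refine max_le (h1.trans ?_) ((h a φ).trans ?_)
    · exact mul_le_mul (pow_le_pow_right₀ ha (Nat.le_add_right _ _)) (le_add_of_nonneg_right hQ0)
        hA0 (by positivity)
    · exact mul_le_mul (pow_le_pow_right₀ ha (Nat.le_add_left _ _)) (le_add_of_nonneg_left hA0)
        hQ0 (by positivity)

theorem tendsto_schwartz_of_seminorm {E α : Type*} [NormedAddCommGroup E] [NormedSpace ℝ E]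
    {f : Filter α} {u : α → 𝓢(E, ℂ)} {y : 𝓢(E, ℂ)}
    (h : ∀ k l, Tendsto (fun x => SchwartzMap.seminorm ℂ k l (u x - y)) f (𝓝 0)) :
    Tendsto u f (𝓝 y) := by
  rw [(schwartz_withSeminorms ℂ E ℂ).tendsto_nhds]
  exact fun i ε hε => (h i.1 i.2).eventually_lt_const hε

/-- The mean value inequality on the segment from `t - a` to `t - b`. As `‖b - a‖ ≤ 1`, its points
`x` satisfy $\|t\|\le(2+\|a\|)(1+\|x\|)$, which absorbs the weight. -/
theorem seminorm_translate_sub_le (k l : ℕ) (φ : 𝓢(V, ℂ)) (a : V) {b : V} (hb : ‖b - a‖ ≤ 1) :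
    SchwartzMap.seminorm ℂ k l
      (SchwartzMap.compSubConstCLM ℂ b φ - SchwartzMap.compSubConstCLM ℂ a φ) ≤
      ((2 + ‖a‖) ^ k * (2 ^ k * (Finset.Iic (k, l + 1)).sup (schwartzSeminormFamily ℂ V ℂ) φ)) *
        ‖b - a‖ := by
  refine SchwartzMap.seminorm_le_bound ℂ k l _ (by positivity) fun t => ?_
  have h1 : ∀ c, schwartzDeriv l (SchwartzMap.compSubConstCLM ℂ c φ) t =
      schwartzDeriv l φ (t - c) := fun c => iteratedFDeriv_comp_sub l c t
  have h2 : ‖t‖ ^ k * ‖iteratedFDeriv ℝ l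
      (SchwartzMap.compSubConstCLM ℂ b φ - SchwartzMap.compSubConstCLM ℂ a φ : 𝓢(V, ℂ)) t‖ =
      ‖‖t‖ ^ k • schwartzDeriv l φ (t - b) - ‖t‖ ^ k • schwartzDeriv l φ (t - a)‖ := by
    have : schwartzDeriv l
        (SchwartzMap.compSubConstCLM ℂ b φ - SchwartzMap.compSubConstCLM ℂ a φ : 𝓢(V, ℂ)) t =
        schwartzDeriv l φ (t - b) - schwartzDeriv l φ (t - a) := by
      rw [sub_eq_add_neg, ← neg_one_smul ℂ, schwartzDeriv_add, schwartzDeriv_smul, h1, h1,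
        neg_one_smul, ← sub_eq_add_neg]
    rw [← smul_sub, ← this, norm_smul, norm_pow, norm_norm]
    rfl
  rw [h2]
  have h3 : ‖b - a‖ = ‖(t - b) - (t - a)‖ := by
    rw [sub_sub_sub_cancel_left, norm_sub_rev]
  rw [h3]
  have hd : ∀ x, HasFDerivAt (fun s => ‖t‖ ^ k • schwartzDeriv l φ s)
      (‖t‖ ^ k • curryDeriv V l (schwartzDeriv (l + 1) φ x)) x :=
    fun x => (hasFDerivAt_schwartzDeriv l φ x).const_smul (‖t‖ ^ k)
  refine Convex.norm_image_sub_le_of_norm_hasFDerivWithin_le (𝕜 := ℝ)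
    (f := fun s => ‖t‖ ^ k • schwartzDeriv l φ s)
    (fun x _ => (hd x).hasFDerivWithinAt) (fun x hx => ?_) (convex_segment (t - a) (t - b))
    (left_mem_segment ℝ _ _) (right_mem_segment ℝ _ _)
  have h4 : ‖t‖ ≤ (2 + ‖a‖) * (1 + ‖x‖) := by
    have hx1 : ‖x - (t - a)‖ ≤ 1 := by
      have h5 := norm_sub_le_of_mem_segment hx
      rw [← h3] at h5
      exact h5.trans hb
    have h6 : t = -(x - (t - a)) + x + a := by abel
    have h7 : ‖t‖ ≤ 1 + ‖x‖ + ‖a‖ := by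
      calc ‖t‖ = ‖-(x - (t - a)) + x + a‖ := by rw [← h6]
        _ ≤ ‖-(x - (t - a))‖ + ‖x‖ + ‖a‖ := norm_add₃_le
        _ ≤ _ := by rw [norm_neg]; gcongr
    nlinarith [norm_nonneg a, norm_nonneg x]
  have h5 := SchwartzMap.one_add_le_sup_seminorm_apply (𝕜 := ℂ) (m := (k, l + 1)) le_rfl le_rfl φ x
  rw [norm_smul, norm_pow, norm_norm, LinearIsometryEquiv.norm_map, norm_schwartzDeriv]
  calc ‖t‖ ^ k * ‖iteratedFDeriv ℝ (l + 1) φ x‖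
      ≤ ((2 + ‖a‖) * (1 + ‖x‖)) ^ k * ‖iteratedFDeriv ℝ (l + 1) φ x‖ := by gcongr
    _ = (2 + ‖a‖) ^ k * ((1 + ‖x‖) ^ k * ‖iteratedFDeriv ℝ (l + 1) φ x‖) := by
        rw [mul_pow, mul_assoc]
    _ ≤ _ := mul_le_mul_of_nonneg_left h5 (by positivity)

theorem continuous_translate (φ : 𝓢(V, ℂ)) :
    Continuous fun a : V => SchwartzMap.compSubConstCLM ℂ a φ := by
  refine continuous_iff_continuousAt.2 fun a => tendsto_schwartz_of_seminorm fun k l => ?_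
  have h1 : Tendsto (fun b : V => ((2 + ‖a‖) ^ k * (2 ^ k *
      (Finset.Iic (k, l + 1)).sup (schwartzSeminormFamily ℂ V ℂ) φ)) * ‖b - a‖) (𝓝 a) (𝓝 0) := by
    have : Continuous fun b : V => ((2 + ‖a‖) ^ k * (2 ^ k *
      (Finset.Iic (k, l + 1)).sup (schwartzSeminormFamily ℂ V ℂ) φ)) * ‖b - a‖ := by fun_prop
    simpa using this.tendsto a
  refine squeeze_zero' (Eventually.of_forall fun _ => apply_nonneg _ _) ?_ h1
  filter_upwards [Metric.closedBall_mem_nhds a one_pos] with b hb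
  rw [mem_closedBall_iff_norm] at hb
  exact seminorm_translate_sub_le k l φ a hb

end Translation

/-! ### Modulations and time-frequency shifts -/

section TimeFrequency

open Filter Topology FourierTransform

variable {V : Type*} [NormedAddCommGroup V] [InnerProductSpace ℝ V] [FiniteDimensional ℝ V]
  [MeasurableSpace V] [BorelSpace V]

/-- The modulation `φ ↦ exp (2πi ⟨·, ω⟩) φ` of Schwartz functions. -/
noncomputable def modulate (ω : V) : 𝓢(V, ℂ) →L[ℂ] 𝓢(V, ℂ) :=
  fourierInvCLM ℂ 𝓢(V, ℂ) ∘L SchwartzMap.compSubConstCLM ℂ ω ∘L fourierCLM ℂ 𝓢(V, ℂ)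

/-- Conjugating translation by the Fourier transform gives multiplication by a character, so growth
and continuity of modulations follow from those of translations without differentiating
exponentials. -/
theorem modulate_apply (ω : V) (φ : 𝓢(V, ℂ)) (t : V) :
    modulate ω φ t = Complex.exp (Complex.I * (2 * Real.pi * inner ℝ t ω : ℝ)) * φ t := by
  have h1 : modulate ω φ = 𝓕⁻ (SchwartzMap.compSubConstCLM ℂ ω (𝓕 φ)) := rfl
  have h2 : φ = 𝓕⁻ (𝓕 φ) := (fourierInv_fourier_eq φ).symm
  conv_rhs => rw [h2]
  rw [h1, SchwartzMap.fourierInv_coe, SchwartzMap.fourierInv_coe, Real.fourierInv_eq',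
    Real.fourierInv_eq', ← integral_add_right_eq_self _ ω, ← integral_const_mul]
  refine integral_congr_ae (Eventually.of_forall fun x => ?_)
  simp only [SchwartzMap.compSubConstCLM_apply, add_sub_cancel_right, smul_eq_mul, ← mul_assoc,
    ← Complex.exp_add, inner_add_left, real_inner_comm ω t]
  congr 2
  push_cast
  ring

/-- The time-frequency shift by `z = (a, ω)`. -/
noncomputable def tfShift (z : V × V) : 𝓢(V, ℂ) →L[ℂ] 𝓢(V, ℂ) :=
  modulate z.2 ∘L SchwartzMap.compSubConstCLM ℂ z.1

theorem tfShift_eq (z : V × V) (φ : 𝓢(V, ℂ)) :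
    tfShift z φ = modulate z.2 (SchwartzMap.compSubConstCLM ℂ z.1 φ) := rfl

theorem tfShift_apply (z : V × V) (φ : 𝓢(V, ℂ)) (t : V) :
    tfShift z φ t =
      Complex.exp (Complex.I * (2 * Real.pi * inner ℝ t z.2 : ℝ)) * φ (t - z.1) := by
  rw [tfShift, ContinuousLinearMap.comp_apply, modulate_apply, SchwartzMap.compSubConstCLM_apply]

theorem exists_seminorm_modulate_le (P : Seminorm ℂ 𝓢(V, ℂ)) (hP : Continuous P) :
    ∃ (N : ℕ) (Q : Seminorm ℂ 𝓢(V, ℂ)), Continuous Q ∧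
      ∀ ω φ, P (modulate ω φ) ≤ (1 + ‖ω‖) ^ N * Q φ := by
  obtain ⟨N, Q, hQ, h⟩ := exists_seminorm_translate_le
    (P.comp (fourierInvCLM ℂ 𝓢(V, ℂ)).toLinearMap) (hP.comp (fourierInvCLM ℂ 𝓢(V, ℂ)).continuous)
  exact ⟨N, Q.comp (fourierCLM ℂ 𝓢(V, ℂ)).toLinearMap, hQ.comp (fourierCLM ℂ 𝓢(V, ℂ)).continuous,
    fun ω φ => h ω (fourierCLM ℂ 𝓢(V, ℂ) φ)⟩

theorem continuous_modulate (φ : 𝓢(V, ℂ)) : Continuous fun ω : V => modulate ω φ :=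
  (fourierInvCLM ℂ 𝓢(V, ℂ)).continuous.comp (continuous_translate (fourierCLM ℂ 𝓢(V, ℂ) φ))

theorem exists_seminorm_tfShift_le (P : Seminorm ℂ 𝓢(V, ℂ)) (hP : Continuous P) :
    ∃ (N : ℕ) (Q : Seminorm ℂ 𝓢(V, ℂ)), Continuous Q ∧
      ∀ z φ, P (tfShift z φ) ≤ (1 + ‖z‖) ^ N * Q φ := by
  obtain ⟨N, Q, hQ, h⟩ := exists_seminorm_modulate_le P hP
  obtain ⟨N', Q', hQ', h'⟩ := exists_seminorm_translate_le Q hQ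
  refine ⟨N + N', Q', hQ', fun z φ => ?_⟩
  have h1 := h z.2 (SchwartzMap.compSubConstCLM ℂ z.1 φ)
  have h2 := h' z.1 φ
  have h3 := apply_nonneg Q' φ
  have h4 : (1 + ‖z.2‖) ^ N ≤ (1 + ‖z‖) ^ N := by gcongr; exact norm_snd_le z
  have h5 : (1 + ‖z.1‖) ^ N' ≤ (1 + ‖z‖) ^ N' := by gcongr; exact norm_fst_le z
  rw [tfShift_eq]
  refine h1.trans ?_
  rw [pow_add, mul_assoc]
  exact mul_le_mul h4 (h2.trans (mul_le_mul_of_nonneg_right h5 h3)) (apply_nonneg _ _)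
    (by positivity)

theorem continuous_tfShift (φ : 𝓢(V, ℂ)) : Continuous fun z : V × V => tfShift z φ := by
  refine continuous_iff_continuousAt.2 fun z => tendsto_schwartz_of_seminorm fun k l => ?_
  have hp : Continuous (SchwartzMap.seminorm ℂ k l : Seminorm ℂ 𝓢(V, ℂ)) :=
    (schwartz_withSeminorms ℂ V ℂ).continuous_seminorm (k, l)
  obtain ⟨N, Q, hQ, h⟩ := exists_seminorm_modulate_le (V := V) _ hp
  set ψ := SchwartzMap.compSubConstCLM ℂ z.1 φ
  have h1 : Continuous fun y : V × V => (1 + ‖y.2‖) ^ N *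
      Q (SchwartzMap.compSubConstCLM ℂ y.1 φ - ψ) +
      SchwartzMap.seminorm ℂ k l (modulate y.2 ψ - modulate z.2 ψ) := by
    refine ((by fun_prop : Continuous fun y : V × V => (1 + ‖y.2‖) ^ N).mul
      (hQ.comp (((continuous_translate φ).comp continuous_fst).sub continuous_const))).add
      (hp.comp (((continuous_modulate ψ).comp continuous_snd).sub continuous_const))
  have h2 := h1.tendsto z
  rw [sub_self, sub_self, map_zero, map_zero, mul_zero, add_zero] at h2
  refine squeeze_zero (fun _ => apply_nonneg _ _) (fun y => ?_) h2
  -- The first summand is small by continuity of translations and the locally uniform bound on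
  -- modulations; the second involves the fixed function `ψ` only.
  have h3 : tfShift y φ - tfShift z φ =
      modulate y.2 (SchwartzMap.compSubConstCLM ℂ y.1 φ - ψ) +
        (modulate y.2 ψ - modulate z.2 ψ) := by
    rw [map_sub, sub_add_sub_cancel, tfShift_eq, tfShift_eq]
  rw [h3]
  exact (map_add_le_add _ _ _).trans
    (add_le_add (h y.2 (SchwartzMap.compSubConstCLM ℂ y.1 φ - ψ)) le_rfl)

end TimeFrequency

/-! ### Weighted supremum bounds -/

section Seminorms

variable {V : Type*} [NormedAddCommGroup V] [NormedSpace ℝ V]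

theorem one_add_norm_pow_mul_norm_le (k : ℕ) (φ : 𝓢(V, ℂ)) (x : V) :
    (1 + ‖x‖) ^ k * ‖φ x‖ ≤
      2 ^ k * ((Finset.Iic (k, 0)).sup (schwartzSeminormFamily ℂ V ℂ) : Seminorm ℂ 𝓢(V, ℂ)) φ := by
  have := SchwartzMap.one_add_le_sup_seminorm_apply (𝕜 := ℂ) (m := (k, 0)) (k := k) (n := 0)
    le_rfl le_rfl φ x
  rwa [norm_iteratedFDeriv_zero] at this

theorem continuous_sup_seminorm (i : ℕ × ℕ) :
    Continuous ((Finset.Iic i).sup (schwartzSeminormFamily ℂ V ℂ) : Seminorm ℂ 𝓢(V, ℂ)) :=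
  Seminorm.continuous_finsetSup fun j _ => (schwartz_withSeminorms ℂ V ℂ).continuous_seminorm j

end Seminorms

/-! ### Decay and covariance of the short-time Fourier transform -/

section ShortTimeFourier

open Filter Topology FourierTransform

variable {V : Type*} [NormedAddCommGroup V] [InnerProductSpace ℝ V] [FiniteDimensional ℝ V]
  [MeasurableSpace V] [BorelSpace V]

/-- The `L²` inner product of Schwartz functions, linear in the first argument. -/
noncomputable def schwartzInner (φ ψ : 𝓢(V, ℂ)) : ℂ := ∫ t, φ t * conj (ψ t)

theorem integrable_mul_conj (φ ψ : 𝓢(V, ℂ)) : Integrable fun t => φ t * conj (ψ t) := by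
  refine (φ.integrable (μ := volume)).mul_bdd (c := SchwartzMap.seminorm ℂ 0 0 ψ)
    (Complex.continuous_conj.comp ψ.continuous).aestronglyMeasurable
    (Eventually.of_forall fun t => ?_)
  rw [RCLike.norm_conj]
  exact SchwartzMap.norm_le_seminorm ℂ ψ t

theorem integrable_norm_mul_norm_sub (φ g : 𝓢(V, ℂ)) (a : V) :
    Integrable fun t => ‖φ t‖ * ‖g (t - a)‖ := by
  refine (φ.integrable (μ := volume)).norm.mul_bdd (c := SchwartzMap.seminorm ℂ 0 0 g)
    (by fun_prop) (Eventually.of_forall fun t => ?_)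
  rw [norm_norm]
  exact SchwartzMap.norm_le_seminorm ℂ g _

/-- Since $1+\|a\|\le(1+\|t\|)(1+\|t-a\|)$, decay in `a` is shared between `φ` and `g`. A further `m
= dim V + 1` powers, taken from `φ`, make the `t`-integral converge. -/
theorem exists_seminorm_integral_norm_mul_norm_sub_le (g : 𝓢(V, ℂ)) (N : ℕ) :
    ∃ P : Seminorm ℂ 𝓢(V, ℂ), Continuous P ∧
      ∀ φ a, (1 + ‖a‖) ^ N * ∫ t, ‖φ t‖ * ‖g (t - a)‖ ≤ P φ := by
  set m := Module.finrank ℝ V + 1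
  have hint : Integrable (fun t : V => (1 + ‖t‖) ^ (-(m : ℝ))) :=
    integrable_one_add_norm (by simp [m])
  set G : ℝ := 2 ^ N * ((Finset.Iic (N, 0)).sup (schwartzSeminormFamily ℂ V ℂ) :
    Seminorm ℂ 𝓢(V, ℂ)) g
  have hG : 0 ≤ G := by positivity
  set I : ℝ := ∫ t : V, (1 + ‖t‖) ^ (-(m : ℝ))
  have hI : 0 ≤ I := integral_nonneg fun t => by positivity
  set Q : Seminorm ℂ 𝓢(V, ℂ) := (Finset.Iic (N + m, 0)).sup (schwartzSeminormFamily ℂ V ℂ)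
  set c : NNReal := Real.toNNReal (2 ^ (N + m) * G * I)
  have hc : (c : ℝ) = 2 ^ (N + m) * G * I := Real.coe_toNNReal _ (by positivity)
  refine ⟨c • Q, (continuous_sup_seminorm _).const_smul c, fun φ a => ?_⟩
  change _ ≤ (c : ℝ) * Q φ
  rw [hc]
  rw [← integral_const_mul]
  have hpt : ∀ t, (1 + ‖a‖) ^ N * (‖φ t‖ * ‖g (t - a)‖) ≤
      (2 ^ (N + m) * Q φ * G) * (1 + ‖t‖) ^ (-(m : ℝ)) := by
    intro t
    have h1 : 1 + ‖a‖ ≤ (1 + ‖t‖) * (1 + ‖t - a‖) := by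
      have h2 : ‖a‖ ≤ ‖t‖ + ‖t - a‖ := by
        have := norm_sub_le t (t - a)
        rwa [sub_sub_cancel] at this
      nlinarith [norm_nonneg t, norm_nonneg (t - a)]
    have h3 := one_add_norm_pow_mul_norm_le (N + m) φ t
    have h4 := one_add_norm_pow_mul_norm_le N g (t - a)
    have h5 : (0 : ℝ) < 1 + ‖t‖ := by positivity
    rw [Real.rpow_neg h5.le, Real.rpow_natCast, ← div_eq_mul_inv, le_div_iff₀ (by positivity)]
    calc (1 + ‖a‖) ^ N * (‖φ t‖ * ‖g (t - a)‖) * (1 + ‖t‖) ^ m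
        ≤ ((1 + ‖t‖) * (1 + ‖t - a‖)) ^ N * (‖φ t‖ * ‖g (t - a)‖) * (1 + ‖t‖) ^ m := by gcongr
      _ = ((1 + ‖t‖) ^ (N + m) * ‖φ t‖) * ((1 + ‖t - a‖) ^ N * ‖g (t - a)‖) := by
          rw [mul_pow, pow_add]; ring
      _ ≤ (2 ^ (N + m) * Q φ) * G := by gcongr
  refine (integral_mono ((integrable_norm_mul_norm_sub φ g a).const_mul _)
    (hint.const_mul _) hpt).trans_eq ?_
  rw [integral_const_mul]
  ring

theorem norm_exp_I_mul_ofReal (r : ℝ) : ‖Complex.exp (Complex.I * (r : ℂ))‖ = 1 := by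
  rw [mul_comm, Complex.norm_exp_ofReal_mul_I]

theorem norm_tfShift (z : V × V) (g : 𝓢(V, ℂ)) (t : V) : ‖tfShift z g t‖ = ‖g (t - z.1)‖ := by
  rw [tfShift_apply, norm_mul, norm_exp_I_mul_ofReal, one_mul]

theorem norm_fourier_translate (a : V) (g : 𝓢(V, ℂ)) (x : V) :
    ‖𝓕 (SchwartzMap.compSubConstCLM ℂ a g) x‖ = ‖𝓕 g x‖ := by
  rw [SchwartzMap.fourier_coe, SchwartzMap.fourier_coe, Real.fourier_eq', Real.fourier_eq',
    ← integral_add_right_eq_self _ a]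
  have : ∀ v : V, Complex.exp (((-2 * Real.pi * inner ℝ (v + a) x : ℝ) : ℂ) * Complex.I) •
      SchwartzMap.compSubConstCLM ℂ a g (v + a) =
      Complex.exp (((-2 * Real.pi * inner ℝ a x : ℝ) : ℂ) * Complex.I) *
        (Complex.exp (((-2 * Real.pi * inner ℝ v x : ℝ) : ℂ) * Complex.I) • g v) := by
    intro v
    rw [SchwartzMap.compSubConstCLM_apply, add_sub_cancel_right, smul_eq_mul, smul_eq_mul,
      ← mul_assoc, ← Complex.exp_add, inner_add_left]
    congr 2
    push_cast
    ring
  simp only [this]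
  rw [integral_const_mul, norm_mul, Complex.norm_exp_ofReal_mul_I, one_mul]

theorem schwartzInner_fourier (φ ψ : 𝓢(V, ℂ)) :
    schwartzInner (𝓕 φ) (𝓕 ψ) = schwartzInner φ ψ := by
  have := SchwartzMap.integral_inner_fourier_fourier ψ φ
  simp only [RCLike.inner_apply] at this
  exact this

theorem norm_schwartzInner_le {φ ψ g : 𝓢(V, ℂ)} {a : V} (h : ∀ t, ‖ψ t‖ = ‖g (t - a)‖) :
    ‖schwartzInner φ ψ‖ ≤ ∫ t, ‖φ t‖ * ‖g (t - a)‖ := by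
  refine (norm_integral_le_integral_norm _).trans_eq ?_
  refine integral_congr_ae (Eventually.of_forall fun t => ?_)
  simp only [norm_mul, RCLike.norm_conj, h]

/-- The overlap of `φ` with a translate of `g` gives decay in position; Parseval turns modulation
into translation and gives decay in frequency. The norm on the product is a maximum, so decay in the
larger coordinate suffices. -/
theorem exists_seminorm_schwartzInner_tfShift_le (g : 𝓢(V, ℂ)) (N : ℕ) :
    ∃ P : Seminorm ℂ 𝓢(V, ℂ), Continuous P ∧
      ∀ φ z, (1 + ‖z‖) ^ N * ‖schwartzInner φ (tfShift z g)‖ ≤ P φ := by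
  obtain ⟨P, hP, h1⟩ := exists_seminorm_integral_norm_mul_norm_sub_le g N
  obtain ⟨Q, hQ, h2⟩ := exists_seminorm_integral_norm_mul_norm_sub_le (𝓕 g) N
  have hF : Continuous (Q.comp (fourierCLM ℂ 𝓢(V, ℂ)).toLinearMap) :=
    hQ.comp (fourierCLM ℂ 𝓢(V, ℂ)).continuous
  refine ⟨P + Q.comp (fourierCLM ℂ 𝓢(V, ℂ)).toLinearMap, hP.add hF, fun φ z => ?_⟩
  change _ ≤ P φ + Q (𝓕 φ)
  have h3 : ‖schwartzInner φ (tfShift z g)‖ ≤ ∫ t, ‖φ t‖ * ‖g (t - z.1)‖ :=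
    norm_schwartzInner_le (norm_tfShift z g)
  have h4 : ‖schwartzInner φ (tfShift z g)‖ ≤ ∫ t, ‖𝓕 φ t‖ * ‖𝓕 g (t - z.2)‖ := by
    rw [← schwartzInner_fourier]
    refine norm_schwartzInner_le fun t => ?_
    have h5 : 𝓕 (tfShift z g) =
        SchwartzMap.compSubConstCLM ℂ z.2 (𝓕 (SchwartzMap.compSubConstCLM ℂ z.1 g)) :=
      fourier_fourierInv_eq _
    rw [h5, SchwartzMap.compSubConstCLM_apply, norm_fourier_translate]
  rcases le_total ‖z.1‖ ‖z.2‖ with h | h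
  · have hz : ‖z‖ = ‖z.2‖ := by rw [Prod.norm_def, max_eq_right h]
    rw [hz]
    have h6 : (1 + ‖z.2‖) ^ N * ‖schwartzInner φ (tfShift z g)‖ ≤ Q (𝓕 φ) :=
      (mul_le_mul_of_nonneg_left h4 (by positivity)).trans (h2 (𝓕 φ) z.2)
    linarith [apply_nonneg P φ]
  · have hz : ‖z‖ = ‖z.1‖ := by rw [Prod.norm_def, max_eq_left h]
    rw [hz]
    have h6 : (1 + ‖z.1‖) ^ N * ‖schwartzInner φ (tfShift z g)‖ ≤ P φ :=
      (mul_le_mul_of_nonneg_left h3 (by positivity)).trans (h1 φ z.1)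
    linarith [apply_nonneg Q (𝓕 φ)]

/-- Substituting `t + z.1` for `t` merges the two shifts into one, up to a phase independent of `t`.
-/
theorem norm_schwartzInner_tfShift_tfShift (z z' : V × V) (g g' : 𝓢(V, ℂ)) :
    ‖schwartzInner (tfShift z g') (tfShift z' g)‖ =
      ‖schwartzInner g' (tfShift (z' - z) g)‖ := by
  unfold schwartzInner
  rw [← integral_add_right_eq_self _ z.1]
  have : ∀ t, tfShift z g' (t + z.1) * conj (tfShift z' g (t + z.1)) =
      Complex.exp (Complex.I * (2 * Real.pi * inner ℝ z.1 (z.2 - z'.2) : ℝ)) *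
        (g' t * conj (tfShift (z' - z) g t)) := by
    intro t
    have h1 : t + z.1 - z'.1 = t - (z' - z).1 := by
      simp only [Prod.fst_sub]; abel
    simp only [tfShift_apply, add_sub_cancel_right, map_mul, ← Complex.exp_conj,
      Complex.conj_I, Complex.conj_ofReal, h1]
    have h2 : ∀ x y u v G H : ℂ, x + y = u + v →
        Complex.exp x * G * (Complex.exp y * H) =
          Complex.exp u * (G * (Complex.exp v * H)) := by
      intro x y u v G H h
      have := congrArg Complex.exp h
      simp only [Complex.exp_add] at this
      linear_combination (G * H) * this
    apply h2
    simp only [Prod.snd_sub, inner_sub_right, inner_add_left]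
    push_cast
    ring
  simp only [this]
  rw [integral_const_mul, norm_mul, norm_exp_I_mul_ofReal, one_mul]

end ShortTimeFourier

/-! ### Inversion of the short-time Fourier transform -/

section Inversion

open Filter Topology FourierTransform

variable {n : ℕ}

theorem conjSchwartz_apply (φ : 𝓢(Space n, ℂ)) (t : Space n) :
    conjSchwartz φ t = conj (φ t) := rfl

theorem continuous_conjSchwartz : Continuous (conjSchwartz (n := n)) :=
  (SchwartzMap.postcompCLM (𝕜 := ℝ) (Complex.conjCLE : ℂ →L[ℝ] ℂ)).continuous

theorem conjSchwartz_conjSchwartz (φ : 𝓢(Space n, ℂ)) : conjSchwartz (conjSchwartz φ) = φ := by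
  ext t
  simp [conjSchwartz_apply]

theorem conjSchwartz_add (φ ψ : 𝓢(Space n, ℂ)) :
    conjSchwartz (φ + ψ) = conjSchwartz φ + conjSchwartz ψ := by
  ext t
  simp [conjSchwartz_apply]

theorem conjSchwartz_smul (c : ℂ) (φ : 𝓢(Space n, ℂ)) :
    conjSchwartz (c • φ) = conj c • conjSchwartz φ := by
  ext t
  simp [conjSchwartz_apply]

theorem ofSchwartz_apply (φ ψ : 𝓢(Space n, ℂ)) : ofSchwartz φ ψ = ∫ t, ψ t * φ t := by
  simp [ofSchwartz]

theorem ofSchwartz_conjSchwartz (φ ψ : 𝓢(Space n, ℂ)) :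
    ofSchwartz φ (conjSchwartz ψ) = schwartzInner φ ψ := by
  rw [ofSchwartz_apply, schwartzInner]
  simp only [conjSchwartz_apply, mul_comm]

theorem continuous_schwartzInner_comp {Z : Type*} [TopologicalSpace Z] (φ : 𝓢(Space n, ℂ))
    {K : Z → 𝓢(Space n, ℂ)} (hK : Continuous K) : Continuous fun z => schwartzInner φ (K z) := by
  simp only [← ofSchwartz_conjSchwartz]
  exact (ofSchwartz φ).continuous.comp (continuous_conjSchwartz.comp hK)

theorem integrable_one_add_norm_prod (n : ℕ) :
    Integrable fun z : Space n × Space n =>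
      (1 + ‖z‖) ^ (-((Module.finrank ℝ (Space n × Space n) + 1 : ℕ) : ℝ)) :=
  haveI : (volume : Measure (Space n × Space n)).IsAddHaarMeasure :=
    Measure.prod.instIsAddHaarMeasure _ _
  integrable_one_add_norm (by simp)

theorem le_mul_one_add_norm_rpow {E : Type*} [NormedAddCommGroup E] {z : E} {N : ℕ} {a b : ℝ}
    (h : (1 + ‖z‖) ^ N * a ≤ b) : a ≤ b * (1 + ‖z‖) ^ (-(N : ℝ)) := by
  have h5 : (0 : ℝ) < 1 + ‖z‖ := by positivity
  rw [Real.rpow_neg h5.le, Real.rpow_natCast, ← div_eq_mul_inv, le_div_iff₀ (by positivity)]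
  linarith

/-- For fixed `a` the transform is the Fourier transform in `ω` of a Schwartz function, so Fourier
inversion holds pointwise. -/
theorem schwartzInner_tfShift_eq_fourier (φ g : 𝓢(Space n, ℂ)) (a ω : Space n) :
    schwartzInner φ (tfShift (a, ω) g) =
      𝓕 (SchwartzMap.pairing (ContinuousLinearMap.mul ℂ ℂ) φ
        (conjSchwartz (SchwartzMap.compSubConstCLM ℂ a g))) ω := by
  rw [SchwartzMap.fourier_coe, Real.fourier_eq', schwartzInner]
  refine integral_congr_ae (Eventually.of_forall fun t => ?_)
  simp only [tfShift_apply, map_mul, ← Complex.exp_conj, Complex.conj_I, Complex.conj_ofReal,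
    SchwartzMap.pairing_apply_apply, ContinuousLinearMap.mul_apply', conjSchwartz_apply,
    SchwartzMap.compSubConstCLM_apply, smul_eq_mul]
  have : -Complex.I * ((2 * Real.pi * inner ℝ t ω : ℝ) : ℂ) =
      ((-2 * Real.pi * inner ℝ t ω : ℝ) : ℂ) * Complex.I := by
    push_cast
    ring
  rw [this]
  ring

theorem integrable_schwartzInner_mul_tfShift (φ g γ : 𝓢(Space n, ℂ)) (t : Space n) :
    Integrable fun z : Space n × Space n => schwartzInner φ (tfShift z g) * tfShift z γ t := by
  obtain ⟨P, -, hP⟩ := exists_seminorm_schwartzInner_tfShift_le g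
    (Module.finrank ℝ (Space n × Space n) + 1)
  refine ((integrable_one_add_norm_prod n).const_mul (P φ * SchwartzMap.seminorm ℂ 0 0 γ)).mono'
    ?_ (Eventually.of_forall fun z => ?_)
  · have h1 : Continuous fun z : Space n × Space n => tfShift z γ t := by
      simp only [tfShift_apply]
      have := γ.continuous
      fun_prop
    exact ((continuous_schwartzInner_comp φ (continuous_tfShift g)).mul h1).aestronglyMeasurable
  · have h1 := le_mul_one_add_norm_rpow (hP φ z)
    have h2 : ‖tfShift z γ t‖ ≤ SchwartzMap.seminorm ℂ 0 0 γ := by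
      rw [norm_tfShift]
      exact SchwartzMap.norm_le_seminorm ℂ γ _
    rw [norm_mul]
    refine (mul_le_mul h1 h2 (norm_nonneg _)
      ((norm_nonneg _).trans h1)).trans_eq ?_
    ring

/-- The inversion formula of the short-time Fourier transform. -/
theorem integral_schwartzInner_mul_tfShift (φ g γ : 𝓢(Space n, ℂ)) (t : Space n) :
    ∫ z : Space n × Space n, schwartzInner φ (tfShift z g) * tfShift z γ t =
      schwartzInner γ g * φ t := by
  have h0 := integrable_schwartzInner_mul_tfShift φ g γ t
  rw [Measure.volume_eq_prod] at h0 ⊢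
  rw [integral_prod _ h0]
  -- Fourier inversion at `t` evaluates the `ω`-integral; the remaining integral over `a` is the
  -- inner product of the windows.
  have h1 : ∀ a : Space n,
      ∫ ω, schwartzInner φ (tfShift (a, ω) g) * tfShift (a, ω) γ t =
        φ t * (γ (t - a) * conj (g (t - a))) := by
    intro a
    set h := SchwartzMap.pairing (ContinuousLinearMap.mul ℂ ℂ) φ
        (conjSchwartz (SchwartzMap.compSubConstCLM ℂ a g))
    have h2 : h t = φ t * conj (g (t - a)) := by
      simp only [h, SchwartzMap.pairing_apply_apply, ContinuousLinearMap.mul_apply',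
        conjSchwartz_apply, SchwartzMap.compSubConstCLM_apply]
    have h3 : h t = ∫ ω, Complex.exp (((2 * Real.pi * inner ℝ ω t : ℝ) : ℂ) * Complex.I) *
        𝓕 h ω := by
      have h4 : h = 𝓕⁻ (𝓕 h) := (fourierInv_fourier_eq h).symm
      conv_lhs => rw [h4]
      rw [SchwartzMap.fourierInv_coe, Real.fourierInv_eq']
      rfl
    calc ∫ ω, schwartzInner φ (tfShift (a, ω) g) * tfShift (a, ω) γ t
        = ∫ ω, γ (t - a) * (Complex.exp (((2 * Real.pi * inner ℝ ω t : ℝ) : ℂ) * Complex.I) *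
            𝓕 h ω) := by
          refine integral_congr_ae (Eventually.of_forall fun ω => ?_)
          simp only [schwartzInner_tfShift_eq_fourier, tfShift_apply, real_inner_comm t ω]
          rw [mul_comm Complex.I]
          ring
      _ = _ := by
          rw [integral_const_mul, ← h3, h2]
          ring
  simp only [h1]
  rw [integral_const_mul, schwartzInner, mul_comm]
  congr 1
  exact integral_sub_left_eq_self (fun s => γ s * conj (g s)) volume t

end Inversion

/-! ### The operators $\Pi_\lambda$ as time-frequency shifts -/

section Representation

open Filter Topology

variable {n : ℕ}

/-- The rotation `rot` as a linear map. -/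
noncomputable def rotLinear (n : ℕ) : Space n →ₗ[ℝ] Space n where
  toFun := rot
  map_add' a b := by
    ext j
    rcases j with j | j <;> simp [rot, add_comm]
  map_smul' c a := by
    ext j
    rcases j with j | j <;> simp [rot]

theorem rotLinear_apply (ξ : Space n) : rotLinear n ξ = rot ξ := rfl

theorem rot_rot (ξ : Space n) : rot (rot ξ) = -ξ := by
  ext j
  rcases j with j | j <;> simp [rot]

theorem dot_eq_inner (t η : Space n) : dot (t : Fin n ⊕ Fin n → ℝ) η = inner ℝ t η := by
  simp [dot, PiLp.inner_apply, Finset.sum_add_distrib, mul_comm]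

theorem symp_eq_inner (t ξ : Space n) : symp (t : Fin n ⊕ Fin n → ℝ) ξ = inner ℝ t (rot ξ) := by
  simp [symp, rot, PiLp.inner_apply, Finset.sum_sub_distrib, mul_comm]
  ring

/-- The linear change of phase space coordinates between `twistedRep` and `tfShift`. -/
noncomputable def phaseMap (n : ℕ) (lam : ℝ) :
    (Space n × Space n) →ₗ[ℝ] (Space n × Space n) :=
  LinearMap.prod
    (LinearMap.fst ℝ _ _ - Real.tanh (lam / 2) • (rotLinear n ∘ₗ LinearMap.snd ℝ _ _))
    ((-(lam / (4 * Real.pi))) •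
      (coth (lam / 2) • LinearMap.snd ℝ _ _ + rotLinear n ∘ₗ LinearMap.fst ℝ _ _))

theorem phaseMap_apply (lam : ℝ) (z : Space n × Space n) :
    phaseMap n lam z = (z.1 - Real.tanh (lam / 2) • rot z.2,
      (-(lam / (4 * Real.pi))) • (coth (lam / 2) • z.2 + rot z.1)) := rfl

/-- On the kernel, `rot ξ = -tanh (λ/2) η`, which leaves
$(\coth\frac\lambda2-\tanh\frac\lambda2)\eta=0$. The factor is
$1/(\sinh\frac\lambda2\cosh\frac\lambda2)$. -/
theorem injective_phaseMap {lam : ℝ} (hlam : lam ≠ 0) :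
    Function.Injective (phaseMap n lam) := by
  rw [← LinearMap.ker_eq_bot, LinearMap.ker_eq_bot']
  rintro ⟨ξ, η⟩ h
  rw [phaseMap_apply, Prod.mk_eq_zero, sub_eq_zero, smul_eq_zero] at h
  obtain ⟨h1, h2⟩ := h
  have h3 : -(lam / (4 * Real.pi)) ≠ 0 := neg_ne_zero.2 (div_ne_zero hlam (by positivity))
  have h4 := h2.resolve_left h3
  simp only at h1 h4
  have h5 : rot ξ = -(Real.tanh (lam / 2) • η) := by
    rw [h1, ← rotLinear_apply, map_smul, rotLinear_apply, rot_rot, smul_neg]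
  rw [h5, ← sub_eq_add_neg, ← sub_smul, smul_eq_zero] at h4
  have hS : Real.sinh (lam / 2) ≠ 0 := by
    rw [Ne, Real.sinh_eq_zero]
    exact div_ne_zero hlam two_ne_zero
  have hC : Real.cosh (lam / 2) ≠ 0 := (Real.cosh_pos _).ne'
  have h6 : coth (lam / 2) - Real.tanh (lam / 2) ≠ 0 := by
    rw [coth, Real.tanh_eq_sinh_div_cosh, div_sub_div _ _ hS hC]
    refine div_ne_zero ?_ (mul_ne_zero hS hC)
    have := Real.cosh_sq_sub_sinh_sq (lam / 2)
    rw [← sq, ← sq, this]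
    exact one_ne_zero
  have h7 : η = 0 := h4.resolve_left h6
  subst h7
  have h8 : rot (0 : Space n) = 0 := map_zero (rotLinear n)
  rw [h8, smul_zero] at h1
  rw [h1]
  rfl

/-- The operators `Π_λ` are, up to unimodular factors, the time-frequency shifts in other
coordinates of phase space. -/
theorem exists_twistedRep_eq_tfShift {lam : ℝ} (hlam : lam ≠ 0) :
    ∃ (L : (Space n × Space n) ≃L[ℝ] (Space n × Space n)) (u : Space n × Space n → ℂ),
      Continuous u ∧ (∀ z, ‖u z‖ = 1) ∧
      ∀ z g, twistedRep lam z.1 z.2 g = u z • tfShift (L z) g := by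
  -- The phase collects the exponents free of `t`: the normalising factor of `twistedRep`, and the
  -- part of the symplectic phase created by evaluating it at the point moved by `tanh (λ/2) • rot
  -- η`. The exponents linear in `t` form the frequency component of `phaseMap`.
  refine ⟨(LinearEquiv.ofInjectiveEndo (phaseMap n lam)
    (injective_phaseMap hlam)).toContinuousLinearEquiv,
    fun z => Complex.exp (Complex.I * ((lam / 2 * coth lam * inner ℝ z.1 z.2 -
      lam / 2 * Real.tanh (lam / 2) * inner ℝ (rot z.2) (rot z.1) : ℝ) : ℂ)),
    ?_, fun z => norm_exp_I_mul_ofReal _, fun z g => ?_⟩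
  · have : Continuous (rot (n := n)) := (rotLinear n).continuous_of_finiteDimensional
    fun_prop
  · ext t
    have h1 : (LinearEquiv.ofInjectiveEndo (phaseMap n lam)
      (injective_phaseMap hlam)).toContinuousLinearEquiv z = phaseMap n lam z := rfl
    rw [h1, phaseMap_apply, smul_apply, twistedRep_apply, tfShift_apply, smul_eq_mul]
    have h2 : t + Real.tanh (lam / 2) • rot z.2 - z.1 =
      t - (z.1 - Real.tanh (lam / 2) • rot z.2) := by abel
    rw [h2]
    simp only [← mul_assoc, ← Complex.exp_add]
    congr 2
    simp only [dot_eq_inner, symp_eq_inner, inner_add_left, inner_add_right, inner_smul_left,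
      inner_smul_right]
    have hpi : (Real.pi : ℂ) ≠ 0 := by exact_mod_cast Real.pi_ne_zero
    simp only [conj_trivial]
    push_cast
    field_simp
    ring

theorem schwartzInner_smul_right {V : Type*} [NormedAddCommGroup V] [InnerProductSpace ℝ V]
    [FiniteDimensional ℝ V] [MeasurableSpace V] [BorelSpace V] (c : ℂ) (φ ψ : 𝓢(V, ℂ)) :
    schwartzInner φ (c • ψ) = conj c * schwartzInner φ ψ := by
  unfold schwartzInner
  rw [← integral_const_mul]
  refine integral_congr_ae (Eventually.of_forall fun t => ?_)
  simp only [smul_apply, smul_eq_mul, map_mul]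
  ring

theorem schwartzInner_smul_left {V : Type*} [NormedAddCommGroup V] [InnerProductSpace ℝ V]
    [FiniteDimensional ℝ V] [MeasurableSpace V] [BorelSpace V] (c : ℂ) (φ ψ : 𝓢(V, ℂ)) :
    schwartzInner (c • φ) ψ = c * schwartzInner φ ψ := by
  unfold schwartzInner
  rw [← integral_const_mul]
  refine integral_congr_ae (Eventually.of_forall fun t => ?_)
  simp only [smul_apply, smul_eq_mul]
  ring

theorem exists_one_add_norm_le (L : (Space n × Space n) ≃L[ℝ] (Space n × Space n)) :
    ∃ c : ℝ, 0 ≤ c ∧ (∀ z, 1 + ‖L z‖ ≤ c * (1 + ‖z‖)) ∧ ∀ z, 1 + ‖z‖ ≤ c * (1 + ‖L z‖) := by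
  refine ⟨1 + ‖(L : (Space n × Space n) →L[ℝ] (Space n × Space n))‖ +
    ‖(L.symm : (Space n × Space n) →L[ℝ] (Space n × Space n))‖, by positivity, fun z => ?_,
    fun z => ?_⟩
  · have h1 := (L : (Space n × Space n) →L[ℝ] (Space n × Space n)).le_opNorm z
    rw [ContinuousLinearEquiv.coe_coe] at h1
    nlinarith [norm_nonneg z, norm_nonneg (L : (Space n × Space n) →L[ℝ] (Space n × Space n)),
      norm_nonneg (L.symm : (Space n × Space n) →L[ℝ] (Space n × Space n))]
  · have h1 := (L.symm : (Space n × Space n) →L[ℝ] (Space n × Space n)).le_opNorm (L z)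
    rw [ContinuousLinearEquiv.coe_coe, ContinuousLinearEquiv.symm_apply_apply] at h1
    nlinarith [norm_nonneg (L z), norm_nonneg (L : (Space n × Space n) →L[ℝ] (Space n × Space n)),
      norm_nonneg (L.symm : (Space n × Space n) →L[ℝ] (Space n × Space n))]

theorem continuous_twistedRep {lam : ℝ} (hlam : lam ≠ 0) (g : 𝓢(Space n, ℂ)) :
    Continuous fun z : Space n × Space n => twistedRep lam z.1 z.2 g := by
  obtain ⟨L, u, hu, -, h⟩ := exists_twistedRep_eq_tfShift (n := n) hlam
  simp only [h]
  exact hu.smul ((continuous_tfShift g).comp L.continuous)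

theorem exists_seminorm_twistedRep_le {lam : ℝ} (hlam : lam ≠ 0)
    (P : Seminorm ℂ 𝓢(Space n, ℂ)) (hP : Continuous P) :
    ∃ (N : ℕ) (Q : Seminorm ℂ 𝓢(Space n, ℂ)), Continuous Q ∧
      ∀ (z : Space n × Space n) φ, P (twistedRep lam z.1 z.2 φ) ≤ (1 + ‖z‖) ^ N * Q φ := by
  obtain ⟨L, u, -, hu, h⟩ := exists_twistedRep_eq_tfShift (n := n) hlam
  obtain ⟨N, Q, hQ, h1⟩ := exists_seminorm_tfShift_le P hP
  obtain ⟨c, hc, hc1, -⟩ := exists_one_add_norm_le L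
  refine ⟨N, (Real.toNNReal (c ^ N)) • Q, hQ.const_smul (Real.toNNReal (c ^ N)), fun z φ => ?_⟩
  change _ ≤ (1 + ‖z‖) ^ N * ((Real.toNNReal (c ^ N) : ℝ) * Q φ)
  rw [Real.coe_toNNReal _ (by positivity), h, map_smul_eq_mul, hu, one_mul]
  refine (h1 _ _).trans ?_
  rw [← mul_assoc, ← mul_pow, mul_comm (1 + ‖z‖)]
  gcongr
  exact hc1 z

theorem exists_seminorm_schwartzInner_twistedRep_le {lam : ℝ} (hlam : lam ≠ 0)
    (g : 𝓢(Space n, ℂ)) (N : ℕ) :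
    ∃ P : Seminorm ℂ 𝓢(Space n, ℂ), Continuous P ∧ ∀ φ (z : Space n × Space n),
      (1 + ‖z‖) ^ N * ‖schwartzInner φ (twistedRep lam z.1 z.2 g)‖ ≤ P φ := by
  obtain ⟨L, u, -, hu, h⟩ := exists_twistedRep_eq_tfShift (n := n) hlam
  obtain ⟨Q, hQ, h1⟩ := exists_seminorm_schwartzInner_tfShift_le g N
  obtain ⟨c, hc, -, hc1⟩ := exists_one_add_norm_le L
  refine ⟨(Real.toNNReal (c ^ N)) • Q, hQ.const_smul (Real.toNNReal (c ^ N)), fun φ z => ?_⟩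
  change _ ≤ (Real.toNNReal (c ^ N) : ℝ) * Q φ
  rw [Real.coe_toNNReal _ (by positivity), h, schwartzInner_smul_right, norm_mul,
    RCLike.norm_conj, hu, one_mul]
  calc (1 + ‖z‖) ^ N * ‖schwartzInner φ (tfShift (L z) g)‖
      ≤ (c * (1 + ‖L z‖)) ^ N * ‖schwartzInner φ (tfShift (L z) g)‖ := by gcongr; exact hc1 z
    _ = c ^ N * ((1 + ‖L z‖) ^ N * ‖schwartzInner φ (tfShift (L z) g)‖) := by
        rw [mul_pow, mul_assoc]
    _ ≤ _ := by gcongr; exact h1 φ (L z)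

theorem norm_schwartzInner_twistedRep_twistedRep {lam : ℝ} (hlam : lam ≠ 0)
    (z z' : Space n × Space n) (g g' : 𝓢(Space n, ℂ)) :
    ‖schwartzInner (twistedRep lam z.1 z.2 g') (twistedRep lam z'.1 z'.2 g)‖ =
      ‖schwartzInner g' (twistedRep lam (z' - z).1 (z' - z).2 g)‖ := by
  obtain ⟨L, u, -, hu, h⟩ := exists_twistedRep_eq_tfShift (n := n) hlam
  simp only [h, schwartzInner_smul_right, schwartzInner_smul_left, norm_mul, RCLike.norm_conj, hu,
    one_mul, norm_schwartzInner_tfShift_tfShift, map_sub]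

/-- The inversion formula for the matrix coefficients of `Π_λ`. -/
theorem exists_integral_schwartzInner_mul_twistedRep {lam : ℝ} (hlam : lam ≠ 0) :
    ∃ κ : ℝ, 0 < κ ∧ ∀ (φ g γ : 𝓢(Space n, ℂ)) (t : Space n),
      ∫ z : Space n × Space n,
        schwartzInner φ (twistedRep lam z.1 z.2 g) * twistedRep lam z.1 z.2 γ t =
      κ * (schwartzInner γ g * φ t) := by
  obtain ⟨L, u, -, hu, h⟩ := exists_twistedRep_eq_tfShift (n := n) hlam
  have : (volume : Measure (Space n × Space n)).IsAddHaarMeasure :=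
    Measure.prod.instIsAddHaarMeasure _ _
  have hdet : LinearMap.det (L.toLinearEquiv : (Space n × Space n) →ₗ[ℝ] (Space n × Space n)) ≠ 0 :=
    L.toLinearEquiv.isUnit_det'.ne_zero
  -- `κ` is the Jacobian of the change of phase space coordinates. The unimodular factors cancel,
  -- one entering conjugated and one not.
  refine ⟨|(LinearMap.det (L.toLinearEquiv : (Space n × Space n) →ₗ[ℝ] _))⁻¹|,
    abs_pos.2 (inv_ne_zero hdet), fun φ g γ t => ?_⟩
  rw [← integral_schwartzInner_mul_tfShift]
  have h1 : ∀ z : Space n × Space n,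
      schwartzInner φ (twistedRep lam z.1 z.2 g) * twistedRep lam z.1 z.2 γ t =
        schwartzInner φ (tfShift (L z) g) * tfShift (L z) γ t := by
    intro z
    have h2 : conj (u z) * u z = 1 := by
      rw [mul_comm, Complex.mul_conj, Complex.normSq_eq_norm_sq, hu]
      norm_num
    rw [h, h, schwartzInner_smul_right, smul_apply, smul_eq_mul]
    linear_combination (schwartzInner φ (tfShift (L z) g) * tfShift (L z) γ t) * h2
  simp only [h1]
  have h3 := integral_map_equiv (μ := (volume : Measure (Space n × Space n)))
    L.toHomeomorph.toMeasurableEquiv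
    (fun z => schwartzInner φ (tfShift z g) * tfShift z γ t)
  have h4 : Measure.map L.toHomeomorph.toMeasurableEquiv
      (volume : Measure (Space n × Space n)) =
      ENNReal.ofReal |(LinearMap.det (L.toLinearEquiv : (Space n × Space n) →ₗ[ℝ] _))⁻¹| •
        volume := Measure.map_linearMap_addHaar_eq_smul_addHaar _ hdet
  rw [h4, integral_smul_measure, ENNReal.toReal_ofReal (abs_nonneg _)] at h3
  rw [← Complex.real_smul]
  exact h3.symm

end Representation

/-! ### Orthogonality, change of window and synthesis -/

section MatrixCoefficients

open Filter Topology

variable {n : ℕ}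

/-- The conjugate linear functional `φ ↦ ⟨h, φ⟩`, conjugated. -/
noncomputable def conjFunctional (h : 𝓢'(Space n, ℂ)) : 𝓢(Space n, ℂ) →L[ℂ] ℂ where
  toFun φ := conj (h (conjSchwartz φ))
  map_add' φ ψ := by rw [conjSchwartz_add, map_add, map_add]
  map_smul' c φ := by
    rw [conjSchwartz_smul, map_smul, smul_eq_mul, map_mul, Complex.conj_conj, smul_eq_mul,
      RingHom.id_apply]
  cont := Complex.continuous_conj.comp (h.continuous.comp continuous_conjSchwartz)

theorem conjFunctional_apply (h : 𝓢'(Space n, ℂ)) (φ : 𝓢(Space n, ℂ)) :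
    conjFunctional h φ = conj (h (conjSchwartz φ)) := rfl

theorem conjFunctional_twistedRep (lam : ℝ) (g : 𝓢(Space n, ℂ)) (h : 𝓢'(Space n, ℂ))
    (z : Space n × Space n) :
    conjFunctional h (twistedRep lam z.1 z.2 g) = conj (matrixCoeff lam g h z) := rfl

theorem matrixCoeff_ofSchwartz (lam : ℝ) (g φ : 𝓢(Space n, ℂ)) (z : Space n × Space n) :
    matrixCoeff lam g (ofSchwartz φ) z = schwartzInner φ (twistedRep lam z.1 z.2 g) :=
  ofSchwartz_conjSchwartz _ _

theorem matrixCoeff_add (lam : ℝ) (g : 𝓢(Space n, ℂ)) (f h : 𝓢'(Space n, ℂ))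
    (z : Space n × Space n) :
    matrixCoeff lam g (f + h) z = matrixCoeff lam g f z + matrixCoeff lam g h z := rfl

theorem matrixCoeff_sub (lam : ℝ) (g : 𝓢(Space n, ℂ)) (f h : 𝓢'(Space n, ℂ))
    (z : Space n × Space n) :
    matrixCoeff lam g (f - h) z = matrixCoeff lam g f z - matrixCoeff lam g h z := rfl

theorem matrixCoeff_smul (lam : ℝ) (g : 𝓢(Space n, ℂ)) (c : ℂ) (f : 𝓢'(Space n, ℂ))
    (z : Space n × Space n) :
    matrixCoeff lam g (c • f) z = c * matrixCoeff lam g f z := rfl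

theorem schwartzInner_conj (φ ψ : 𝓢(Space n, ℂ)) :
    conj (schwartzInner φ ψ) = schwartzInner ψ φ := by
  unfold schwartzInner
  rw [← integral_conj]
  refine integral_congr_ae (Eventually.of_forall fun t => ?_)
  simp only [map_mul, Complex.conj_conj, mul_comm]

theorem exists_pos_schwartzInner_self {γ : 𝓢(Space n, ℂ)} (hγ : γ ≠ 0) :
    ∃ r : ℝ, 0 < r ∧ schwartzInner γ γ = r := by
  have h1 : schwartzInner γ γ = ((∫ t, ‖γ t‖ ^ 2 : ℝ) : ℂ) := by
    rw [schwartzInner, ← integral_complex_ofReal]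
    refine integral_congr_ae (Eventually.of_forall fun t => ?_)
    simp only [Complex.mul_conj, Complex.normSq_eq_norm_sq]
  have h2 : Integrable fun t => ‖γ t‖ ^ 2 := by
    refine (integrable_mul_conj γ γ).norm.congr (Eventually.of_forall fun t => ?_)
    simp only [norm_mul, RCLike.norm_conj, sq]
  refine ⟨_, lt_of_le_of_ne (integral_nonneg fun t => by positivity) fun h3 => hγ ?_, h1⟩
  rw [eq_comm, integral_eq_zero_iff_of_nonneg (fun t => by positivity) h2] at h3
  have h4 : (fun t => ‖γ t‖ ^ 2) = fun _ => 0 := by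
    have hc := γ.continuous
    exact (Continuous.ae_eq_iff_eq volume (by fun_prop) continuous_const).1 h3
  ext t
  have := congrFun h4 t
  simpa using this

theorem continuous_matrixCoeff {lam : ℝ} (hlam : lam ≠ 0) (g : 𝓢(Space n, ℂ))
    (f : 𝓢'(Space n, ℂ)) : Continuous (matrixCoeff lam g f) :=
  f.continuous.comp (continuous_conjSchwartz.comp (continuous_twistedRep hlam g))

/-- The Schwartz-valued integral of `F z` times `Π(z) γ` exists because rapid decay of `F` beats the
polynomial growth in `z` of each seminorm of `Π(z) γ`. -/
theorem exists_synthesis {lam : ℝ} (hlam : lam ≠ 0) (γ : 𝓢(Space n, ℂ))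
    {F : Space n × Space n → ℂ} (hF : AEStronglyMeasurable F volume)
    (hd : ∀ N : ℕ, Integrable fun z => (1 + ‖z‖) ^ N * ‖F z‖) :
    ∃ ψ : 𝓢(Space n, ℂ), ∀ f : 𝓢(Space n, ℂ) →L[ℂ] ℂ,
      Integrable (fun z : Space n × Space n => F z * f (twistedRep lam z.1 z.2 γ)) ∧
      f ψ = ∫ z : Space n × Space n, F z * f (twistedRep lam z.1 z.2 γ) := by
  have hK : SchwartzIntegrable
      (fun z : Space n × Space n => F z • twistedRep lam z.1 z.2 γ) volume := by
    refine SchwartzIntegrable.of_continuous (continuous_twistedRep hlam γ) hF fun k l => ?_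
    obtain ⟨N, Q, -, h⟩ := exists_seminorm_twistedRep_le hlam _
      ((schwartz_withSeminorms ℂ (Space n) ℂ).continuous_seminorm (k, l))
    refine ⟨_, (hd N).mul_const (Q γ), fun z => ?_⟩
    have := mul_le_mul_of_nonneg_left (h z γ) (norm_nonneg (F z))
    refine this.trans_eq ?_
    ring
  obtain ⟨ψ, hψ⟩ := hK.exists_integral
  refine ⟨ψ, fun f => ?_⟩
  simpa only [map_smul, smul_eq_mul] using hψ f

/-- Evaluation at a point as a continuous linear functional on Schwartz space. -/
noncomputable def evalSchwartz (t : Space n) : 𝓢(Space n, ℂ) →L[ℂ] ℂ :=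
  BoundedContinuousFunction.evalCLM ℂ t ∘L SchwartzMap.toBoundedContinuousFunctionCLM ℂ (Space n) ℂ

theorem evalSchwartz_apply (t : Space n) (φ : 𝓢(Space n, ℂ)) : evalSchwartz t φ = φ t := rfl

theorem integrable_one_add_norm_pow_mul_matrixCoeff {lam : ℝ} (hlam : lam ≠ 0)
    (g φ : 𝓢(Space n, ℂ)) (N : ℕ) :
    Integrable fun z => (1 + ‖z‖) ^ N * ‖matrixCoeff lam g (ofSchwartz φ) z‖ := by
  set m := Module.finrank ℝ (Space n × Space n) + 1
  obtain ⟨P, -, hP⟩ := exists_seminorm_schwartzInner_twistedRep_le hlam g (m + N)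
  refine ((integrable_one_add_norm_prod n).const_mul (P φ)).mono' ?_
    (Eventually.of_forall fun z => ?_)
  · have := continuous_matrixCoeff hlam g (ofSchwartz φ)
    exact Continuous.aestronglyMeasurable (by fun_prop)
  · rw [Real.norm_of_nonneg (by positivity), matrixCoeff_ofSchwartz]
    refine le_mul_one_add_norm_rpow ?_
    rw [← mul_assoc, ← pow_add]
    exact hP φ z

/-- The orthogonality relations of the matrix coefficients of `Π_λ`. -/
theorem exists_integral_matrixCoeff_mul_conj {lam : ℝ} (hlam : lam ≠ 0) :
    ∃ κ : ℝ, 0 < κ ∧ ∀ (φ g γ : 𝓢(Space n, ℂ)) (h : 𝓢'(Space n, ℂ)),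
      Integrable (fun z => matrixCoeff lam g (ofSchwartz φ) z * conj (matrixCoeff lam γ h z)) ∧
      ∫ z, matrixCoeff lam g (ofSchwartz φ) z * conj (matrixCoeff lam γ h z) =
        κ * schwartzInner γ g * conj (h (conjSchwartz φ)) := by
  obtain ⟨κ, hκ, hinv⟩ := exists_integral_schwartzInner_mul_twistedRep (n := n) hlam
  refine ⟨κ, hκ, fun φ g γ h => ?_⟩
  obtain ⟨ψ, hψ⟩ := exists_synthesis hlam γ
    (continuous_matrixCoeff hlam g (ofSchwartz φ)).aestronglyMeasurable
    (integrable_one_add_norm_pow_mul_matrixCoeff hlam g φ)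
  -- Point evaluations and the inversion formula identify the synthesized function. Applying the
  -- functional of `h` to the same integral extends orthogonality to distributions.
  have h1 : ψ = (κ * schwartzInner γ g) • φ := by
    ext t
    have h2 := (hψ (evalSchwartz t)).2
    simp only [evalSchwartz_apply, matrixCoeff_ofSchwartz] at h2
    rw [h2, hinv, smul_apply, smul_eq_mul, mul_assoc]
  obtain ⟨h3, h4⟩ := hψ (conjFunctional h)
  simp only [conjFunctional_twistedRep] at h3 h4
  refine ⟨h3, ?_⟩
  rw [← h4, h1, map_smul, smul_eq_mul, conjFunctional_apply]

/-- A weight with integrable decay. -/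
noncomputable def decayWeight (n : ℕ) (x : Space n) : ℝ≥0∞ :=
  ENNReal.ofReal ((1 + ‖x‖) ^ (-((Module.finrank ℝ (Space n) + 1 : ℕ) : ℝ)))

theorem measurable_decayWeight : Measurable (decayWeight n) := by
  unfold decayWeight
  fun_prop

/-- The weight is bounded by one and integrable, so the crude interpolation covers all exponents. -/
theorem eLpNorm_decayWeight_lt_top {p : ℝ≥0∞} (hp : 1 ≤ p) :
    eLpNorm (decayWeight n) p volume < ∞ := by
  refine (eLpNorm_le_top_add one_ne_zero hp).trans_lt (ENNReal.add_lt_top.2 ⟨?_, ?_⟩)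
  · refine (eLpNorm_top_le_iff.2 (Eventually.of_forall fun x => ?_)).trans_lt ENNReal.one_lt_top
    refine ENNReal.ofReal_le_one.2 (Real.rpow_le_one_of_one_le_of_nonpos ?_
      (neg_nonpos.2 (Nat.cast_nonneg _)))
    linarith [norm_nonneg x]
  · rw [eLpNorm_ennreal_one]
    have h1 : Integrable (fun x : Space n =>
        (1 + ‖x‖) ^ (-((Module.finrank ℝ (Space n) + 1 : ℕ) : ℝ))) :=
      integrable_one_add_norm (by simp)
    have h2 := h1.hasFiniteIntegral
    rw [hasFiniteIntegral_iff_ofReal (Eventually.of_forall fun x => by positivity)] at h2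
    exact h2

/-- Rapid decay of the matrix coefficients, with a product weight. -/
theorem exists_seminorm_enorm_schwartzInner_le {lam : ℝ} (hlam : lam ≠ 0)
    (g : 𝓢(Space n, ℂ)) :
    ∃ P : Seminorm ℂ 𝓢(Space n, ℂ), Continuous P ∧ ∀ φ (z : Space n × Space n),
      ‖schwartzInner φ (twistedRep lam z.1 z.2 g)‖ₑ ≤
        ENNReal.ofReal (P φ) * (decayWeight n z.1 * decayWeight n z.2) := by
  set m := Module.finrank ℝ (Space n) + 1
  -- `m` powers of the weight for each coordinate produce the tensor product that Young's inequality
  -- for mixed norms requires.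
  obtain ⟨P, hc, hP⟩ := exists_seminorm_schwartzInner_twistedRep_le hlam g (m + m)
  refine ⟨P, hc, fun φ z => ?_⟩
  have h1 : (1 + ‖z.1‖) ^ m * ((1 + ‖z.2‖) ^ m *
      ‖schwartzInner φ (twistedRep lam z.1 z.2 g)‖) ≤ P φ := by
    refine le_trans ?_ (hP φ z)
    rw [pow_add (1 + ‖z‖) m m, mul_assoc]
    have h3 := norm_fst_le z
    have h4 := norm_snd_le z
    clear_value m
    gcongr
  have h2 := le_mul_one_add_norm_rpow h1
  rw [mul_comm] at h2
  have h3 : ‖schwartzInner φ (twistedRep lam z.1 z.2 g)‖ ≤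
      P φ * ((1 + ‖z.1‖) ^ (-(m : ℝ)) * (1 + ‖z.2‖) ^ (-(m : ℝ))) := by
    rw [← mul_assoc]
    exact le_mul_one_add_norm_rpow (by linarith)
  rw [← ofReal_norm, decayWeight, decayWeight,
    ← ENNReal.ofReal_mul (by positivity), ← ENNReal.ofReal_mul (apply_nonneg P φ)]
  exact ENNReal.ofReal_le_ofReal h3

theorem mixedNorm_eq (p q : ℝ≥0∞) (F : Space n × Space n → ℂ) :
    mixedNorm p q F = mixedENorm volume volume p q fun z => ‖F z‖ₑ := by
  unfold mixedNorm mixedENorm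
  simp only [eLpNorm_enorm]

/-- Young's inequality with a kernel lying in every $L^p$. The constant depends only on `p`, `q` and
`n`, while the target exponents may be larger: this is the source of the inclusions (iii). -/
theorem exists_mixedNorm_le_of_enorm_le {p q : ℝ≥0∞} (hp : 1 ≤ p) (hq : 1 ≤ q) :
    ∃ C : ℝ≥0∞, C < ∞ ∧ ∀ (r s : ℝ≥0∞), p ≤ r → q ≤ s → ∀ (c : ℝ≥0∞)
      (F G : Space n × Space n → ℂ), Measurable F →
      (∀ z, ‖G z‖ₑ ≤ c * ∫⁻ z', ‖F z'‖ₑ *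
        (decayWeight n (z'.1 - z.1) * decayWeight n (z'.2 - z.2))) →
      mixedNorm r s G ≤ C * c * mixedNorm p q F := by
  have h1 := ENNReal.HolderConjugate.conjExponent hp
  have h2 := ENNReal.HolderConjugate.conjExponent hq
  have h1' := h1.symm
  have h2' := h2.symm
  set w := decayWeight n
  have hw : Measurable w := measurable_decayWeight
  refine ⟨((eLpNorm w q.conjExponent volume + eLpNorm w 1 volume) *
    (eLpNorm w p.conjExponent volume + eLpNorm w 1 volume)), ?_, fun r s hr hs c F G hF h => ?_⟩
  · refine ENNReal.mul_lt_top (ENNReal.add_lt_top.2 ⟨?_, ?_⟩) (ENNReal.add_lt_top.2 ⟨?_, ?_⟩)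
    · exact eLpNorm_decayWeight_lt_top (one_le_of_holderConjugate _ q)
    · exact eLpNorm_decayWeight_lt_top le_rfl
    · exact eLpNorm_decayWeight_lt_top (one_le_of_holderConjugate _ p)
    · exact eLpNorm_decayWeight_lt_top le_rfl
  · rw [mixedNorm_eq, mixedNorm_eq]
    refine (mixedENorm_mono _ _ h).trans ?_
    have h3 : Measurable fun z : Space n × Space n => ∫⁻ z', ‖F z'‖ₑ *
        (w (z'.1 - z.1) * w (z'.2 - z.2)) := by
      refine Measurable.lintegral_prod_right'
        (f := fun x : (Space n × Space n) × (Space n × Space n) => ‖F x.2‖ₑ *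
        (w (x.2.1 - x.1.1) * w (x.2.2 - x.1.2))) ?_
      fun_prop
    refine (mixedENorm_const_mul h3 _ _ _).trans ?_
    rw [mul_comm _ c, mul_assoc]
    gcongr
    exact mixedENorm_correlation_le hF.enorm hw hr hs

/-- Covariance makes the size of the reproducing kernel depend on `z' - z` alone, and rapid decay
bounds it by the product weight. -/
theorem norm_schwartzInner_twistedRep_sub {lam : ℝ} (hlam : lam ≠ 0) (g γ : 𝓢(Space n, ℂ)) :
    ∃ c : ℝ≥0∞, c < ∞ ∧ ∀ z z' : Space n × Space n,
      ‖schwartzInner (twistedRep lam z.1 z.2 g) (twistedRep lam z'.1 z'.2 γ)‖ₑ ≤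
        c * (decayWeight n (z'.1 - z.1) * decayWeight n (z'.2 - z.2)) := by
  obtain ⟨P, -, hP⟩ := exists_seminorm_enorm_schwartzInner_le hlam γ
  refine ⟨ENNReal.ofReal (P g), ENNReal.ofReal_lt_top, fun z z' => ?_⟩
  have h1 := norm_schwartzInner_twistedRep_twistedRep hlam z z' γ g
  rw [← ofReal_norm, h1, ofReal_norm]
  exact hP g (z' - z)

/-- Change of window and embedding of mixed norm spaces of matrix coefficients. -/
theorem exists_modulationNorm_le {lam : ℝ} (hlam : lam ≠ 0) {γ : 𝓢(Space n, ℂ)} (hγ : γ ≠ 0)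
    (g : 𝓢(Space n, ℂ)) {p q r s : ℝ≥0∞} (hp : 1 ≤ p) (hq : 1 ≤ q) (hpr : p ≤ r) (hqs : q ≤ s) :
    ∃ C : ℝ≥0∞, C < ∞ ∧ ∀ f, modulationNorm lam r s g f ≤ C * modulationNorm lam p q γ f := by
  obtain ⟨κ, hκ, h1⟩ := exists_integral_matrixCoeff_mul_conj (n := n) hlam
  obtain ⟨ρ, hρ, h2⟩ := exists_pos_schwartzInner_self hγ
  obtain ⟨c, hc, h3⟩ := norm_schwartzInner_twistedRep_sub hlam g γ
  obtain ⟨C, hC, h4⟩ := exists_mixedNorm_le_of_enorm_le (n := n) hp hq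
  have hκρ : 0 < κ * ρ := mul_pos hκ hρ
  have hk0 : ENNReal.ofReal (κ * ρ) ≠ 0 := (ENNReal.ofReal_pos.2 hκρ).ne'
  refine ⟨C * ((ENNReal.ofReal (κ * ρ))⁻¹ * c), ?_, fun f => h4 r s hpr hqs _ _ _
    (continuous_matrixCoeff hlam γ f).measurable fun z => ?_⟩
  · exact ENNReal.mul_lt_top hC (ENNReal.mul_lt_top (ENNReal.inv_lt_top.2
      (ENNReal.ofReal_pos.2 hκρ)) hc)
  -- Orthogonality with $\varphi=\Pi_\lambda(z)g$ and both windows `γ` expresses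
  -- $\kappa\rho\,\overline{V_gf(z)}$ as an integral of $\overline{V_\gamma f}$ against the kernel
  -- just bounded.
  have h5 := (h1 (twistedRep lam z.1 z.2 g) γ γ f).2
  have h6 : ENNReal.ofReal (κ * ρ) * ‖matrixCoeff lam g f z‖ₑ ≤
      c * ∫⁻ z', ‖matrixCoeff lam γ f z'‖ₑ *
        (decayWeight n (z'.1 - z.1) * decayWeight n (z'.2 - z.2)) := by
    have h7 : ENNReal.ofReal (κ * ρ) * ‖matrixCoeff lam g f z‖ₑ =
        ‖(κ : ℂ) * schwartzInner γ γ *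
          conj (f (conjSchwartz (twistedRep lam z.1 z.2 g)))‖ₑ := by
      rw [h2, enorm_mul, ← Complex.ofReal_mul, ← ofReal_norm ((κ * ρ : ℝ) : ℂ),
        Complex.norm_real, Real.norm_of_nonneg hκρ.le, ← ofReal_norm (conj _),
        RCLike.norm_conj, ofReal_norm]
      rfl
    rw [h7, ← h5, ← lintegral_const_mul' _ _ hc.ne]
    refine (enorm_integral_le_lintegral_enorm _).trans (lintegral_mono fun z' => ?_)
    rw [matrixCoeff_ofSchwartz, enorm_mul, ← ofReal_norm (conj _), RCLike.norm_conj,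
      ofReal_norm, mul_comm]
    calc _ ≤ ‖matrixCoeff lam γ f z'‖ₑ *
          (c * (decayWeight n (z'.1 - z.1) * decayWeight n (z'.2 - z.2))) := by
          gcongr
          exact h3 z z'
      _ = _ := by ring
  rw [mul_assoc]
  calc ‖matrixCoeff lam g f z‖ₑ
      = (ENNReal.ofReal (κ * ρ))⁻¹ *
        (ENNReal.ofReal (κ * ρ) * ‖matrixCoeff lam g f z‖ₑ) := by
        rw [← mul_assoc, ENNReal.inv_mul_cancel hk0 ENNReal.ofReal_ne_top, one_mul]
    _ ≤ _ := by gcongr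

/-- The modulation norms of Schwartz functions are bounded by continuous seminorms. -/
theorem exists_modulationNorm_ofSchwartz_le {lam : ℝ} (hlam : lam ≠ 0) (g : 𝓢(Space n, ℂ))
    {p q : ℝ≥0∞} (hp : 1 ≤ p) (hq : 1 ≤ q) :
    ∃ P : Seminorm ℂ 𝓢(Space n, ℂ), Continuous P ∧
      ∀ φ, modulationNorm lam p q g (ofSchwartz φ) ≤ ENNReal.ofReal (P φ) := by
  obtain ⟨P, hP, h⟩ := exists_seminorm_enorm_schwartzInner_le hlam g
  set w := decayWeight n
  have hw : Measurable w := measurable_decayWeight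
  have hp' : eLpNorm w p volume < ∞ := eLpNorm_decayWeight_lt_top hp
  have hq' : eLpNorm w q volume < ∞ := eLpNorm_decayWeight_lt_top hq
  -- The mixed norm of a tensor product is at most the product of the norms of its factors.
  set c : NNReal := (eLpNorm w p volume * eLpNorm w q volume).toNNReal
  have hc : (c : ℝ≥0∞) = eLpNorm w p volume * eLpNorm w q volume :=
    ENNReal.coe_toNNReal (ENNReal.mul_lt_top hp' hq').ne
  refine ⟨c • P, hP.const_smul c, fun φ => ?_⟩
  change _ ≤ ENNReal.ofReal ((c : ℝ) * P φ)
  rw [ENNReal.ofReal_mul c.coe_nonneg, ENNReal.ofReal_coe_nnreal, hc, modulationNorm, mixedNorm_eq]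
  simp only [matrixCoeff_ofSchwartz]
  refine (mixedENorm_mono p q (h φ)).trans ?_
  refine (mixedENorm_const_mul (by fun_prop) _ _ _).trans ?_
  rw [mul_comm]
  gcongr
  unfold mixedENorm
  have h1 : ∀ y, eLpNorm (fun x => w x * w y) p volume ≤ eLpNorm w p volume * w y := by
    intro y
    simp only [mul_comm _ (w y)]
    exact eLpNorm_ennreal_const_mul hw _ _
  exact (eLpNorm_ennreal_mono q h1).trans (eLpNorm_ennreal_const_mul hw _ _)

/-- Synthesis of a Schwartz function from a rapidly decreasing function on phase space. -/
theorem exists_modulationNorm_synthesis_le {lam : ℝ} (hlam : lam ≠ 0) (g : 𝓢(Space n, ℂ))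
    {p q : ℝ≥0∞} (hp : 1 ≤ p) (hq : 1 ≤ q) :
    ∃ C : ℝ≥0∞, C < ∞ ∧ ∀ F : Space n × Space n → ℂ, Measurable F →
      ∀ u : 𝓢'(Space n, ℂ),
      (∀ z, ‖matrixCoeff lam g u z‖ₑ ≤ ∫⁻ z', ‖F z'‖ₑ *
        ‖schwartzInner (twistedRep lam z.1 z.2 g) (twistedRep lam z'.1 z'.2 g)‖ₑ) →
      modulationNorm lam p q g u ≤ C * mixedNorm p q F := by
  obtain ⟨c, hc, h3⟩ := norm_schwartzInner_twistedRep_sub hlam g g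
  obtain ⟨C, hC, h4⟩ := exists_mixedNorm_le_of_enorm_le (n := n) hp hq
  refine ⟨C * c, ENNReal.mul_lt_top hC hc, fun F hF u h => h4 p q le_rfl le_rfl _ _ _ hF
    fun z => (h z).trans ?_⟩
  rw [← lintegral_const_mul' _ _ hc.ne]
  refine lintegral_mono fun z' => ?_
  calc _ ≤ ‖F z'‖ₑ * (c * (decayWeight n (z'.1 - z.1) * decayWeight n (z'.2 - z.2))) := by
        gcongr
        exact h3 z z'
    _ = _ := by ring

end MatrixCoefficients

/-! ### Twisted modulation spaces as Banach spaces -/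

section ModulationSpace

open Filter Topology

variable {n : ℕ}

theorem exists_schwartz_ne_zero (n : ℕ) : ∃ g : 𝓢(Space n, ℂ), g ≠ 0 := by
  obtain ⟨b⟩ : Nonempty (ContDiffBump (0 : Space n)) := inferInstance
  have h1 : HasCompactSupport fun x => (b x : ℂ) :=
    b.hasCompactSupport.comp_left (g := Complex.ofReal) Complex.ofReal_zero
  have h2 : ContDiff ℝ (⊤ : ℕ∞) fun x => (b x : ℂ) :=
    Complex.ofRealCLM.contDiff.comp b.contDiff
  refine ⟨h1.toSchwartzMap h2, fun h => ?_⟩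
  have h3 := congrArg (fun φ : 𝓢(Space n, ℂ) => φ 0) h
  have h4 : (b 0 : ℂ) = 0 := h3
  rw [b.one_of_mem_closedBall (Metric.mem_closedBall_self b.rIn_pos.le)] at h4
  norm_num at h4

theorem modulationNorm_eq (lam : ℝ) (p q : ℝ≥0∞) (g : 𝓢(Space n, ℂ)) (f : 𝓢'(Space n, ℂ)) :
    modulationNorm lam p q g f = mixedENorm volume volume p q fun z => ‖matrixCoeff lam g f z‖ₑ :=
  mixedNorm_eq _ _ _

theorem measurable_enorm_matrixCoeff {lam : ℝ} (hlam : lam ≠ 0) (g : 𝓢(Space n, ℂ))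
    (f : 𝓢'(Space n, ℂ)) : Measurable fun z => ‖matrixCoeff lam g f z‖ₑ :=
  (continuous_matrixCoeff hlam g f).measurable.enorm

/-- Change of window at equal exponents lets any nonzero window replace the one in the definition;
measurability is automatic since matrix coefficients are continuous. -/
theorem mem_twistedModulationSpace_iff {lam : ℝ} (hlam : lam ≠ 0) {p q : ℝ≥0∞} (hp : 1 ≤ p)
    (hq : 1 ≤ q) {g : 𝓢(Space n, ℂ)} (hg : g ≠ 0) {f : 𝓢'(Space n, ℂ)} :
    f ∈ twistedModulationSpace n lam p q ↔ modulationNorm lam p q g f < ∞ := by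
  constructor
  · rintro ⟨γ, hγ, -, h⟩
    obtain ⟨C, hC, h1⟩ := exists_modulationNorm_le hlam hγ g hp hq le_rfl le_rfl
    exact (h1 f).trans_lt (ENNReal.mul_lt_top hC h)
  · exact fun h => ⟨g, hg, (continuous_matrixCoeff hlam g f).aestronglyMeasurable, h⟩

theorem modulationNorm_add_le {lam : ℝ} (hlam : lam ≠ 0) {p q : ℝ≥0∞} (hp : 1 ≤ p)
    (hq : 1 ≤ q) (g : 𝓢(Space n, ℂ)) (f h : 𝓢'(Space n, ℂ)) :
    modulationNorm lam p q g (f + h) ≤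
      modulationNorm lam p q g f + modulationNorm lam p q g h := by
  simp only [modulationNorm_eq]
  exact (mixedENorm_mono p q fun z => enorm_add_le _ _).trans
    (mixedENorm_add_le (measurable_enorm_matrixCoeff hlam g f)
      (measurable_enorm_matrixCoeff hlam g h) hp hq)

theorem modulationNorm_smul_le {lam : ℝ} (hlam : lam ≠ 0) (p q : ℝ≥0∞) (g : 𝓢(Space n, ℂ))
    (c : ℂ) (f : 𝓢'(Space n, ℂ)) :
    modulationNorm lam p q g (c • f) ≤ ‖c‖ₑ * modulationNorm lam p q g f := by
  simp only [modulationNorm_eq, matrixCoeff_smul, enorm_mul]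
  exact mixedENorm_const_mul (measurable_enorm_matrixCoeff hlam g f) _ _ _

theorem modulationNorm_zero (lam : ℝ) (p q : ℝ≥0∞) (g : 𝓢(Space n, ℂ)) :
    modulationNorm lam p q g 0 = 0 := by
  have h : matrixCoeff lam g 0 = fun _ => 0 := rfl
  simp [modulationNorm, mixedNorm, h]

theorem modulationNorm_ofSchwartz_lt_top {lam : ℝ} (hlam : lam ≠ 0) {p q : ℝ≥0∞} (hp : 1 ≤ p)
    (hq : 1 ≤ q) (g φ : 𝓢(Space n, ℂ)) : modulationNorm lam p q g (ofSchwartz φ) < ∞ := by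
  obtain ⟨P, -, h⟩ := exists_modulationNorm_ofSchwartz_le hlam g hp hq
  exact (h φ).trans_lt ENNReal.ofReal_lt_top

/-- The twisted modulation space as a subspace of the tempered distributions. -/
noncomputable def modulationSubmodule (n : ℕ) {lam : ℝ} (hlam : lam ≠ 0) {p q : ℝ≥0∞} (hp : 1 ≤ p)
    (hq : 1 ≤ q) : Submodule ℂ 𝓢'(Space n, ℂ) where
  carrier := twistedModulationSpace n lam p q
  zero_mem' := by
    obtain ⟨g, hg⟩ := exists_schwartz_ne_zero n
    rw [mem_twistedModulationSpace_iff hlam hp hq hg, modulationNorm_zero]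
    exact ENNReal.zero_lt_top
  add_mem' := by
    obtain ⟨g, hg⟩ := exists_schwartz_ne_zero n
    intro f h hf hh
    rw [mem_twistedModulationSpace_iff hlam hp hq hg] at *
    exact (modulationNorm_add_le hlam hp hq g f h).trans_lt (ENNReal.add_lt_top.2 ⟨hf, hh⟩)
  smul_mem' := by
    obtain ⟨g, hg⟩ := exists_schwartz_ne_zero n
    intro c f hf
    rw [mem_twistedModulationSpace_iff hlam hp hq hg] at *
    exact (modulationNorm_smul_le hlam p q g c f).trans_lt (ENNReal.mul_lt_top enorm_lt_top hf)

theorem mem_modulationSubmodule {lam : ℝ} (hlam : lam ≠ 0) {p q : ℝ≥0∞} (hp : 1 ≤ p)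
    (hq : 1 ≤ q) {g : 𝓢(Space n, ℂ)} (hg : g ≠ 0) {f : 𝓢'(Space n, ℂ)} :
    f ∈ modulationSubmodule n hlam hp hq ↔ modulationNorm lam p q g f < ∞ :=
  mem_twistedModulationSpace_iff hlam hp hq hg

/-- The norm of the twisted modulation space with window `g`, as a seminorm. -/
noncomputable def modulationSeminorm {lam : ℝ} (hlam : lam ≠ 0) {p q : ℝ≥0∞} (hp : 1 ≤ p)
    (hq : 1 ≤ q) {g : 𝓢(Space n, ℂ)} (hg : g ≠ 0) :
    Seminorm ℂ (modulationSubmodule n hlam hp hq) :=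
  Seminorm.ofSMulLE (fun f => (modulationNorm lam p q g f).toReal)
    (by simp [modulationNorm_zero])
    (fun f h => by
      have hf := (mem_modulationSubmodule hlam hp hq hg).1 f.2
      have hh := (mem_modulationSubmodule hlam hp hq hg).1 h.2
      rw [← ENNReal.toReal_add hf.ne hh.ne]
      exact ENNReal.toReal_mono (ENNReal.add_lt_top.2 ⟨hf, hh⟩).ne
        (modulationNorm_add_le hlam hp hq g _ _))
    (fun c f => by
      have hf := (mem_modulationSubmodule hlam hp hq hg).1 f.2
      rw [← toReal_enorm c, ← ENNReal.toReal_mul]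
      exact ENNReal.toReal_mono (ENNReal.mul_lt_top enorm_lt_top hf).ne
        (modulationNorm_smul_le hlam p q g c _))

theorem ofReal_modulationSeminorm {lam : ℝ} (hlam : lam ≠ 0) {p q : ℝ≥0∞} (hp : 1 ≤ p)
    (hq : 1 ≤ q) {g : 𝓢(Space n, ℂ)} (hg : g ≠ 0) (f : modulationSubmodule n hlam hp hq) :
    modulationNorm lam p q g f = ENNReal.ofReal (modulationSeminorm hlam hp hq hg f) :=
  (ENNReal.ofReal_toReal ((mem_modulationSubmodule hlam hp hq hg).1 f.2).ne).symm

/-- Orthogonality with equal windows, where `κ` also absorbs the squared norm of `g`. Pairing with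
Schwartz functions thus recovers every value of `h`. -/
theorem exists_modulationPairing_ofSchwartz {lam : ℝ} (hlam : lam ≠ 0) {g : 𝓢(Space n, ℂ)}
    (hg : g ≠ 0) :
    ∃ κ : ℝ, 0 < κ ∧ ∀ (φ : 𝓢(Space n, ℂ)) (h : 𝓢'(Space n, ℂ)),
      Integrable (pairingIntegrand lam g (ofSchwartz φ) h) ∧
      modulationPairing lam g (ofSchwartz φ) h = κ * conj (h (conjSchwartz φ)) := by
  obtain ⟨κ, hκ, h1⟩ := exists_integral_matrixCoeff_mul_conj (n := n) hlam
  obtain ⟨ρ, hρ, h2⟩ := exists_pos_schwartzInner_self hg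
  refine ⟨κ * ρ, mul_pos hκ hρ, fun φ h => ⟨(h1 φ g g h).1, ?_⟩⟩
  rw [Complex.ofReal_mul, ← h2]
  exact (h1 φ g g h).2

theorem enorm_conj (c : ℂ) : ‖conj c‖ₑ = ‖c‖ₑ := by
  rw [← ofReal_norm, RCLike.norm_conj, ofReal_norm]

theorem enorm_ofReal_of_pos {κ : ℝ} (hκ : 0 < κ) : ‖(κ : ℂ)‖ₑ = ENNReal.ofReal κ := by
  rw [← ofReal_norm, Complex.norm_real, Real.norm_of_nonneg hκ.le]

theorem lintegral_pairingIntegrand_le {lam : ℝ} (hlam : lam ≠ 0) (g : 𝓢(Space n, ℂ))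
    (p p' q q' : ℝ≥0∞) [p.HolderConjugate p'] [q.HolderConjugate q'] (f h : 𝓢'(Space n, ℂ)) :
    ∫⁻ z, ‖pairingIntegrand lam g f h z‖ₑ ≤
      modulationNorm lam p q g f * modulationNorm lam p' q' g h := by
  simp only [modulationNorm_eq, pairingIntegrand, enorm_mul, enorm_conj]
  exact lintegral_mul_le_mixedENorm p p' q q' (measurable_enorm_matrixCoeff hlam g f)
    (measurable_enorm_matrixCoeff hlam g h)

/-- Precomposition of a seminorm with complex conjugation. -/
noncomputable def conjSeminorm (P : Seminorm ℂ 𝓢(Space n, ℂ)) : Seminorm ℂ 𝓢(Space n, ℂ) :=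
  Seminorm.of (fun φ => P (conjSchwartz φ))
    (fun φ ψ => by rw [conjSchwartz_add]; exact map_add_le_add P _ _)
    (fun c φ => by rw [conjSchwartz_smul, map_smul_eq_mul, RCLike.norm_conj])

/-- `f ψ` is, up to conjugation and a constant, a pairing of `f` with a Schwartz function. Hölder
leaves the conjugate-exponent norm of that function, itself bounded by a continuous seminorm. -/
theorem exists_enorm_apply_le {lam : ℝ} (hlam : lam ≠ 0) {g : 𝓢(Space n, ℂ)} (hg : g ≠ 0)
    {p q : ℝ≥0∞} (hp : 1 ≤ p) (hq : 1 ≤ q) :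
    ∃ P : Seminorm ℂ 𝓢(Space n, ℂ), Continuous P ∧
      ∀ (f : 𝓢'(Space n, ℂ)) ψ, ‖f ψ‖ₑ ≤ ENNReal.ofReal (P ψ) * modulationNorm lam p q g f := by
  have i1 := ENNReal.HolderConjugate.conjExponent hp
  have i2 := ENNReal.HolderConjugate.conjExponent hq
  have i1' := i1.symm
  have i2' := i2.symm
  obtain ⟨P, hP, h1⟩ := exists_modulationNorm_ofSchwartz_le hlam g
    (one_le_of_holderConjugate p.conjExponent p) (one_le_of_holderConjugate q.conjExponent q)
  obtain ⟨κ, hκ, h2⟩ := exists_modulationPairing_ofSchwartz hlam hg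
  refine ⟨Real.toNNReal κ⁻¹ • conjSeminorm P,
    (hP.comp continuous_conjSchwartz).const_smul (Real.toNNReal κ⁻¹), fun f ψ => ?_⟩
  change _ ≤ ENNReal.ofReal ((Real.toNNReal κ⁻¹ : ℝ) * P (conjSchwartz ψ)) * _
  rw [Real.coe_toNNReal _ (inv_nonneg.2 hκ.le), ENNReal.ofReal_mul (inv_nonneg.2 hκ.le),
    ENNReal.ofReal_inv_of_pos hκ]
  have h3 := (h2 (conjSchwartz ψ) f).2
  rw [conjSchwartz_conjSchwartz] at h3
  have h4 : ENNReal.ofReal κ * ‖f ψ‖ₑ ≤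
      ENNReal.ofReal (P (conjSchwartz ψ)) * modulationNorm lam p q g f := by
    rw [← enorm_ofReal_of_pos hκ, ← enorm_conj (f ψ), ← enorm_mul, ← h3]
    refine (enorm_integral_le_lintegral_enorm _).trans
      ((lintegral_pairingIntegrand_le hlam g p.conjExponent p q.conjExponent q _ f).trans ?_)
    gcongr
    exact h1 _
  rw [mul_assoc]
  refine le_trans (le_of_eq ?_) (mul_le_mul_right h4 (ENNReal.ofReal κ)⁻¹)
  rw [← mul_assoc, ENNReal.inv_mul_cancel (ENNReal.ofReal_pos.2 hκ).ne' ENNReal.ofReal_ne_top,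
    one_mul]

/-- Pointwise convergence of distributions gives pointwise convergence of matrix coefficients, so
Fatou's lemma for mixed norms applies. -/
theorem modulationNorm_le_of_tendsto {lam : ℝ} (hlam : lam ≠ 0) {g : 𝓢(Space n, ℂ)}
    {p q b : ℝ≥0∞} {u : ℕ → 𝓢'(Space n, ℂ)} {f : 𝓢'(Space n, ℂ)}
    (h : ∀ ψ, Tendsto (fun k => u k ψ) atTop (𝓝 (f ψ)))
    (hb : ∀ᶠ k in atTop, modulationNorm lam p q g (u k) ≤ b) : modulationNorm lam p q g f ≤ b := by
  simp only [modulationNorm_eq] at hb ⊢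
  exact mixedENorm_le_of_tendsto (fun k => measurable_enorm_matrixCoeff hlam g (u k))
    (fun z => (h _).enorm) hb

/-- A linear functional on Schwartz space which is bounded by a continuous seminorm is a tempered
distribution. -/
theorem exists_distribution (ℓ : 𝓢(Space n, ℂ) →ₗ[ℂ] ℂ) {P : Seminorm ℂ 𝓢(Space n, ℂ)}
    (hP : Continuous P) (h : ∀ φ, ‖ℓ φ‖ ≤ P φ) : ∃ f : 𝓢'(Space n, ℂ), ∀ φ, f φ = ℓ φ := by
  have hc : Continuous ℓ := by
    refine continuous_of_continuousAt_zero ℓ ?_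
    rw [ContinuousAt, map_zero]
    refine squeeze_zero_norm h ?_
    have := hP.tendsto 0
    rwa [map_zero] at this
  exact ⟨ContinuousLinearMap.toPointwiseConvergenceCLM ℂ (RingHom.id ℂ) _ _ ⟨ℓ, hc⟩, fun φ => rfl⟩

/-- Norm control of point values gives definiteness, and turns a Cauchy sequence into a pointwise
convergent one whose limit is again a distribution; Fatou does the rest. -/
theorem isBanachNorm_modulationSeminorm {lam : ℝ} (hlam : lam ≠ 0) {p q : ℝ≥0∞} (hp : 1 ≤ p)
    (hq : 1 ≤ q) {g : 𝓢(Space n, ℂ)} (hg : g ≠ 0) :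
    IsBanachNorm (modulationSeminorm hlam hp hq hg) := by
  obtain ⟨P, hP, hb⟩ := exists_enorm_apply_le hlam hg hp hq
  set N := modulationSeminorm hlam hp hq hg
  have hN : ∀ f : modulationSubmodule n hlam hp hq, modulationNorm lam p q g f =
    ENNReal.ofReal (N f) := ofReal_modulationSeminorm hlam hp hq hg
  have hb' : ∀ (f : modulationSubmodule n hlam hp hq) ψ,
      ‖(f : 𝓢'(Space n, ℂ)) ψ‖ ≤ P ψ * N f := by
    intro f ψ
    have := hb f ψ
    rw [hN, ← ENNReal.ofReal_mul (apply_nonneg P ψ), ← ofReal_norm] at this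
    exact (ENNReal.ofReal_le_ofReal_iff
      (mul_nonneg (apply_nonneg P ψ) (apply_nonneg N f))).1 this
  refine ⟨fun f hf => ?_, fun u hu => ?_⟩
  · ext ψ
    have := hb' f ψ
    rw [hf, mul_zero] at this
    exact norm_le_zero_iff.1 this
  · have hcau : ∀ ψ, CauchySeq fun k => (u k : 𝓢'(Space n, ℂ)) ψ := by
      intro ψ
      refine Metric.cauchySeq_iff.2 fun ε hε => ?_
      have hpos : 0 < P ψ + 1 := by linarith [apply_nonneg P ψ]
      obtain ⟨K, hK⟩ := hu (ε / (P ψ + 1)) (div_pos hε hpos)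
      refine ⟨K, fun m hm k hk => ?_⟩
      rw [dist_eq_norm]
      have h1 := hb' (u m - u k) ψ
      have h2 := hK m k hm hk
      rw [lt_div_iff₀ hpos] at h2
      refine lt_of_le_of_lt h1 ?_
      nlinarith [apply_nonneg N (u m - u k)]
    choose ℓ hℓ using fun ψ => cauchySeq_tendsto_of_complete (hcau ψ)
    obtain ⟨K₁, hK₁⟩ := hu 1 one_pos
    -- A bound for the tail of the sequence; it makes the limit functional continuous and, by Fatou,
    -- a member of the space.
    set b : ℝ := 1 + N (u K₁)
    have hub : ∀ k, K₁ ≤ k → N (u k) ≤ b := by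
      intro k hk
      have h1 := hK₁ k K₁ hk le_rfl
      have h2 := map_add_le_add N (u k - u K₁) (u K₁)
      rw [sub_add_cancel] at h2
      linarith
    have hb0 : 0 ≤ b := add_nonneg zero_le_one (apply_nonneg N _)
    obtain ⟨f, hf⟩ := exists_distribution (n := n)
      { toFun := ℓ
        map_add' := fun φ ψ => tendsto_nhds_unique (hℓ (φ + ψ)) (by
          simpa only [map_add] using (hℓ φ).add (hℓ ψ))
        map_smul' := fun c φ => tendsto_nhds_unique (hℓ (c • φ)) (by
          simpa only [map_smul, RingHom.id_apply] using (hℓ φ).const_smul c) }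
      (P := Real.toNNReal b • P) (hP.const_smul (Real.toNNReal b)) (fun ψ => by
        change _ ≤ (Real.toNNReal b : ℝ) * P ψ
        rw [Real.coe_toNNReal _ hb0]
        refine le_of_tendsto (hℓ ψ).norm ?_
        filter_upwards [eventually_ge_atTop K₁] with k hk
        refine (hb' (u k) ψ).trans ?_
        rw [mul_comm]
        exact mul_le_mul_of_nonneg_right (hub k hk) (apply_nonneg P ψ))
    have hlim : ∀ ψ, Tendsto (fun k => (u k : 𝓢'(Space n, ℂ)) ψ) atTop (𝓝 (f ψ)) := by
      intro ψ
      rw [hf]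
      exact hℓ ψ
    have hfM : f ∈ modulationSubmodule n hlam hp hq := by
      rw [mem_modulationSubmodule hlam hp hq hg]
      refine (modulationNorm_le_of_tendsto hlam hlim (b := ENNReal.ofReal b) ?_).trans_lt
        ENNReal.ofReal_lt_top
      filter_upwards [eventually_ge_atTop K₁] with k hk
      rw [hN]
      exact ENNReal.ofReal_le_ofReal (hub k hk)
    refine ⟨⟨f, hfM⟩, ?_⟩
    refine Metric.tendsto_atTop.2 fun ε hε => ?_
    obtain ⟨K, hK⟩ := hu (ε / 2) (half_pos hε)
    refine ⟨K, fun k hk => ?_⟩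
    rw [Real.dist_eq, sub_zero, abs_of_nonneg (apply_nonneg N _)]
    refine lt_of_le_of_lt ?_ (half_lt_self hε)
    -- Fatou along `m` in `u k - u m` keeps the Cauchy bound for the limit `u k - f`.
    have h1 : modulationNorm lam p q g ((u k : 𝓢'(Space n, ℂ)) - f) ≤
        ENNReal.ofReal (ε / 2) := by
      refine modulationNorm_le_of_tendsto hlam
        (u := fun m => (u k : 𝓢'(Space n, ℂ)) - (u m : 𝓢'(Space n, ℂ)))
        (fun ψ => tendsto_const_nhds.sub (hlim ψ)) ?_
      filter_upwards [eventually_ge_atTop K] with m hm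
      have := hN (u k - u m)
      rw [Submodule.coe_sub] at this
      rw [this]
      exact ENNReal.ofReal_le_ofReal (hK k m hk hm).le
    have h2 := hN (u k - ⟨f, hfM⟩)
    rw [Submodule.coe_sub] at h2
    rw [h2] at h1
    exact (ENNReal.ofReal_le_ofReal_iff (half_pos hε).le).1 h1

end ModulationSpace

/-! ### Density of Schwartz functions and duality -/

section Duality

open Filter Topology

variable {n : ℕ}

theorem integrable_one_add_norm_pow_mul_of_bounded {F : Space n × Space n → ℂ}
    (hF : Measurable F) {R b : ℝ}
    (h : ∀ z, ‖F z‖ ≤ (Metric.closedBall (0 : Space n × Space n) R).indicator (fun _ => b) z)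
    (N : ℕ) : Integrable fun z => (1 + ‖z‖) ^ N * ‖F z‖ := by
  have h1 : Integrable ((Metric.closedBall (0 : Space n × Space n) R).indicator
      fun _ => (1 + R) ^ N * b) := by
    rw [integrable_indicator_iff Metric.isClosed_closedBall.measurableSet]
    exact integrableOn_const (isCompact_closedBall _ _).measure_lt_top.ne
  refine h1.mono' (by fun_prop) (Eventually.of_forall fun z => ?_)
  rw [Real.norm_of_nonneg (by positivity)]
  have h2 := h z
  by_cases hz : z ∈ Metric.closedBall (0 : Space n × Space n) R
  · rw [Set.indicator_of_mem hz] at h2 ⊢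
    rw [mem_closedBall_zero_iff] at hz
    have hR : 0 ≤ R := (norm_nonneg z).trans hz
    gcongr
  · rw [Set.indicator_of_notMem hz] at h2 ⊢
    rw [le_antisymm h2 (norm_nonneg _), mul_zero]

/-- The matrix coefficients of a synthesized Schwartz function. -/
theorem exists_synthesis_matrixCoeff {lam : ℝ} (hlam : lam ≠ 0) (g : 𝓢(Space n, ℂ))
    {F : Space n × Space n → ℂ} (hF : Measurable F) {R b : ℝ}
    (hb : ∀ z, ‖F z‖ ≤ (Metric.closedBall (0 : Space n × Space n) R).indicator (fun _ => b) z) :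
    ∃ φ : 𝓢(Space n, ℂ),
      (∀ h : 𝓢'(Space n, ℂ), Integrable (fun z => F z * conj (matrixCoeff lam g h z)) ∧
        conj (h (conjSchwartz φ)) = ∫ z, F z * conj (matrixCoeff lam g h z)) ∧
      ∀ z, Integrable (fun z' : Space n × Space n => F z' *
          schwartzInner (twistedRep lam z'.1 z'.2 g) (twistedRep lam z.1 z.2 g)) ∧
        matrixCoeff lam g (ofSchwartz φ) z = ∫ z' : Space n × Space n, F z' *
          schwartzInner (twistedRep lam z'.1 z'.2 g) (twistedRep lam z.1 z.2 g) := by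
  obtain ⟨φ, hφ⟩ := exists_synthesis hlam g hF.aestronglyMeasurable
    (integrable_one_add_norm_pow_mul_of_bounded hF hb)
  have h1 : ∀ h : 𝓢'(Space n, ℂ), Integrable (fun z => F z * conj (matrixCoeff lam g h z)) ∧
      conj (h (conjSchwartz φ)) = ∫ z, F z * conj (matrixCoeff lam g h z) :=
    fun h => hφ (conjFunctional h)
  refine ⟨φ, h1, fun z => ?_⟩
  -- The matrix coefficient at `z` comes from taking $\Pi_\lambda(z)g$ itself as the test
  -- distribution.
  have h2 := h1 (ofSchwartz (twistedRep lam z.1 z.2 g))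
  simp only [matrixCoeff_ofSchwartz, ofSchwartz_conjSchwartz, schwartzInner_conj] at h2 ⊢
  exact h2

theorem enorm_schwartzInner_comm (φ ψ : 𝓢(Space n, ℂ)) :
    ‖schwartzInner φ ψ‖ₑ = ‖schwartzInner ψ φ‖ₑ := by
  rw [← schwartzInner_conj, enorm_conj]

/-- The reproducing formula: the pairing with $\Pi_\lambda(z)g$, conjugated. The constant is the
inverse of the one in `exists_modulationPairing_ofSchwartz`. -/
theorem exists_matrixCoeff_eq_integral {lam : ℝ} (hlam : lam ≠ 0) {g : 𝓢(Space n, ℂ)}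
    (hg : g ≠ 0) :
    ∃ κ : ℝ, 0 < κ ∧ ∀ (f : 𝓢'(Space n, ℂ)) (z : Space n × Space n),
      Integrable (fun z' : Space n × Space n => (κ : ℂ) * matrixCoeff lam g f z' *
          schwartzInner (twistedRep lam z'.1 z'.2 g) (twistedRep lam z.1 z.2 g)) ∧
      matrixCoeff lam g f z = ∫ z' : Space n × Space n, (κ : ℂ) * matrixCoeff lam g f z' *
          schwartzInner (twistedRep lam z'.1 z'.2 g) (twistedRep lam z.1 z.2 g) := by
  obtain ⟨κ, hκ, h⟩ := exists_modulationPairing_ofSchwartz hlam hg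
  refine ⟨κ⁻¹, inv_pos.2 hκ, fun f z => ?_⟩
  obtain ⟨h1, h2⟩ := h (twistedRep lam z.1 z.2 g) f
  have h3 : (fun z' : Space n × Space n => ((κ⁻¹ : ℝ) : ℂ) * matrixCoeff lam g f z' *
      schwartzInner (twistedRep lam z'.1 z'.2 g) (twistedRep lam z.1 z.2 g)) = fun z' =>
      ((κ⁻¹ : ℝ) : ℂ) *
        conj (pairingIntegrand lam g (ofSchwartz (twistedRep lam z.1 z.2 g)) f z') := by
    funext z'
    rw [pairingIntegrand, map_mul, Complex.conj_conj, matrixCoeff_ofSchwartz, schwartzInner_conj]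
    ring
  rw [h3]
  refine ⟨(Complex.conjCLE.toContinuousLinearMap.integrable_comp h1).const_mul _, ?_⟩
  rw [integral_const_mul, integral_conj]
  change _ = _ * conj (modulationPairing lam g _ f)
  rw [h2, map_mul, Complex.conj_conj, Complex.conj_ofReal, ← mul_assoc, ← Complex.ofReal_mul,
    inv_mul_cancel₀ hκ.ne', Complex.ofReal_one, one_mul]
  rfl

/-- Schwartz functions are dense in the modulation spaces with finite exponents. -/
theorem exists_modulationNorm_sub_ofSchwartz_lt {lam : ℝ} (hlam : lam ≠ 0) {g : 𝓢(Space n, ℂ)}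
    (hg : g ≠ 0) {p q : ℝ≥0∞} (hp : 1 ≤ p) (hq : 1 ≤ q) (hp' : p ≠ ∞) (hq' : q ≠ ∞)
    {f : 𝓢'(Space n, ℂ)} (hf : modulationNorm lam p q g f < ∞) {ε : ℝ≥0∞} (hε : 0 < ε) :
    ∃ φ, modulationNorm lam p q g (f - ofSchwartz φ) < ε := by
  obtain ⟨κ, hκ, hrep⟩ := exists_matrixCoeff_eq_integral hlam hg
  obtain ⟨C, hC, hsyn⟩ := exists_modulationNorm_synthesis_le hlam g hp hq
  set B : ℕ → Set (Space n × Space n) := fun k => Metric.closedBall 0 k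
  have hB : ∀ k, MeasurableSet (B k) := fun k => Metric.isClosed_closedBall.measurableSet
  have hV := measurable_enorm_matrixCoeff hlam g f
  have hc := continuous_matrixCoeff hlam g f
  have hlim := tendsto_mixedENorm_indicator_compl (μ := volume) (ν := volume) hV hB
    (fun i j hij => Metric.closedBall_subset_closedBall (by exact_mod_cast hij))
    (fun z => by
      obtain ⟨k, hk⟩ := exists_nat_ge ‖z‖
      exact ⟨k, mem_closedBall_zero_iff.2 hk⟩)
    (zero_lt_one.trans_le hp).ne' hp' (zero_lt_one.trans_le hq).ne' hq'
    (by rw [← modulationNorm_eq]; exact hf.ne)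
  have hCκ : C * ENNReal.ofReal κ ≠ ∞ := (ENNReal.mul_lt_top hC ENNReal.ofReal_lt_top).ne
  have hlim2 := ENNReal.Tendsto.const_mul hlim (Or.inr hCκ)
  rw [mul_zero] at hlim2
  obtain ⟨k, hk⟩ := (hlim2.eventually_lt_const hε).exists
  -- The density in the reproducing formula is split at the ball. The inner part synthesizes `φ`, so
  -- the coefficients of `f - φ` are reproduced from the tail `F'` alone, whose mixed norm is small
  -- by the choice of `k`.
  set F : Space n × Space n → ℂ := (B k).indicator fun z => (κ : ℂ) * matrixCoeff lam g f z
  set F' : Space n × Space n → ℂ := (B k)ᶜ.indicator fun z => (κ : ℂ) * matrixCoeff lam g f z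
  have hm : Measurable fun z => (κ : ℂ) * matrixCoeff lam g f z := hc.measurable.const_mul _
  obtain ⟨b, hb⟩ := (isCompact_closedBall (0 : Space n × Space n) k).exists_bound_of_continuousOn
    (f := fun z => (κ : ℂ) * matrixCoeff lam g f z) (continuous_const.mul hc).continuousOn
  obtain ⟨φ, -, hφ⟩ := exists_synthesis_matrixCoeff hlam g (hm.indicator (hB k)) (R := k) (b := b)
    (fun z => by
      by_cases hz : z ∈ B k
      · rw [Set.indicator_of_mem hz, Set.indicator_of_mem hz]
        exact hb z hz
      · rw [Set.indicator_of_notMem hz, Set.indicator_of_notMem hz, norm_zero])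
  refine ⟨φ, lt_of_le_of_lt ?_ hk⟩
  have h1 := hsyn F' (hm.indicator (hB k).compl) (f - ofSchwartz φ) (fun z => ?_)
  · refine h1.trans ?_
    rw [mul_assoc, mixedNorm_eq]
    gcongr
    have h2 : (fun z => ‖F' z‖ₑ) = fun z => ENNReal.ofReal κ *
        (B k)ᶜ.indicator (fun z => ‖matrixCoeff lam g f z‖ₑ) z := by
      funext z
      by_cases hz : z ∈ (B k)ᶜ
      · simp only [F', Set.indicator_of_mem hz, enorm_mul, enorm_ofReal_of_pos hκ]
      · simp only [F', Set.indicator_of_notMem hz, enorm_zero, mul_zero]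
    rw [h2]
    exact mixedENorm_const_mul (hV.indicator (hB k).compl) _ _ _
  · obtain ⟨h2, h3⟩ := hrep f z
    obtain ⟨h4, h5⟩ := hφ z
    rw [matrixCoeff_sub, h3, h5, ← integral_sub h2 h4]
    refine (enorm_integral_le_lintegral_enorm _).trans_eq (lintegral_congr fun z' => ?_)
    rw [← sub_mul, enorm_mul, enorm_schwartzInner_comm]
    congr 2
    by_cases hz : z' ∈ B k
    · simp only [F', Set.indicator_of_mem hz, sub_self,
        Set.indicator_of_notMem (fun h : z' ∈ (B k)ᶜ => h hz)]
    · simp only [F', Set.indicator_of_notMem hz, sub_zero, Set.indicator_of_mem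
        (show z' ∈ (B k)ᶜ from hz)]

/-- The modulation norm is controlled by the action on Schwartz functions. -/
theorem exists_modulationNorm_le_of_forall_schwartz {lam : ℝ} (hlam : lam ≠ 0)
    (g : 𝓢(Space n, ℂ)) (p p' q q' : ℝ≥0∞) [p.HolderConjugate p'] [q.HolderConjugate q'] :
    ∃ A : ℝ≥0∞, A < ∞ ∧ ∀ (h : 𝓢'(Space n, ℂ)) (c : ℝ≥0∞),
      (∀ φ, ‖h (conjSchwartz φ)‖ₑ ≤ c * modulationNorm lam p q g (ofSchwartz φ)) →
      modulationNorm lam p' q' g h ≤ c * A := by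
  have i1 : p'.HolderConjugate p := ENNReal.HolderConjugate.symm
  have i2 : q'.HolderConjugate q := ENNReal.HolderConjugate.symm
  obtain ⟨C, hC, hsyn⟩ := exists_modulationNorm_synthesis_le hlam g
    (one_le_of_holderConjugate p p') (one_le_of_holderConjugate q q')
  refine ⟨C, hC, fun h c hh => ?_⟩
  rw [modulationNorm_eq]
  have hm := (continuous_matrixCoeff hlam g h).measurable
  refine mixedENorm_le_of_forall_bounded p' p q' q (measurable_enorm_matrixCoeff hlam g h)
    (B := fun k : ℕ => Metric.closedBall 0 k)
    (fun k => Metric.isClosed_closedBall.measurableSet)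
    (fun i j hij => Metric.closedBall_subset_closedBall (by exact_mod_cast hij))
    (fun z => by
      obtain ⟨k, hk⟩ := exists_nat_ge ‖z‖
      exact ⟨k, mem_closedBall_zero_iff.2 hk⟩) fun H hH k hHk => ?_
  have hfin : ∀ z, H z ≠ ∞ := by
    intro z
    refine ((hHk z).trans_lt (lt_of_le_of_lt (Set.indicator_le_self _ _ z) ?_)).ne
    exact ENNReal.natCast_lt_top k
  -- `H` times the phase of the matrix coefficient, so that `F` against the conjugate coefficient is
  -- `H` times its modulus. Where the coefficient vanishes, division by zero makes `F` zero,
  -- consistently.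
  set F : Space n × Space n → ℂ := fun z =>
    ((H z).toReal : ℂ) * (matrixCoeff lam g h z / (‖matrixCoeff lam g h z‖ : ℂ))
  have hF : Measurable F := by fun_prop
  have hFH : ∀ z, ‖F z‖ ≤ (H z).toReal := by
    intro z
    simp only [F, norm_mul, norm_div, Complex.norm_real, norm_norm]
    rw [Real.norm_of_nonneg ENNReal.toReal_nonneg]
    exact mul_le_of_le_one_right ENNReal.toReal_nonneg (div_self_le_one _)
  have hFV : ∀ z, F z * conj (matrixCoeff lam g h z) =
      (((H z).toReal * ‖matrixCoeff lam g h z‖ : ℝ) : ℂ) := by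
    intro z
    simp only [F]
    rcases eq_or_ne (matrixCoeff lam g h z) 0 with h0 | h0
    · simp [h0]
    · have h1 : (‖matrixCoeff lam g h z‖ : ℂ) ≠ 0 := by exact_mod_cast norm_ne_zero_iff.2 h0
      have h2 := Complex.mul_conj (matrixCoeff lam g h z)
      rw [Complex.normSq_eq_norm_sq] at h2
      push_cast at h2 ⊢
      field_simp
      rw [mul_assoc, h2]
  obtain ⟨φ, h1, h2⟩ := exists_synthesis_matrixCoeff hlam g hF (R := k) (b := k) fun z => by
    refine (hFH z).trans ?_
    have h3 := hHk z
    by_cases hz : z ∈ Metric.closedBall (0 : Space n × Space n) k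
    · rw [Set.indicator_of_mem hz] at h3 ⊢
      simpa using ENNReal.toReal_mono (ENNReal.natCast_ne_top k) h3
    · rw [Set.indicator_of_notMem hz] at h3 ⊢
      rw [le_antisymm h3 bot_le]
      simp
  obtain ⟨h3, h4⟩ := h1 h
  simp only [hFV] at h3 h4
  have h5 : Integrable fun z => (H z).toReal * ‖matrixCoeff lam g h z‖ := by
    simpa using h3.re
  -- The duality integral is thus a single value of `h` at a synthesized Schwartz function, whose
  -- norm is at most `C` times that of `F`, hence of `H`.
  have h6 : ∫⁻ z, ‖matrixCoeff lam g h z‖ₑ * H z = ‖h (conjSchwartz φ)‖ₑ := by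
    rw [← enorm_conj, h4, integral_complex_ofReal, ← ofReal_norm, Complex.norm_real,
      Real.norm_of_nonneg (integral_nonneg fun z => by positivity),
      ofReal_integral_eq_lintegral_ofReal h5 (Eventually.of_forall fun z => by positivity)]
    refine lintegral_congr fun z => ?_
    rw [ENNReal.ofReal_mul ENNReal.toReal_nonneg, ENNReal.ofReal_toReal (hfin z), ofReal_norm,
      mul_comm]
  rw [← Measure.volume_eq_prod, h6, mul_assoc]
  refine (hh φ).trans (mul_le_mul_right ?_ c)
  refine (hsyn F hF (ofSchwartz φ) fun z => ?_).trans ?_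
  · rw [(h2 z).2]
    refine (enorm_integral_le_lintegral_enorm _).trans_eq (lintegral_congr fun z' => ?_)
    rw [enorm_mul, enorm_schwartzInner_comm]
  · rw [mixedNorm_eq]
    refine mul_le_mul_right (mixedENorm_mono p q fun z => ?_) C
    rw [← ofReal_norm, ← ENNReal.ofReal_toReal (hfin z)]
    exact ENNReal.ofReal_le_ofReal (hFH z)

theorem ofSchwartz_mem_modulationSubmodule {lam : ℝ} (hlam : lam ≠ 0) {p q : ℝ≥0∞} (hp : 1 ≤ p)
    (hq : 1 ≤ q) (φ : 𝓢(Space n, ℂ)) : ofSchwartz φ ∈ modulationSubmodule n hlam hp hq := by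
  obtain ⟨g, hg⟩ := exists_schwartz_ne_zero n
  rw [mem_modulationSubmodule hlam hp hq hg]
  exact modulationNorm_ofSchwartz_lt_top hlam hp hq g φ

theorem exists_modulationSeminorm_sub_ofSchwartz_lt {lam : ℝ} (hlam : lam ≠ 0)
    {g : 𝓢(Space n, ℂ)} (hg : g ≠ 0) {p q : ℝ≥0∞} (hp : 1 ≤ p) (hq : 1 ≤ q) (hp' : p ≠ ∞)
    (hq' : q ≠ ∞) (f : modulationSubmodule n hlam hp hq) {ε : ℝ} (hε : 0 < ε) :
    ∃ φ, modulationSeminorm hlam hp hq hg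
      (f - ⟨ofSchwartz φ, ofSchwartz_mem_modulationSubmodule hlam hp hq φ⟩) < ε := by
  obtain ⟨φ, hφ⟩ := exists_modulationNorm_sub_ofSchwartz_lt hlam hg hp hq hp' hq'
    ((mem_modulationSubmodule hlam hp hq hg).1 f.2) (ENNReal.ofReal_pos.2 hε)
  refine ⟨φ, ?_⟩
  have h1 := ofReal_modulationSeminorm hlam hp hq hg
    (f - ⟨ofSchwartz φ, ofSchwartz_mem_modulationSubmodule hlam hp hq φ⟩)
  rw [Submodule.coe_sub] at h1
  rw [h1, ENNReal.ofReal_lt_ofReal_iff hε] at hφ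
  exact hφ

theorem integrable_pairingIntegrand {lam : ℝ} (hlam : lam ≠ 0) {g : 𝓢(Space n, ℂ)}
    (p p' q q' : ℝ≥0∞) [p.HolderConjugate p'] [q.HolderConjugate q'] {f h : 𝓢'(Space n, ℂ)}
    (hf : modulationNorm lam p q g f < ∞) (hh : modulationNorm lam p' q' g h < ∞) :
    Integrable (pairingIntegrand lam g f h) := by
  refine ⟨Continuous.aestronglyMeasurable ?_, ?_⟩
  · exact (continuous_matrixCoeff hlam g f).mul
      (Complex.continuous_conj.comp (continuous_matrixCoeff hlam g h))
  · exact (lintegral_pairingIntegrand_le hlam g p p' q q' f h).trans_lt (ENNReal.mul_lt_top hf hh)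

theorem norm_modulationPairing_le {lam : ℝ} (hlam : lam ≠ 0) {g : 𝓢(Space n, ℂ)}
    (p p' q q' : ℝ≥0∞) [p.HolderConjugate p'] [q.HolderConjugate q'] {f h : 𝓢'(Space n, ℂ)}
    (hf : modulationNorm lam p q g f < ∞) (hh : modulationNorm lam p' q' g h < ∞) :
    ‖modulationPairing lam g f h‖ ≤
      (modulationNorm lam p' q' g h).toReal * (modulationNorm lam p q g f).toReal := by
  rw [mul_comm, ← ENNReal.toReal_mul, ← toReal_enorm]
  exact ENNReal.toReal_mono (ENNReal.mul_lt_top hf hh).ne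
    ((enorm_integral_le_lintegral_enorm _).trans
      (lintegral_pairingIntegrand_le hlam g p p' q q' f h))

/-- The pairing with a fixed distribution as a linear functional. -/
noncomputable def pairingFunctional {lam : ℝ} (hlam : lam ≠ 0) {g : 𝓢(Space n, ℂ)} (hg : g ≠ 0)
    {p q : ℝ≥0∞} (hp : 1 ≤ p) (hq : 1 ≤ q) (p' q' : ℝ≥0∞) [p.HolderConjugate p']
    [q.HolderConjugate q'] {h : 𝓢'(Space n, ℂ)} (hh : modulationNorm lam p' q' g h < ∞) :
    modulationSubmodule n hlam hp hq →ₗ[ℂ] ℂ where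
  toFun f := modulationPairing lam g f h
  map_add' f₁ f₂ := by
    have h1 := integrable_pairingIntegrand hlam p p' q q'
      ((mem_modulationSubmodule hlam hp hq hg).1 f₁.2) hh
    have h2 := integrable_pairingIntegrand hlam p p' q q'
      ((mem_modulationSubmodule hlam hp hq hg).1 f₂.2) hh
    unfold modulationPairing
    rw [← integral_add h1 h2]
    refine integral_congr_ae (Eventually.of_forall fun z => ?_)
    simp only [pairingIntegrand, Submodule.coe_add, matrixCoeff_add, add_mul]
  map_smul' c f := by
    unfold modulationPairing
    rw [RingHom.id_apply, smul_eq_mul, ← integral_const_mul]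
    refine integral_congr_ae (Eventually.of_forall fun z => ?_)
    simp only [pairingIntegrand, Submodule.coe_smul, matrixCoeff_smul, mul_assoc]

/-- The duality of the twisted modulation spaces. -/
theorem isDualUnderPairing {lam : ℝ} (hlam : lam ≠ 0) {g : 𝓢(Space n, ℂ)} (hg : g ≠ 0)
    {p q : ℝ≥0∞} (hp : 1 ≤ p) (hq : 1 ≤ q) (hp' : p ≠ ∞) (hq' : q ≠ ∞) (p' q' : ℝ≥0∞)
    [p.HolderConjugate p'] [q.HolderConjugate q'] :
    IsDualUnderPairing lam g (modulationSubmodule n hlam hp hq)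
      (modulationSeminorm hlam hp hq hg) (twistedModulationSpace n lam p' q')
      (modulationNorm lam p' q' g) := by
  have i1 : p'.HolderConjugate p := ENNReal.HolderConjugate.symm
  have i2 : q'.HolderConjugate q := ENNReal.HolderConjugate.symm
  have hM' : ∀ h : 𝓢'(Space n, ℂ), h ∈ twistedModulationSpace n lam p' q' ↔
      modulationNorm lam p' q' g h < ∞ := fun h =>
    mem_twistedModulationSpace_iff hlam (one_le_of_holderConjugate p' p)
      (one_le_of_holderConjugate q' q) hg
  have hM := fun f : modulationSubmodule n hlam hp hq =>
    (mem_modulationSubmodule hlam hp hq hg).1 f.2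
  obtain ⟨κ, hκ, hpair⟩ := exists_modulationPairing_ofSchwartz hlam hg
  obtain ⟨A, hA, hnorm⟩ := exists_modulationNorm_le_of_forall_schwartz hlam g p p' q q'
  set N := modulationSeminorm hlam hp hq hg
  have hS := ofSchwartz_mem_modulationSubmodule (n := n) hlam hp hq
  -- The left side is the modulus of the pairing with `φ`: a bound on Schwartz functions alone
  -- controls the dual norm. Both existence and norm equivalence use it.
  have hbound : ∀ (h : 𝓢'(Space n, ℂ)) (C : ℝ), 0 ≤ C →
      (∀ φ, κ * ‖h (conjSchwartz φ)‖ ≤ C * N ⟨ofSchwartz φ, hS φ⟩) →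
      modulationNorm lam p' q' g h ≤ ENNReal.ofReal (κ⁻¹ * C) * A := by
    intro h C hC hφ
    refine hnorm h _ fun φ => ?_
    have h1 : ‖h (conjSchwartz φ)‖ ≤ κ⁻¹ * C * N ⟨ofSchwartz φ, hS φ⟩ := by
      rw [mul_assoc, le_inv_mul_iff₀ hκ]
      exact hφ φ
    have h2 := ofReal_modulationSeminorm hlam hp hq hg ⟨ofSchwartz φ, hS φ⟩
    rw [← ofReal_norm, h2, ← ENNReal.ofReal_mul (by positivity)]
    exact ENNReal.ofReal_le_ofReal h1
  refine ⟨fun h hh => ?_, fun ℓ hℓ => ?_, ?_⟩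
  · rw [hM'] at hh
    refine ⟨pairingFunctional hlam hg hp hq p' q' hh, fun f => ⟨?_, rfl, ?_⟩⟩
    · exact integrable_pairingIntegrand hlam p p' q q' (hM f) hh
    · exact norm_modulationPairing_le hlam p p' q q' (hM f) hh
  · obtain ⟨C₀, hC₀⟩ := hℓ
    obtain ⟨C, hC0, hC⟩ : ∃ C : ℝ, 0 ≤ C ∧ ∀ f, ‖ℓ f‖ ≤ C * N f :=
      ⟨|C₀|, abs_nonneg _, fun f => (hC₀ f).trans
        (mul_le_mul_of_nonneg_right (le_abs_self _) (apply_nonneg N f))⟩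
    obtain ⟨P, hP, hPb⟩ := exists_modulationNorm_ofSchwartz_le hlam g hp hq
    have hPN : ∀ φ, N ⟨ofSchwartz φ, hS φ⟩ ≤ P φ := fun φ =>
      ENNReal.toReal_le_of_le_ofReal (apply_nonneg P φ) (hPb φ)
    let S : 𝓢(Space n, ℂ) → modulationSubmodule n hlam hp hq := fun φ => ⟨ofSchwartz φ, hS φ⟩
    have hSadd : ∀ φ ψ, S (φ + ψ) = S φ + S ψ := fun φ ψ =>
      Subtype.ext (map_add (SchwartzMap.toTemperedDistributionCLM (Space n) ℂ volume) φ ψ)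
    have hSsmul : ∀ (c : ℂ) φ, S (c • φ) = c • S φ := fun c φ =>
      Subtype.ext (map_smul (SchwartzMap.toTemperedDistributionCLM (Space n) ℂ volume) c φ)
    -- The formula for `h` is forced by the value of the pairing on Schwartz functions; the two
    -- conjugations make it complex linear.
    obtain ⟨h, hh⟩ := exists_distribution (n := n)
      { toFun := fun ψ => ((κ⁻¹ : ℝ) : ℂ) * conj (ℓ (S (conjSchwartz ψ)))
        map_add' := fun φ ψ => by
          rw [conjSchwartz_add, hSadd, map_add, map_add, mul_add]
        map_smul' := fun c φ => by
          rw [conjSchwartz_smul, hSsmul, map_smul, smul_eq_mul, map_mul, Complex.conj_conj,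
            RingHom.id_apply, smul_eq_mul]
          ring }
      (P := Real.toNNReal (κ⁻¹ * C) • conjSeminorm P)
      ((hP.comp continuous_conjSchwartz).const_smul (Real.toNNReal (κ⁻¹ * C)))
      (fun ψ => by
        change ‖((κ⁻¹ : ℝ) : ℂ) * conj (ℓ (S (conjSchwartz ψ)))‖ ≤
          (Real.toNNReal (κ⁻¹ * C) : ℝ) * P (conjSchwartz ψ)
        rw [Real.coe_toNNReal _ (by positivity), norm_mul, RCLike.norm_conj, Complex.norm_real,
          Real.norm_of_nonneg (inv_nonneg.2 hκ.le), mul_assoc]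
        gcongr
        exact (hC _).trans (mul_le_mul_of_nonneg_left (hPN _) hC0))
    have hh' : ∀ φ, (κ : ℂ) * conj (h (conjSchwartz φ)) = ℓ (S φ) := by
      intro φ
      have h1 : h (conjSchwartz φ) = ((κ⁻¹ : ℝ) : ℂ) * conj (ℓ (S φ)) := by
        rw [hh]
        change _ * conj (ℓ (S (conjSchwartz (conjSchwartz φ)))) = _
        rw [conjSchwartz_conjSchwartz]
      rw [h1, map_mul, Complex.conj_conj, Complex.conj_ofReal, ← mul_assoc, ← Complex.ofReal_mul,
        mul_inv_cancel₀ hκ.ne', Complex.ofReal_one, one_mul]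
    have hhM : modulationNorm lam p' q' g h < ∞ := by
      refine (hbound h C hC0 fun φ => ?_).trans_lt (ENNReal.mul_lt_top ENNReal.ofReal_lt_top hA)
      have h1 := congrArg norm (hh' φ)
      rw [norm_mul, RCLike.norm_conj, Complex.norm_real, Real.norm_of_nonneg hκ.le] at h1
      rw [h1]
      exact hC _
    refine ⟨h, ⟨(hM' h).2 hhM, fun f => ?_⟩, fun h₂ hh₂ => ?_⟩
    · set ℓ₂ := pairingFunctional hlam hg hp hq p' q' hhM
      set D := (modulationNorm lam p' q' g h).toReal
      have hD : 0 ≤ D := ENNReal.toReal_nonneg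
      have h2 : ∀ f, ‖ℓ₂ f‖ ≤ D * N f := fun f =>
        norm_modulationPairing_le hlam p p' q q' (hM f) hhM
      have h3 : ∀ φ, ℓ₂ (S φ) = ℓ (S φ) := fun φ => (hpair φ h).2.trans (hh' φ)
      change ℓ f = ℓ₂ f
      rw [← sub_eq_zero, ← norm_le_zero_iff]
      refine le_of_forall_pos_lt_add fun ε hε => ?_
      -- Both functionals are bounded, by `C` and `D`, and agree on Schwartz functions, so density
      -- gives equality; the `1` keeps the divisor positive.
      have hpos : 0 < C + D + 1 := by positivity
      obtain ⟨φ, hφ⟩ := exists_modulationSeminorm_sub_ofSchwartz_lt hlam hg hp hq hp' hq' f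
        (div_pos hε hpos)
      have h4 : ℓ f - ℓ₂ f = ℓ (f - S φ) - ℓ₂ (f - S φ) := by
        rw [map_sub, map_sub, h3]
        ring
      rw [h4, zero_add]
      change N (f - S φ) < _ at hφ
      rw [lt_div_iff₀ hpos] at hφ
      have h5 := norm_sub_le (ℓ (f - S φ)) (ℓ₂ (f - S φ))
      have h6 := hC (f - S φ)
      have h7 := h2 (f - S φ)
      nlinarith [apply_nonneg N (f - S φ)]
    -- Uniqueness needs only the pairings with Schwartz functions, which recover all values of the
    -- distribution.
    · ext ψ
      have h1 := (hh₂.2 (S (conjSchwartz ψ))).symm.trans (hh' (conjSchwartz ψ)).symm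
      rw [(hpair _ _).2, conjSchwartz_conjSchwartz] at h1
      have h2 := mul_left_cancel₀ (by exact_mod_cast hκ.ne') h1
      exact (starRingEnd ℂ).injective h2
  -- Adding `1` secures strict positivity, since `A` may vanish.
  · refine ⟨κ⁻¹ * A.toReal + 1, by positivity, fun h _ C hC hb => ?_⟩
    refine (hbound h C hC fun φ => ?_).trans ?_
    · have h1 := hb ⟨ofSchwartz φ, hS φ⟩
      rwa [(hpair φ h).2, norm_mul, RCLike.norm_conj, Complex.norm_real,
        Real.norm_of_nonneg hκ.le] at h1
    · conv_lhs => rw [← ENNReal.ofReal_toReal hA.ne, ← ENNReal.ofReal_mul (by positivity)]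
      refine ENNReal.ofReal_le_ofReal ?_
      nlinarith

end Duality
end TwistedMod
-- Assembly
theorem mainTheorem3 (n : ℕ) (lam : ℝ) (hlam : lam ≠ 0) :
    (∀ p q : ℝ≥0∞, 1 ≤ p → 1 ≤ q →
      ∃ M : Submodule ℂ 𝓢'(Space n, ℂ),
        (M : Set 𝓢'(Space n, ℂ)) = twistedModulationSpace n lam p q ∧
        ∀ g : 𝓢(Space n, ℂ), g ≠ 0 →
          ∃ N : Seminorm ℂ M,
            (∀ f : M, modulationNorm lam p q g (f : 𝓢'(Space n, ℂ)) = ENNReal.ofReal (N f)) ∧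
            IsBanachNorm N ∧
            (p ≠ ∞ → q ≠ ∞ →
              ((∀ φ : 𝓢(Space n, ℂ), ofSchwartz φ ∈ M) ∧
                ∀ f : M, ∀ ε : ℝ, 0 < ε →
                  ∃ φ : 𝓢(Space n, ℂ), ∃ hφ : ofSchwartz φ ∈ M, N (f - ⟨ofSchwartz φ, hφ⟩) < ε) ∧
              ∀ p' q' : ℝ≥0∞, p.HolderConjugate p' → q.HolderConjugate q' →
                IsDualUnderPairing lam g M N (twistedModulationSpace n lam p' q')
                  (modulationNorm lam p' q' g))) ∧
    (∀ p₁ q₁ p₂ q₂ : ℝ≥0∞, 1 ≤ p₁ → p₁ ≤ p₂ → 1 ≤ q₁ → q₁ ≤ q₂ →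
      twistedModulationSpace n lam p₁ q₁ ⊆ twistedModulationSpace n lam p₂ q₂) := by
  -- The subspace is fixed before the window; change of window lets every nonzero `g` norm the same
  -- space.
  refine ⟨fun p q hp hq => ⟨modulationSubmodule n hlam hp hq, rfl, fun g hg =>
    ⟨modulationSeminorm hlam hp hq hg, ofReal_modulationSeminorm hlam hp hq hg,
      isBanachNorm_modulationSeminorm hlam hp hq hg, fun hp' hq' => ⟨⟨?_, ?_⟩, ?_⟩⟩⟩, ?_⟩
  · exact ofSchwartz_mem_modulationSubmodule hlam hp hq
  · intro f ε hε
    obtain ⟨φ, hφ⟩ := exists_modulationSeminorm_sub_ofSchwartz_lt hlam hg hp hq hp' hq' f hε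
    exact ⟨φ, _, hφ⟩
  · intro p' q' hpp hqq
    exact isDualUnderPairing hlam hg hp hq hp' hq' p' q'
  · rintro p₁ q₁ p₂ q₂ hp hp' hq hq' f ⟨g, hg, -, hf⟩
    obtain ⟨C, hC, h⟩ := exists_modulationNorm_le hlam hg g hp hq hp' hq'
    exact (mem_twistedModulationSpace_iff hlam (hp.trans hp') (hq.trans hq') hg).2
      ((h f).trans_lt (ENNReal.mul_lt_top hC hf))
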